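/- **Conventions.** $\lambda$ is the security parameter, given to every algorithm in unary, and a function is negligible if it tends to $0$ faster than the inverse of every polynomial. Honest algorithms are uniform: "polynomial time" means deterministic polynomial time, "PPT" means probabilistic polynomial time (a deterministic polynomial-time algorithm with a uniformly random tape of polynomial length). Adversaries are non-uniform: a QPT adversary is a polynomial-time quantum algorithm that gets, for every $\lambda$, an advice string and an advice quantum state, both of polynomial size; an adversarial PPT sampler gets an advice string of polynomial size. A function that is hard-wired into a circuit (a PRF with a given key, a decryption function with a given key, a PRG) is given by a Boolean circuit which is computed in polynomial time from $1^\lambda$ and the key. The size of a circuit is its number of gates. **Tools.** Let $k,\ell,n,m:\mathbb N\to\mathbb N$ be functions of $\lambda$, where $k(\lambda)$ is computable in time polynomial in $\lambda$ and in unary; put $\ell_{\mathsf{pt}}=\ell+\lceil\log_2 k\rceil+1$. * *Puncturable PRF* $(\mathsf{Gen},\mathsf{Puncture},\mathsf F)$, $\mathsf F_K:\{0,1\}^n\to\{0,1\}^m$; $\mathsf{Gen}$, $\mathsf{Puncture}$ are PPT. It is *secure* if (i) for every finite $S\subseteq\{0,1\}^n$, $x\in\{0,1\}^n\setminus S$,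 $K\leftarrow\mathsf{Gen}(1^\lambda)$, $K_{\notin S}\leftarrow\mathsf{Puncture}(K,S)$, always $\mathsf F_K(x)=\mathsf F_{K_{\notin S}}(x)$; and (ii) for every sequence of polynomial-size sets $S=S_\lambda$, no QPT adversary distinguishes $(K_{\notin S},(\mathsf F_K(x))_{x\in S})$ from $(K_{\notin S},(y_x)_{x\in S})$, with uniform independent $y_x\in\{0,1\}^m$, with non-negligible advantage. * *PRG* $\mathsf{PRG}:\{0,1\}^{\ell}\to\{0,1\}^{m}$, $\ell<m$, *secure*: no QPT adversary distinguishes $\mathsf{PRG}(s)$, $s\leftarrow\{0,1\}^\ell$, from a uniform $m$-bit string with non-negligible advantage. * *Puncturable encryption* $\mathsf{PE}=(\mathsf{Gen},\mathsf{Puncture},\mathsf{Enc},\mathsf{Dec})$ with plaintexts $\{0,1\}^{\ell_{\mathsf{pt}}}$ and ciphertexts $\{0,1\}^{n}$; the first three algorithms are PPT, $\mathsf{Dec}$ is deterministic with values in $\{0,1\}^{\ell_{\mathsf{pt}}}\cup\{\bot\}$. It is *secure with strong ciphertext pseudorandomness* if, for $(\mathsf{ek},\mathsf{dk})\leftarrow\mathsf{Gen}(1^\lambda)$: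 (i) always $\mathsf{Dec}(\mathsf{dk},\mathsf{Enc}(\mathsf{ek},p))=p$; (ii) always $\mathsf{Dec}(\mathsf{dk}_{\neq c^*},c)=\mathsf{Dec}(\mathsf{dk},c)$ for all $c\ne c^*$ in $\{0,1\}^n$ and $\mathsf{dk}_{\ne c^*}\leftarrow\mathsf{Puncture}(\mathsf{dk},c^*)$; (iii) for uniform $c\in\{0,1\}^n$, $\Pr[\mathsf{Dec}(\mathsf{dk},c)\neq\bot]$ is negligible; (iv) every QPT adversary has negligible advantage $2|\Pr[\mathsf{coin}'=\mathsf{coin}]-\frac12|$ in the game in which it sends $p^*\in\{0,1\}^{\ell_{\mathsf{pt}}}$, the challenger generates $(\mathsf{ek},\mathsf{dk})$, $x_0\leftarrow\mathsf{Enc}(\mathsf{ek},p^*)$, $x_1\leftarrow\{0,1\}^n$, $\mathsf{coin}\leftarrow\{0,1\}$, $\mathsf{dk}'\leftarrow\mathsf{Puncture}(\mathsf{dk},x_{\mathsf{coin}})$ and sends $(x_{\mathsf{coin}},\mathsf{ek},\mathsf{dk}')$, and the adversary outputs $\mathsf{coin}'$. * *Indistinguishability obfuscator* $i\mathcal O$: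 a PPT algorithm that maps $1^\lambda$ and a Boolean circuit to a Boolean circuit. It is *secure* if always $i\mathcal O(1^\lambda,C)$ computes the same function as $C$, and, for every non-uniform PPT sampler $\mathsf{Samp}(1^\lambda)\to(C_0,C_1,\mathsf{aux})$ such that except with negligible probability $C_0,C_1$ have the same size and compute the same function, no QPT adversary distinguishes $(i\mathcal O(1^\lambda,C_0),\mathsf{aux})$ from $(i\mathcal O(1^\lambda,C_1),\mathsf{aux})$ with non-negligible advantage. **Construction $\mathsf{PRF}_{\mathsf{io}}$ with padding $P$.** $\mathsf{Setup}(1^\lambda)$ outputs $(\mathsf{pp},\mathsf{xk})=(\bot,\bot)$. $\mathsf{Gen}$ samples a PRF key $K$ and $(\mathsf{ek},\mathsf{dk})\leftarrow\mathsf{PE}.\mathsf{Gen}(1^\lambda)$ and outputs $\mathsf{prfk}=(K,\mathsf{dk})$ and the tag $\tau=\mathsf{ek}$. $\mathsf{Eval}(\mathsf{prfk},x)=\mathsf F_K(x)$. $\mathsf{Mark}(\mathsf{prfk},\mathsf m)$, for $\mathsf m\in\{0,1\}^k$, outputs $i\mathcal O(1^\lambda,D)$, where $D$ is the circuit, padded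 to $P(\lambda)$ gates, that on input $x\in\{0,1\}^n$ computes $d=\mathsf{Dec}(\mathsf{dk},x)$, outputs $\mathsf{PRG}(s)$ if $d=s\|i\|\gamma$ with $s\in\{0,1\}^\ell$, $i\in[k]$ (encoded in $\lceil\log_2k\rceil$ bits), $\gamma\in\{0,1\}$ and $\mathsf m[i]\ne\gamma$, and outputs $\mathsf F_K(x)$ otherwise. $\mathsf{Sim}(\mathsf{xk},\tau,i)$ samples $\gamma\leftarrow\{0,1\}$, $s\leftarrow\{0,1\}^\ell$ and outputs $(\gamma,x,y)$ with $x\leftarrow\mathsf{Enc}(\mathsf{ek},s\|i\|\gamma)$, $y=\mathsf{PRG}(s)$. **Theorem.** If the puncturable PRF, the PRG, the puncturable encryption scheme (with strong ciphertext pseudorandomness) and $i\mathcal O$ are secure, then there is a polynomial $P_0$ such that for every polynomial $P\ge P_0$ (with natural coefficients) $\mathsf{PRF}_{\mathsf{io}}$ with padding $P$ is an extraction-less watermarking PRF with message space $\{0,1\}^k$, domain $\{0,1\}^n$ and range $\{0,1\}^m$ that is SIM-MDD secure with public simulation. That is: 1. $\mathsf{Setup},\mathsf{Gen},\mathsf{Mark},\mathsf{Sim}$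 are PPT, $\mathsf{Eval}$ is polynomial time, all outputs have the right format, and evaluation correctness holds: for all messages $\mathsf m=\mathsf m_\lambda\in\{0,1\}^k$, $\Pr[\widetilde C(x)=\mathsf{Eval}(\mathsf{prfk},x)]\ge1-\mathrm{negl}(\lambda)$ over $(\mathsf{pp},\mathsf{xk})\leftarrow\mathsf{Setup}(1^\lambda)$, $(\mathsf{prfk},\tau)\leftarrow\mathsf{Gen}(\mathsf{pp})$, $\widetilde C\leftarrow\mathsf{Mark}(\mathsf{pp},\mathsf{prfk},\mathsf m)$, $x\leftarrow\{0,1\}^n$. 2. For every $i^*=i^*(\lambda)\in[k]$ every QPT adversary has negligible advantage $2|\Pr[\mathsf{coin}'=\mathsf{coin}]-\frac12|$ in the following game. The challenger sends $(\mathsf{pp},\mathsf{xk})\leftarrow\mathsf{Setup}(1^\lambda)$; the adversary sends $\mathsf m\in\{0,1\}^k$; the challenger generates $(\mathsf{prfk},\tau)\leftarrow\mathsf{Gen}(\mathsf{pp})$, $\widetilde C\leftarrow\mathsf{Mark}(\mathsf{pp},\mathsf{prfk},\mathsf m)$ and $\mathsf{coin}\leftarrow\{0,1\}$. If $\mathsf{coin}=1$,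 then $(\gamma,x,y)\leftarrow\mathsf{Sim}(\mathsf{xk},\tau,i^*)$. If $\mathsf{coin}=0$, then $\gamma\leftarrow\{0,1\}$, $x\leftarrow\{0,1\}^n$, and $y\leftarrow\{0,1\}^m$ if $\gamma=\mathsf m[i^*]$, $y=\mathsf{Eval}(\mathsf{prfk},x)$ if $\gamma\neq\mathsf m[i^*]$. The adversary gets $\tau,\widetilde C,(\gamma,x,y)$ and outputs $\mathsf{coin}'$. -/

import Mathlib

namespace ELWM

/-! ## Data, programs and running time

The machine model is a small LISP-like language over binary trees with an explicit step count.
Every instruction is charged at least the size of the tree that it reads, so that a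
computation takes at least as many steps as the sizes of its input and of its output, and one
step costs a (multi-tape) Turing machine polynomial time only, and conversely. -/

/-- Binary trees, the data type of the machine. -/
inductive Val where
  | leaf : Val
  | node : Val → Val → Val

/-- The size of a tree: its number of vertices. -/
def Val.size : Val → ℕ
  | .leaf => 1
  | .node a b => a.size + b.size + 1

/-- Programs. -/
inductive Code where
  | id : Code
  | nil : Code
  | left : Code
  | right : Code
  | pair : Code → Code → Code
  | comp : Code → Code → Code
  | cond : Code → Code → Code → Code
  | loop : Code → Code → Code

/-- `Runs c x y t`: program `c` halts on input `x` with output `y` after `t` steps. The truth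
value of a tree is `false` for `leaf` and `true` for `node _ _`; `comp f g` is "first `g`, then
`f`"; `loop c f` is "while `c` is true do `f`". -/
inductive Runs : Code → Val → Val → ℕ → Prop where
  | id (x : Val) : Runs .id x x (x.size + 1)
  | nil (x : Val) : Runs .nil x .leaf (x.size + 1)
  | left_leaf : Runs .left .leaf .leaf 2
  | left_node (a b : Val) : Runs .left (.node a b) a ((Val.node a b).size + 1)
  | right_leaf : Runs .right .leaf .leaf 2
  | right_node (a b : Val) : Runs .right (.node a b) b ((Val.node a b).size + 1)
  | pair {f g : Code} {x a b : Val} {s t : ℕ} :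
      Runs f x a s → Runs g x b t → Runs (.pair f g) x (.node a b) (s + t + x.size + 1)
  | comp {f g : Code} {x y z : Val} {s t : ℕ} :
      Runs g x y s → Runs f y z t → Runs (.comp f g) x z (s + t + 1)
  | cond_false {c f g : Code} {x y : Val} {s t : ℕ} :
      Runs c x .leaf s → Runs g x y t → Runs (.cond c f g) x y (s + t + x.size + 1)
  | cond_true {c f g : Code} {x a b y : Val} {s t : ℕ} :
      Runs c x (.node a b) s → Runs f x y t → Runs (.cond c f g) x y (s + t + x.size + 1)
  | loop_stop {c f : Code} {x : Val} {s : ℕ} :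
      Runs c x .leaf s → Runs (.loop c f) x x (s + x.size + 1)
  | loop_step {c f : Code} {x a b y z : Val} {s t u : ℕ} :
      Runs c x (.node a b) s → Runs f x y t → Runs (.loop c f) y z u →
      Runs (.loop c f) x z (s + t + u + x.size + 1)

/-- A type whose elements are written down as trees (without ambiguity). -/
class TreeEnc (α : Type) where
  enc : α → Val
  enc_inj : Function.Injective enc

open TreeEnc in
/-- The size of the representation of an object. -/
def esize {α : Type} [TreeEnc α] (a : α) : ℕ := (enc a).size

instance : TreeEnc Val := ⟨fun v => v, fun _ _ h => h⟩

instance : TreeEnc Unit := ⟨fun _ => .leaf, fun _ _ _ => rfl⟩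

instance : TreeEnc Bool where
  enc b := match b with
    | false => .leaf
    | true => .node .leaf .leaf
  enc_inj a b h := by cases a <;> cases b <;> simp_all

/-- Natural numbers are written in unary; in particular the machine reads the security
parameter `lam` as `1^lam`. -/
def encNat : ℕ → Val
  | 0 => .leaf
  | n + 1 => .node .leaf (encNat n)

theorem encNat_inj : Function.Injective encNat := by
  intro a
  induction a with
  | zero => intro b h; cases b <;> simp_all [encNat]
  | succ n ih =>
    intro b h
    cases b with
    | zero => simp [encNat] at h
    | succ m => simp only [encNat, Val.node.injEq, true_and] at h; rw [ih h]

instance : TreeEnc ℕ := ⟨encNat, encNat_inj⟩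

instance {α β : Type} [TreeEnc α] [TreeEnc β] : TreeEnc (α × β) where
  enc p := .node (TreeEnc.enc p.1) (TreeEnc.enc p.2)
  enc_inj p q h := by
    simp only [Val.node.injEq] at h
    exact Prod.ext (TreeEnc.enc_inj h.1) (TreeEnc.enc_inj h.2)

def encList {α : Type} [TreeEnc α] : List α → Val
  | [] => .leaf
  | a :: l => .node (TreeEnc.enc a) (encList l)

theorem encList_inj {α : Type} [TreeEnc α] : Function.Injective (encList (α := α)) := by
  intro a
  induction a with
  | nil => intro b h; cases b <;> simp_all [encList]
  | cons x l ih =>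
    intro b h
    cases b with
    | nil => simp [encList] at h
    | cons y m =>
      simp only [encList, Val.node.injEq] at h
      rw [ih h.2, TreeEnc.enc_inj h.1]

instance {α : Type} [TreeEnc α] : TreeEnc (List α) := ⟨encList, encList_inj⟩

/-- `f` is computed by a deterministic polynomial-time program. -/
def PolyTime {α β : Type} [TreeEnc α] [TreeEnc β] (f : α → β) : Prop :=
  ∃ (c : Code) (p : Polynomial ℕ), ∀ a : α, ∃ t : ℕ, t ≤ p.eval (esize a) ∧
    Runs c (TreeEnc.enc a) (TreeEnc.enc (f a)) t

/-! ## Probabilistic polynomial time -/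

/-- The uniform distribution on the bit strings of length `n`. -/
noncomputable def unifBits (n : ℕ) : PMF (List Bool) :=
  (PMF.uniformOfFintype (Fin n → Bool)).map List.ofFn

/-- A uniform bit. -/
noncomputable def unifBit : PMF Bool := PMF.uniformOfFintype Bool

/-- `r` independent uniform bit strings of length `n`. -/
noncomputable def unifStrings (n : ℕ) : ℕ → PMF (List (List Bool))
  | 0 => pure []
  | r + 1 => do
    let y ← unifBits n
    let ys ← unifStrings n r
    pure (y :: ys)

/-- `A` is a (uniform) PPT algorithm: a polynomial-time program that is run on its input and on
a uniformly random tape whose length is a polynomial in the size of the input. -/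
def PPT {α β : Type} [TreeEnc α] [TreeEnc β] (A : α → PMF β) : Prop :=
  ∃ (f : α × List Bool → β) (p : Polynomial ℕ), PolyTime f ∧
    ∀ a, A a = (unifBits (p.eval (esize a))).map fun r => f (a, r)

/-- `v` is a sequence of trees of polynomial size. -/
def PolySize (v : ℕ → Val) : Prop := ∃ p : Polynomial ℕ, ∀ lam, (v lam).size ≤ p.eval lam

/-- `S` is a non-uniform PPT sampler: the output on `1^lam` of a PPT algorithm that is helped by
an advice string of polynomial size. -/
def NonuniformPPTSampler {β : Type} [TreeEnc β] (S : ℕ → PMF β) : Prop :=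
  ∃ (adv : ℕ → Val) (A : ℕ × Val → PMF β), PolySize adv ∧ PPT A ∧ ∀ lam, S lam = A (lam, adv lam)

/-- Negligible functions. -/
def Negligible (f : ℕ → ℝ) : Prop :=
  Asymptotics.SuperpolynomialDecay Filter.atTop (fun lam : ℕ => (lam : ℝ)) f

/-- The probability of the outcome `true`, as a real number. -/
noncomputable def prTrue (p : PMF Bool) : ℝ := (p true).toReal

/-! ## Quantum circuits -/

/-- Pure states of `n` qubits: unit vectors, in the computational basis. -/
structure QState (n : ℕ) where
  vec : (Fin n → Bool) → ℂ
  norm_one : ∑ b, ‖vec b‖ ^ 2 = 1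

/-- The gate set Hadamard, `T`, controlled NOT. -/
inductive QGate where
  | H (i : ℕ) : QGate
  | T (i : ℕ) : QGate
  | CNOT (i j : ℕ) : QGate

/-- A quantum circuit: `anc` fresh ancillas in state `|0⟩` are appended to the register, the
gates are applied in turn, and the qubits listed in `out` are measured. -/
structure QCircuit where
  anc : ℕ
  gates : List QGate
  out : List ℕ

def QGate.toTuple : QGate → ℕ × ℕ × ℕ
  | .H i => (0, i, 0)
  | .T i => (1, i, 0)
  | .CNOT i j => (2, i, j)

theorem QGate.toTuple_inj : Function.Injective QGate.toTuple := by
  intro a b h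
  cases a <;> cases b <;> simp_all [QGate.toTuple]

instance : TreeEnc QGate where
  enc g := TreeEnc.enc g.toTuple
  enc_inj _ _ h := QGate.toTuple_inj (TreeEnc.enc_inj h)

instance : TreeEnc QCircuit where
  enc C := TreeEnc.enc (C.anc, C.gates, C.out)
  enc_inj C D h := by
    have := TreeEnc.enc_inj h
    cases C; cases D; simp_all

/-- Flip qubit `j` if qubit `i` is 1. -/
def cnotMap {n : ℕ} (i j : Fin n) (b : Fin n → Bool) : Fin n → Bool :=
  Function.update b j (b j ^^ b i)

theorem cnotMap_involutive {n : ℕ} {i j : Fin n} (h : i ≠ j) :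
    Function.Involutive (cnotMap i j) := by
  intro b
  funext t
  by_cases ht : t = j
  · subst ht; simp [cnotMap, h]
  · simp [cnotMap, ht]

noncomputable def hadamard {n : ℕ} (i : Fin n) (ψ : (Fin n → Bool) → ℂ) (b : Fin n → Bool) : ℂ :=
  (ψ (Function.update b i false) + (if b i then -1 else 1) * ψ (Function.update b i true)) / √2

theorem hadamard_pair {n : ℕ} (i : Fin n) (ψ : (Fin n → Bool) → ℂ) (b : Fin n → Bool) :
    ‖hadamard i ψ b‖ ^ 2 + ‖hadamard i ψ (Function.update b i (!b i))‖ ^ 2 =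
      ‖ψ b‖ ^ 2 + ‖ψ (Function.update b i (!b i))‖ ^ 2 := by
  have key : ∀ u v : ℂ, ‖(u + v) / (√2 : ℝ)‖ ^ 2 + ‖(u - v) / (√2 : ℝ)‖ ^ 2 = ‖u‖ ^ 2 + ‖v‖ ^ 2 := by
    intro u v
    have h2 : ‖((√2 : ℝ) : ℂ)‖ ^ 2 = 2 := by
      rw [Complex.norm_real, Real.norm_eq_abs, sq_abs]; exact Real.sq_sqrt (by norm_num)
    have hp := parallelogram_law_with_norm ℝ u v
    rw [norm_div, norm_div, div_pow, div_pow, h2]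
    nlinarith [hp]
  have hb : Function.update b i (b i) = b := Function.update_eq_self i b
  cases hbi : b i <;> rw [hbi] at hb
  · have := key (ψ b) (ψ (Function.update b i true))
    simpa [hadamard, hbi, hb, sub_eq_add_neg] using this
  · have := key (ψ (Function.update b i false)) (ψ b)
    simp only [hadamard, hbi, hb, Function.update_idem, Function.update_self, Bool.not_true,
      if_true, Bool.false_eq_true, if_false, neg_mul, one_mul, ← sub_eq_add_neg] at this ⊢
    linarith

theorem flip_involutive {n : ℕ} (i : Fin n) :
    Function.Involutive fun b : Fin n → Bool => Function.update b i (!b i) := by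
  intro b
  simp

theorem hadamard_norm {n : ℕ} (i : Fin n) (ψ : (Fin n → Bool) → ℂ) :
    ∑ b, ‖hadamard i ψ b‖ ^ 2 = ∑ b, ‖ψ b‖ ^ 2 := by
  have e : ∀ F : (Fin n → Bool) → ℝ, ∑ b, F (Function.update b i (!b i)) = ∑ b, F b := fun F =>
    Equiv.sum_comp (flip_involutive i).toPerm F
  have h := Finset.sum_congr (rfl : (Finset.univ : Finset (Fin n → Bool)) = Finset.univ)
    fun b _ => hadamard_pair i ψ b
  rw [Finset.sum_add_distrib, Finset.sum_add_distrib, e fun b => ‖hadamard i ψ b‖ ^ 2,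
    e fun b => ‖ψ b‖ ^ 2] at h
  linarith

/-- The action of a gate; a gate that names a qubit outside the register, or the same qubit
twice, does nothing. -/
noncomputable def QGate.apply {n : ℕ} (g : QGate) (ψ : QState n) : QState n :=
  match g with
  | .H i => if hi : i < n then ⟨hadamard ⟨i, hi⟩ ψ.vec, by rw [hadamard_norm, ψ.norm_one]⟩ else ψ
  | .T i => if hi : i < n then
      ⟨fun b => (if b ⟨i, hi⟩ then Complex.exp ((Real.pi / 4 : ℝ) * Complex.I) else 1) * ψ.vec b, by
        refine Eq.trans ?_ ψ.norm_one
        refine Finset.sum_congr rfl fun b _ => ?_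
        rw [norm_mul]
        split_ifs
        · rw [Complex.norm_exp_ofReal_mul_I, one_mul]
        · simp⟩
      else ψ
  | .CNOT i j => if h : ∃ (hi : i < n) (hj : j < n), (⟨i, hi⟩ : Fin n) ≠ ⟨j, hj⟩ then
      ⟨fun b => ψ.vec (cnotMap ⟨i, h.1⟩ ⟨j, h.2.1⟩ b), by
        refine Eq.trans ?_ ψ.norm_one
        exact Equiv.sum_comp (cnotMap_involutive h.2.2).toPerm fun b => ‖ψ.vec b‖ ^ 2⟩
      else ψ

/-- Append `a` qubits in state `|0⟩`. -/
noncomputable def QState.extend {n : ℕ} (ψ : QState n) (a : ℕ) : QState (n + a) :=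
  ⟨fun b => if ∀ j : Fin a, b (Fin.natAdd n j) = false then ψ.vec fun i => b (Fin.castAdd a i)
    else 0, by
    refine Eq.trans ?_ ψ.norm_one
    rw [← Equiv.sum_comp (Fin.appendEquiv n a), Fintype.sum_prod_type]
    refine Finset.sum_congr rfl fun u _ => ?_
    rw [Finset.sum_eq_single fun _ => false]
    · simp [Fin.appendEquiv]
    · intro v _ hv
      rw [if_neg]
      · simp
      · intro h
        apply hv
        funext j
        simpa [Fin.appendEquiv] using h j
    · simp⟩

/-- The outcome of measuring all qubits. -/
noncomputable def QState.measure {n : ℕ} (ψ : QState n) : PMF (Fin n → Bool) :=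
  PMF.ofFintype (fun b => ENNReal.ofReal (‖ψ.vec b‖ ^ 2)) (by
    rw [← ENNReal.ofReal_sum_of_nonneg fun _ _ => by positivity, ψ.norm_one, ENNReal.ofReal_one])

/-- The post-measurement state when the measurement of the classical information `f` about the
register has had outcome `o`. -/
noncomputable def QState.collapse {n : ℕ} (ψ : QState n) (f : (Fin n → Bool) → List Bool)
    (o : List Bool) : QState n :=
  if h : ∑ b, (if f b = o then ‖ψ.vec b‖ ^ 2 else 0) = 0 then ψ else
    ⟨fun b => if f b = o then ψ.vec b / √(∑ b, if f b = o then ‖ψ.vec b‖ ^ 2 else 0) else 0, by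
      have h0 : 0 ≤ ∑ b, (if f b = o then ‖ψ.vec b‖ ^ 2 else 0) :=
        Finset.sum_nonneg fun b _ => by split_ifs <;> positivity
      refine Eq.trans ?_ (div_self h)
      rw [Finset.sum_div]
      refine Finset.sum_congr rfl fun b _ => ?_
      split_ifs with hb
      · rw [norm_div, div_pow, Complex.norm_real, Real.norm_eq_abs, sq_abs, Real.sq_sqrt h0]
      · simp⟩

/-- Measure the information `f` about the register: outcome and post-measurement state. (The
outcome of the partial measurement is distributed as the value of `f` at the outcome of a
measurement of all qubits.) -/
noncomputable def QState.measurePart {n : ℕ} (ψ : QState n) (f : (Fin n → Bool) → List Bool) :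
    PMF (List Bool × QState n) :=
  ψ.measure.map fun b => (f b, ψ.collapse f (f b))

/-- The bits of `b` at the listed positions (0 at a position outside the register). -/
def readBits {n : ℕ} (out : List ℕ) (b : Fin n → Bool) : List Bool :=
  out.map fun i => if h : i < n then b ⟨i, h⟩ else false

/-- Quantum registers of arbitrary size. -/
abbrev QReg : Type := Σ n : ℕ, QState n

/-- Run a quantum circuit on a register: measured bits and post-measurement register. -/
noncomputable def QCircuit.run (C : QCircuit) (ψ : QReg) : PMF (List Bool × QReg) :=
  ((C.gates.foldl (fun φ g => g.apply φ) (ψ.2.extend C.anc)).measurePart (readBits C.out)).map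
    fun r => (r.1, ⟨_, r.2⟩)

/-! ## Quantum polynomial-time adversaries -/

/-- A polynomial-time quantum algorithm with classical input in `α` and classical output in `β`
that acts on a quantum register: from its input it computes in polynomial time a quantum circuit,
runs this circuit on the register, and computes its output in polynomial time from its input
and the measured bits. -/
structure QAlg (α β : Type) [TreeEnc α] [TreeEnc β] where
  circ : α → QCircuit
  post : α × List Bool → β
  circ_poly : PolyTime circ
  post_poly : PolyTime post

/-- Output and remaining quantum register. -/
noncomputable def QAlg.run {α β : Type} [TreeEnc α] [TreeEnc β] (A : QAlg α β) (a : α) (ψ : QReg) :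
    PMF (β × QReg) :=
  ((A.circ a).run ψ).map fun r => (A.post (a, r.1), r.2)

/-- Non-uniform advice: for every security parameter a string and a quantum state, both of
polynomial size. -/
structure Advice where
  str : ℕ → Val
  reg : ℕ → QReg
  str_poly : PolySize str
  reg_poly : ∃ p : Polynomial ℕ, ∀ lam, (reg lam).1 ≤ p.eval lam

/-- A (non-uniform) QPT distinguisher with input in `α`. Coin tosses are available through
measurements of Hadamard-transformed ancillas. -/
structure Distinguisher (α : Type) [TreeEnc α] where
  adv : Advice
  alg : QAlg (ℕ × Val × α) Bool

noncomputable def Distinguisher.run {α : Type} [TreeEnc α] (A : Distinguisher α) (lam : ℕ) (a : α) :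
    PMF Bool :=
  (A.alg.run (lam, A.adv.str lam, a) (A.adv.reg lam)).map Prod.fst

/-- A (non-uniform) QPT adversary with two stages. The first stage gets an element of `α` and
sends a message of length `len lam`; the second stage goes on with the quantum register that the
first stage has left, gets in addition an element of `β`, and outputs a bit. -/
structure TwoStage (α β : Type) [TreeEnc α] [TreeEnc β] (len : ℕ → ℕ) where
  adv : Advice
  stage1 : QAlg (ℕ × Val × α) (List Bool)
  stage2 : QAlg (ℕ × Val × α × List Bool × β) Bool
  stage1_length : ∀ lam a o, (stage1.post ((lam, adv.str lam, a), o)).length = len lam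

noncomputable def TwoStage.first {α β : Type} [TreeEnc α] [TreeEnc β] {len : ℕ → ℕ}
    (A : TwoStage α β len) (lam : ℕ) (a : α) : PMF (List Bool × QReg) :=
  A.stage1.run (lam, A.adv.str lam, a) (A.adv.reg lam)

noncomputable def TwoStage.second {α β : Type} [TreeEnc α] [TreeEnc β] {len : ℕ → ℕ}
    (A : TwoStage α β len) (lam : ℕ) (a : α) (msg : List Bool) (b : β) (ψ : QReg) : PMF Bool :=
  (A.stage2.run (lam, A.adv.str lam, a, msg, b) ψ).map Prod.fst

/-! ## Boolean circuits -/

/-- A gate of fan-in two: an arbitrary Boolean function of the wires `i` and `j`. -/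
structure Gate where
  op : Bool → Bool → Bool
  i : ℕ
  j : ℕ

/-- A Boolean circuit. The wires are numbered: first the `numIn` inputs, then one wire for the
output of each gate in turn. The outputs of the circuit are the wires listed in `outs`. -/
structure Circuit where
  numIn : ℕ
  gates : List Gate
  outs : List ℕ

def Gate.toTuple (g : Gate) : Bool × Bool × Bool × Bool × ℕ × ℕ :=
  (g.op false false, g.op false true, g.op true false, g.op true true, g.i, g.j)

theorem Gate.toTuple_inj : Function.Injective Gate.toTuple := by
  rintro ⟨f, i, j⟩ ⟨g, i', j'⟩ h
  simp only [Gate.toTuple, Prod.mk.injEq] at h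
  obtain ⟨h1, h2, h3, h4, h5, h6⟩ := h
  have : f = g := by
    funext a b
    cases a <;> cases b <;> assumption
  simp [this, h5, h6]

instance : TreeEnc Gate where
  enc g := TreeEnc.enc g.toTuple
  enc_inj _ _ h := Gate.toTuple_inj (TreeEnc.enc_inj h)

instance : TreeEnc Circuit where
  enc C := TreeEnc.enc (C.numIn, C.gates, C.outs)
  enc_inj C D h := by
    have := TreeEnc.enc_inj h
    cases C; cases D; simp_all

/-- The value of wire `w`, given the values of the wires that exist so far; a wire that does not
exist (yet) reads as 0. -/
def wire (ws : List Bool) (w : ℕ) : Bool := ws.getD w false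

/-- Append to the list of wire values the values of further gates. -/
def evalGates (ws : List Bool) (gs : List Gate) : List Bool :=
  gs.foldl (fun ws g => ws ++ [g.op (wire ws g.i) (wire ws g.j)]) ws

/-- The output of a circuit on a bit string of length `numIn`. -/
def Circuit.eval (C : Circuit) (x : List Bool) : List Bool :=
  C.outs.map (wire (evalGates x C.gates))

/-- The size of a circuit: its number of gates. -/
def Circuit.size (C : Circuit) : ℕ := C.gates.length

/-- The circuit has `n` input bits and `m` output bits. -/
def Circuit.HasArity (C : Circuit) (n m : ℕ) : Prop := C.numIn = n ∧ C.outs.length = m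

/-- Two circuits of the same size and arity that compute the same function. -/
def Circuit.Equivalent (C D : Circuit) : Prop :=
  C.size = D.size ∧ D.HasArity C.numIn C.outs.length ∧
    ∀ x : List Bool, x.length = C.numIn → C.eval x = D.eval x

/-! ## Cryptographic tools -/

/-- Indistinguishability obfuscation for (polynomial-size) Boolean circuits. -/
structure IsSecureIO (iO : ℕ → Circuit → PMF Circuit) : Prop where
  ppt : PPT fun a : ℕ × Circuit => iO a.1 a.2
  functionality : ∀ lam C, ∀ C' ∈ (iO lam C).support,
    C'.HasArity C.numIn C.outs.length ∧ ∀ x : List Bool, x.length = C.numIn → C'.eval x = C.eval x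
  indistinguishability : ∀ Samp : ℕ → PMF (Circuit × Circuit × Val), NonuniformPPTSampler Samp →
    ∀ A : Distinguisher (Circuit × Val),
    Negligible (fun lam =>
      ((Samp lam).toOuterMeasure {c | ¬ Circuit.Equivalent c.1 c.2.1}).toReal) →
    Negligible fun lam =>
      |prTrue (do
          let c ← Samp lam
          let C' ← iO lam c.1
          A.run lam (C', c.2.2))
        - prTrue (do
          let c ← Samp lam
          let C' ← iO lam c.2.1
          A.run lam (C', c.2.2))|

/-- `PRG` (a sequence of circuits that is computable in polynomial time) is a secure
pseudorandom generator `{0,1}^(l lam) → {0,1}^(m lam)`. -/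
structure IsSecurePRG (PRG : ℕ → Circuit) (l m : ℕ → ℕ) : Prop where
  poly : PolyTime PRG
  arity : ∀ lam, (PRG lam).HasArity (l lam) (m lam)
  stretch : ∀ lam, l lam < m lam
  pseudorandom : ∀ A : Distinguisher (List Bool),
    Negligible fun lam =>
      |prTrue (do
          let s ← unifBits (l lam)
          A.run lam ((PRG lam).eval s))
        - prTrue (do
          let r ← unifBits (m lam)
          A.run lam r)|

/-- Syntax of puncturable PRFs. `evalCirc lam K` is the evaluation circuit of the (possibly
punctured) key `K`. Finite sets of inputs are given as lists. -/
structure PuncturablePRF where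
  gen : ℕ → PMF Val
  puncture : ℕ → Val → List (List Bool) → PMF Val
  evalCirc : ℕ → Val → Circuit

/-- The value of the function with key `K`. -/
def PuncturablePRF.F (P : PuncturablePRF) (lam : ℕ) (K : Val) (x : List Bool) : List Bool :=
  (P.evalCirc lam K).eval x

/-- A set of `n`-bit strings (as a list without repetitions). -/
def IsStringSet (n : ℕ) (S : List (List Bool)) : Prop := S.Nodup ∧ ∀ x ∈ S, x.length = n

/-- Secure puncturable PRFs with domain `{0,1}^(n lam)` and range `{0,1}^(m lam)`. -/
structure PuncturablePRF.IsSecure (P : PuncturablePRF) (n m : ℕ → ℕ) : Prop where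
  gen_ppt : PPT P.gen
  puncture_ppt : PPT fun a : ℕ × Val × List (List Bool) => P.puncture a.1 a.2.1 a.2.2
  evalCirc_poly : PolyTime fun a : ℕ × Val => P.evalCirc a.1 a.2
  arity : ∀ lam K, (P.evalCirc lam K).HasArity (n lam) (m lam)
  punctured_correctness : ∀ lam (S : List (List Bool)), IsStringSet (n lam) S →
    ∀ x : List Bool, x.length = n lam → x ∉ S →
    ∀ K ∈ (P.gen lam).support, ∀ K' ∈ (P.puncture lam K S).support, P.F lam K x = P.F lam K' x
  punctured_pseudorandom : ∀ S : ℕ → List (List Bool), (∀ lam, IsStringSet (n lam) (S lam)) →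
    (∃ p : Polynomial ℕ, ∀ lam, (S lam).length ≤ p.eval lam) →
    ∀ A : Distinguisher (Val × List (List Bool)),
    Negligible fun lam =>
      |prTrue (do
          let K ← P.gen lam
          let K' ← P.puncture lam K (S lam)
          A.run lam (K', (S lam).map (P.F lam K)))
        - prTrue (do
          let K ← P.gen lam
          let K' ← P.puncture lam K (S lam)
          let ys ← unifStrings (m lam) (S lam).length
          A.run lam (K', ys))|

/-- Syntax of puncturable encryption. `decCirc lam dk` is the decryption circuit of the (possibly
punctured) decryption key `dk`: its first output bit tells whether the ciphertext is valid, the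
other output bits are then the plaintext. -/
structure PuncturableEnc where
  gen : ℕ → PMF (Val × Val)
  puncture : ℕ → Val → List Bool → PMF Val
  enc : ℕ → Val → List Bool → PMF (List Bool)
  decCirc : ℕ → Val → Circuit

/-- Decryption; `none` stands for `⊥`. -/
def PuncturableEnc.dec (E : PuncturableEnc) (lam : ℕ) (dk : Val) (c : List Bool) :
    Option (List Bool) :=
  match (E.decCirc lam dk).eval c with
  | true :: d => some d
  | _ => none

/-- The experiment of strong ciphertext pseudorandomness. -/
noncomputable def PuncturableEnc.expSCPR (E : PuncturableEnc) (lp lct : ℕ → ℕ)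
    (A : TwoStage Unit (List Bool × Val × Val) lp) (lam : ℕ) : PMF Bool := do
  let (msg, ψ) ← A.first lam ()
  let (ek, dk) ← E.gen lam
  let c ← E.enc lam ek msg
  let r ← unifBits (lct lam)
  let coin ← unifBit
  let x := if coin then r else c
  let dk' ← E.puncture lam dk x
  let coin' ← A.second lam () msg (x, ek, dk') ψ
  pure (coin == coin')

/-- Secure puncturable encryption with strong ciphertext pseudorandomness, with plaintext space
`{0,1}^(lp lam)` and ciphertext space `{0,1}^(lct lam)`. -/
structure PuncturableEnc.IsSecure (E : PuncturableEnc) (lp lct : ℕ → ℕ) : Prop where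
  gen_ppt : PPT E.gen
  puncture_ppt : PPT fun a : ℕ × Val × List Bool => E.puncture a.1 a.2.1 a.2.2
  enc_ppt : PPT fun a : ℕ × Val × List Bool => E.enc a.1 a.2.1 a.2.2
  decCirc_poly : PolyTime fun a : ℕ × Val => E.decCirc a.1 a.2
  enc_length : ∀ lam ek msg, msg.length = lp lam →
    ∀ c ∈ (E.enc lam ek msg).support, c.length = lct lam
  dec_arity : ∀ lam dk, (E.decCirc lam dk).HasArity (lct lam) (lp lam + 1)
  correctness : ∀ lam msg, msg.length = lp lam → ∀ key ∈ (E.gen lam).support,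
    ∀ c ∈ (E.enc lam key.1 msg).support, E.dec lam key.2 c = some msg
  punctured_correctness : ∀ lam, ∀ key ∈ (E.gen lam).support,
    ∀ x : List Bool, x.length = lct lam → ∀ dk' ∈ (E.puncture lam key.2 x).support,
    ∀ c : List Bool, c.length = lct lam → c ≠ x → E.dec lam key.2 c = E.dec lam dk' c
  sparseness : Negligible fun lam => prTrue (do
    let (_, dk) ← E.gen lam
    let c ← unifBits (lct lam)
    pure (E.dec lam dk c).isSome)
  strong_ciphertext_pseudorandom : ∀ A : TwoStage Unit (List Bool × Val × Val) lp,
    Negligible fun lam => 2 * |prTrue (E.expSCPR lp lct A lam) - 1 / 2|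

/-! ## Extraction-less watermarking PRFs -/

/-- The algorithms of an extraction-less watermarking PRF. All of them get the security parameter;
`PP`, `XK`, `K`, `Tag` are the types of public parameters, extraction keys, PRF keys and tags.
Indices are counted from 0. -/
structure ExtractionLessWM (PP XK K Tag : Type) where
  setup : ℕ → PMF (PP × XK)
  gen : ℕ → PP → PMF (K × Tag)
  eval : ℕ → K → List Bool → List Bool
  mark : ℕ → PP → K → List Bool → PMF Circuit
  sim : ℕ → XK → Tag → ℕ → PMF (Bool × List Bool × List Bool)

section watermarking

variable {PP XK K Tag : Type}

/-- Evaluate a marked key at a random input, and compare with the PRF. -/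
noncomputable def ExtractionLessWM.expEval (W : ExtractionLessWM PP XK K Tag) (n : ℕ → ℕ)
    (msg : List Bool) (lam : ℕ) : PMF Bool := do
  let (pp, _) ← W.setup lam
  let (prfk, _) ← W.gen lam pp
  let C ← W.mark lam pp prfk msg
  let x ← unifBits (n lam)
  pure (decide (C.eval x = W.eval lam prfk x))

/-- `W` is an extraction-less watermarking PRF for the message space `{0,1}^(k lam)` with domain
`{0,1}^(n lam)` and range `{0,1}^(m lam)`: the algorithms are efficient, their inputs and outputs are
of the right form, and evaluation correctness holds. -/
structure ExtractionLessWM.IsExtractionLessWatermarkingPRF [TreeEnc PP] [TreeEnc XK] [TreeEnc K]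
    [TreeEnc Tag] (W : ExtractionLessWM PP XK K Tag) (k n m : ℕ → ℕ) : Prop where
  setup_ppt : PPT W.setup
  gen_ppt : PPT fun a : ℕ × PP => W.gen a.1 a.2
  eval_poly : PolyTime fun a : ℕ × K × List Bool => W.eval a.1 a.2.1 a.2.2
  mark_ppt : PPT fun a : ℕ × PP × K × List Bool => W.mark a.1 a.2.1 a.2.2.1 a.2.2.2
  sim_ppt : PPT fun a : ℕ × XK × Tag × ℕ => W.sim a.1 a.2.1 a.2.2.1 a.2.2.2
  eval_length : ∀ lam prfk x, x.length = n lam → (W.eval lam prfk x).length = m lam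
  mark_arity : ∀ lam pp prfk msg, msg.length = k lam →
    ∀ C ∈ (W.mark lam pp prfk msg).support, C.HasArity (n lam) (m lam)
  sim_length : ∀ lam xk tag i, i < k lam → ∀ r ∈ (W.sim lam xk tag i).support,
    r.2.1.length = n lam ∧ r.2.2.length = m lam
  evaluation_correctness : ∀ msg : ℕ → List Bool, (∀ lam, (msg lam).length = k lam) →
    ∃ ν : ℕ → ℝ, Negligible ν ∧ ∀ lam, 1 - ν lam ≤ prTrue (W.expEval n (msg lam) lam)

/-- The mark-dependent distribution `D_real`: a random value if `γ` is the `i`-th bit of the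
message, and a value of the PRF otherwise. -/
noncomputable def ExtractionLessWM.dReal (W : ExtractionLessWM PP XK K Tag) (n m : ℕ → ℕ)
    (lam : ℕ) (prfk : K) (msg : List Bool) (i : ℕ) : PMF (Bool × List Bool × List Bool) := do
  let γ ← unifBit
  let x ← unifBits (n lam)
  let y ← if γ = msg.getD i false then unifBits (m lam) else pure (W.eval lam prfk x)
  pure (γ, x, y)

/-- The game of SIM-MDD security with public simulation, for the index `i`. -/
noncomputable def ExtractionLessWM.expSIMMDDPub [TreeEnc PP] [TreeEnc XK] [TreeEnc Tag]
    (W : ExtractionLessWM PP XK K Tag) {k : ℕ → ℕ} (n m : ℕ → ℕ)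
    (A : TwoStage (PP × XK) (Tag × Circuit × Bool × List Bool × List Bool) k)
    (i lam : ℕ) : PMF Bool := do
  let (pp, xk) ← W.setup lam
  let (msg, ψ) ← A.first lam (pp, xk)
  let (prfk, tag) ← W.gen lam pp
  let C ← W.mark lam pp prfk msg
  let coin ← unifBit
  let r ← if coin then W.sim lam xk tag i else W.dReal n m lam prfk msg i
  let coin' ← A.second lam (pp, xk) msg (tag, C, r) ψ
  pure (coin == coin')

/-- SIM-MDD security with public simulation. The index may depend on the security parameter; only
those security parameters count for which it is an index of a message bit. -/
def ExtractionLessWM.IsSIMMDDPub [TreeEnc PP] [TreeEnc XK] [TreeEnc Tag]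
    (W : ExtractionLessWM PP XK K Tag) (k n m : ℕ → ℕ) : Prop :=
  ∀ (i : ℕ → ℕ) (A : TwoStage (PP × XK) (Tag × Circuit × Bool × List Bool × List Bool) k),
    Negligible fun lam =>
      if i lam < k lam then 2 * |prTrue (W.expSIMMDDPub n m A (i lam) lam) - 1 / 2| else 0

end watermarking

/-! ## The circuit `D[F, dk, msg]` -/

/-- The `w` low-order bits of `i`, least significant bit first. -/
def natBits : ℕ → ℕ → List Bool
  | 0, _ => []
  | w + 1, i => (i % 2 == 1) :: natBits w (i / 2)

/-- The wire of the big circuit that takes the place of wire `w` of `C` when `C` is inserted with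
input wires `args` and its gates at the wires from `base` on; `z` is a wire with value 0. -/
def Circuit.place (C : Circuit) (args : List ℕ) (base z w : ℕ) : ℕ :=
  if w < C.numIn then args.getD w z
  else if w < C.numIn + C.size then base + (w - C.numIn) else z

def Circuit.placedGates (C : Circuit) (args : List ℕ) (base z : ℕ) : List Gate :=
  C.gates.map fun g => ⟨g.op, C.place args base z g.i, C.place args base z g.j⟩

def Circuit.placedOuts (C : Circuit) (args : List ℕ) (base z : ℕ) : List ℕ :=
  C.outs.map (C.place args base z)

/-- Gates (the first of which gets the wire `b`) for the chain `w := w && (wire = bit)`, starting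
from wire `w`. -/
def testGates : List (ℕ × Bool) → ℕ → ℕ → List Gate
  | [], _, _ => []
  | (v, c) :: l, w, b => ⟨fun s t => s && (t == c), w, v⟩ :: testGates l b (b + 1)

/-- Gates from the wire `b` on whose last wire carries
`acc || (γ ≠ msgbit && (idx = natBits _ j))`. -/
def matchGates (idx : List ℕ) (γ acc b j : ℕ) (msgbit : Bool) : List Gate :=
  ⟨fun s _ => s ^^ msgbit, γ, γ⟩ ::
    testGates (idx.zip (natBits idx.length j)) b (b + 1) ++
    [⟨fun s t => s || t, acc, b + idx.length⟩]

/-- Gates from the wire `b` on whose last wire carries "`acc`, or `idx` is an index `j < k` for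
which the `j`-th bit of the message is not `γ`" (where `acc = b - 1`). -/
def selectGates (idx : List ℕ) (γ b : ℕ) (msg : List Bool) (k : ℕ) : List Gate :=
  (List.range k).flatMap fun j =>
    matchGates idx γ (b + j * (idx.length + 2) - 1) (b + j * (idx.length + 2)) j (msg.getD j false)

/-- Gates from the wire `b` on that select, if `sel` is 1, the wires `gs`, and otherwise the
wires `fs`. -/
def muxGates (sel : ℕ) : List (ℕ × ℕ) → ℕ → List Gate
  | [], _ => []
  | (f, g) :: l, b =>
    ⟨fun s t => s && t, sel, g⟩ :: ⟨fun s t => !s && t, sel, f⟩ :: ⟨fun s t => s || t, b, b + 1⟩ ::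
      muxGates sel l (b + 3)

/-- The circuit `D[F, dk, msg]`, built from the evaluation circuit `F`, the decryption circuit
`Dec` and the circuit `G` of the PRG. On input `x` it computes `d := Dec x`; if `d` is a plaintext,
`d = s ‖ j ‖ γ` with `j` an index `j < k`, and the `j`-th bit of the message is not `γ`, then it
outputs `G s`; otherwise it outputs `F x`. -/
def circuitD (F Dec G : Circuit) (k : ℕ) (msg : List Bool) : Circuit :=
  let n := F.numIn
  let z := n
  let ins := List.range n
  let b1 := n + 1
  let b2 := b1 + F.size
  let b3 := b2 + Dec.size
  let b4 := b3 + G.size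
  let fs := F.placedOuts ins b1 z
  let ds := Dec.placedOuts ins b2 z
  let valid := ds.getD 0 z
  let seed := (ds.drop 1).take G.numIn
  let idx := (ds.drop (1 + G.numIn)).take (Nat.clog 2 k)
  let γ := ds.getD (1 + G.numIn + Nat.clog 2 k) z
  let gs := G.placedOuts seed b3 z
  let b5 := b4 + 1 + k * (idx.length + 2)
  let zero : Gate := ⟨fun _ _ => false, 0, 0⟩
  { numIn := n
    gates := [zero] ++ F.placedGates ins b1 z ++ Dec.placedGates ins b2 z ++
      G.placedGates seed b3 z ++ [zero] ++ selectGates idx γ (b4 + 1) msg k ++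
      [⟨fun s t => s && t, valid, b5 - 1⟩] ++ muxGates b5 (fs.zip gs) (b5 + 1)
    outs := (List.range fs.length).map fun t => b5 + 1 + (3 * t + 2) }

/-- Pad a circuit with useless gates to at least `s` gates. -/
def Circuit.pad (C : Circuit) (s : ℕ) : Circuit :=
  { C with gates := C.gates ++ List.replicate (s - C.size) ⟨fun _ _ => false, 0, 0⟩ }

/-! ### The circuit computes what it should: `circuitD_pad_eval` -/

theorem evalGates_append (ws : List Bool) (g h : List Gate) :
    evalGates ws (g ++ h) = evalGates (evalGates ws g) h := by
  simp [evalGates]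

theorem evalGates_cons (ws : List Bool) (g : Gate) (h : List Gate) :
    evalGates ws (g :: h) = evalGates (ws ++ [g.op (wire ws g.i) (wire ws g.j)]) h := rfl

theorem evalGates_length (gs : List Gate) : ∀ ws : List Bool,
    (evalGates ws gs).length = ws.length + gs.length := by
  induction gs with
  | nil => intro ws; rfl
  | cons g gs ih => intro ws; rw [evalGates_cons, ih]; simp; omega

theorem wire_append_left {ws : List Bool} (vs : List Bool) {w : ℕ} (h : w < ws.length) :
    wire (ws ++ vs) w = wire ws w := by
  simp only [wire]; rw [List.getD_append _ _ _ _ h]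

theorem wire_append_last (ws : List Bool) (v : Bool) : wire (ws ++ [v]) ws.length = v := by
  simp [wire]

/-- The values of the earlier wires do not change when gates are added. -/
theorem wire_evalGates (gs : List Gate) : ∀ {ws : List Bool} {w : ℕ}, w < ws.length →
    wire (evalGates ws gs) w = wire ws w := by
  induction gs with
  | nil => intro ws w _; rfl
  | cons g gs ih =>
    intro ws w h
    rw [evalGates_cons, ih (by simp; omega), wire_append_left _ h]

theorem wire_of_le {ws : List Bool} {w : ℕ} (h : ws.length ≤ w) : wire ws w = false := by
  simp only [wire]; exact List.getD_eq_default _ _ h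

/-- Inserting a circuit preserves the values of its wires. -/
theorem place_spec_aux (C : Circuit) (args : List ℕ) (z : ℕ) (W x : List Bool)
    (hargs : args.length = C.numIn) (hlt : ∀ a ∈ args, a < W.length) (hz : z < W.length)
    (hz0 : wire W z = false) (hx : x = args.map (wire W)) :
    ∀ gs hs : List Gate, C.gates = gs ++ hs → ∀ w : ℕ,
      wire (evalGates W (gs.map fun g =>
        ⟨g.op, C.place args W.length z g.i, C.place args W.length z g.j⟩))
        (C.place args W.length z w) = wire (evalGates x gs) w := by
  intro gs
  induction gs using List.reverseRecOn with
  | nil =>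
    intro hs _ w
    simp only [List.map_nil, evalGates, List.foldl_nil, Circuit.place]
    split_ifs with h1 h2
    · rw [← hargs] at h1
      simp [wire, hx, h1]
    · rw [wire_of_le (by omega), wire_of_le (by simp [hx, hargs]; omega)]
    · rw [hz0, wire_of_le (by simp [hx, hargs]; omega)]
  | append_singleton gs g ih =>
    intro hs he w
    have ih' := ih (g :: hs) (by simp [he])
    rw [List.map_append, evalGates_append, evalGates_append]
    simp only [List.map_cons, List.map_nil, evalGates_cons, ih']
    set W' := evalGates W (gs.map fun g =>
        ⟨g.op, C.place args W.length z g.i, C.place args W.length z g.j⟩) with hW'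
    have hl : W'.length = W.length + gs.length := by rw [hW', evalGates_length]; simp
    have hlx : (evalGates x gs).length = C.numIn + gs.length := by
      rw [evalGates_length]; simp [hx, hargs]
    have hsz : gs.length < C.size := by simp [Circuit.size, he]
    simp only [evalGates, List.foldl_nil]
    by_cases hw : w = C.numIn + gs.length
    · have hp : C.place args W.length z w = W'.length := by
        simp [Circuit.place, hw, hsz, hl]
      rw [hp, wire_append_last, hw, ← hlx, evalGates, wire_append_last]
    · rcases lt_or_gt_of_ne hw with hw | hw
      · have h1 : C.place args W.length z w < W'.length := by
          simp only [Circuit.place]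
          split_ifs with h1 h2
          · have : args.getD w z ∈ args := by
              rw [List.getD_eq_getElem _ _ (by omega)]; exact List.getElem_mem _
            have := hlt _ this
            omega
          · omega
          · omega
        have h2 : w < (evalGates x gs).length := by omega
        rw [wire_append_left _ h1, ih' w]
        exact (wire_append_left _ h2).symm
      · rw [wire_of_le (w := w) (by rw [List.length_append]; simp only [List.length_singleton]; rw [← evalGates, hlx]; omega)]
        simp only [Circuit.place]
        split_ifs with h1 h2
        · omega
        · exact wire_of_le (by simp; omega)
        · rw [wire_append_left _ (by omega), hW', wire_evalGates _ hz, hz0]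

theorem place_lt (C : Circuit) (args : List ℕ) (z N : ℕ)
    (hargs : args.length = C.numIn) (hlt : ∀ a ∈ args, a < N) (hz : z < N) (w : ℕ) :
    C.place args N z w < N + C.size := by
  simp only [Circuit.place]
  split_ifs with h1 h2
  · have : args.getD w z ∈ args := by
      rw [List.getD_eq_getElem _ _ (by omega)]; exact List.getElem_mem _
    have := hlt _ this
    omega
  · omega
  · omega

/-- An inserted circuit computes its function of the values of its input wires. -/
theorem placedOuts_spec (C : Circuit) (args : List ℕ) (z : ℕ) (W : List Bool)
    (hargs : args.length = C.numIn) (hlt : ∀ a ∈ args, a < W.length) (hz : z < W.length)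
    (hz0 : wire W z = false) :
    (C.placedOuts args W.length z).map (wire (evalGates W (C.placedGates args W.length z))) =
      C.eval (args.map (wire W)) := by
  simp only [Circuit.placedOuts, Circuit.eval, List.map_map]
  refine List.map_congr_left fun w _ => ?_
  exact place_spec_aux C args z W _ hargs hlt hz hz0 rfl C.gates [] (by simp) w

theorem placedOuts_lt (C : Circuit) (args : List ℕ) (z N : ℕ)
    (hargs : args.length = C.numIn) (hlt : ∀ a ∈ args, a < N) (hz : z < N) :
    ∀ w ∈ C.placedOuts args N z, w < N + C.size := by
  intro w hw
  obtain ⟨v, _, rfl⟩ := List.mem_map.1 hw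
  exact place_lt C args z N hargs hlt hz v

theorem testGates_length : ∀ (l : List (ℕ × Bool)) (w b : ℕ), (testGates l w b).length = l.length
  | [], _, _ => rfl
  | (v, c) :: l, w, b => by simp [testGates, testGates_length l]

theorem testGates_spec : ∀ (l : List (ℕ × Bool)) (W : List Bool), 0 < W.length →
    (∀ p ∈ l, p.1 < W.length) →
    wire (evalGates W (testGates l (W.length - 1) W.length)) (W.length - 1 + l.length) =
      (wire W (W.length - 1) && l.all fun p => wire W p.1 == p.2)
  | [], W, _, _ => by simp [testGates, evalGates]
  | (v, c) :: l, W, h0, hl => by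
    have ih := testGates_spec l
      (W ++ [wire W (W.length - 1) && (wire W v == c)]) (by simp)
      (by intro p hp; have := hl p (List.mem_cons_of_mem _ hp); simp; omega)
    simp only [testGates, evalGates_cons]
    have e : W.length - 1 + ((v, c) :: l).length =
      (W ++ [wire W (W.length - 1) && (wire W v == c)]).length - 1 + l.length := by simp; omega
    have e2 : (W ++ [wire W (W.length - 1) && (wire W v == c)]).length - 1 = W.length := by simp
    rw [e]
    simp only [e2] at ih ⊢
    rw [List.length_append, List.length_singleton] at ih
    rw [ih, wire_append_last, List.all_cons, Bool.and_assoc]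
    refine congrArg _ (congrArg _ ?_)
    rw [Bool.eq_iff_iff, List.all_eq_true, List.all_eq_true]
    refine forall₂_congr fun p hp => ?_
    rw [wire_append_left _ (hl p (List.mem_cons_of_mem _ hp))]

theorem natBits_length : ∀ w i : ℕ, (natBits w i).length = w
  | 0, _ => rfl
  | w + 1, i => by simp [natBits, natBits_length w]

theorem matchGates_length (idx : List ℕ) (γ acc b j : ℕ) (c : Bool) :
    (matchGates idx γ acc b j c).length = idx.length + 2 := by
  simp [matchGates, testGates_length, natBits_length]

theorem zip_all_eq (W : List Bool) : ∀ (idx : List ℕ) (bs : List Bool), idx.length = bs.length →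
    ((idx.zip bs).all fun p => wire W p.1 == p.2) = decide (idx.map (wire W) = bs)
  | [], [], _ => by simp
  | i :: idx, c :: bs, h => by
    have := zip_all_eq W idx bs (by simpa using h)
    simp only [List.zip_cons_cons, List.all_cons, this, List.map_cons, List.cons.injEq,
      Bool.decide_and]
    rfl
  | [], _ :: _, h => by simp at h
  | _ :: _, [], h => by simp at h

theorem matchGates_spec (idx : List ℕ) (γ j : ℕ) (c : Bool) (W : List Bool) (h0 : 0 < W.length)
    (hidx : ∀ w ∈ idx, w < W.length) :
    wire (evalGates W (matchGates idx γ (W.length - 1) W.length j c))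
        (W.length + (idx.length + 2) - 1) =
      (wire W (W.length - 1) ||
        ((wire W γ ^^ c) && decide (idx.map (wire W) = natBits idx.length j))) := by
  have hz : (idx.zip (natBits idx.length j)).length = idx.length := by simp [natBits_length]
  have ht := testGates_spec (idx.zip (natBits idx.length j)) (W ++ [wire W γ ^^ c]) (by simp)
    (by intro p hp; have := hidx _ (List.of_mem_zip hp).1; simp; omega)
  rw [zip_all_eq _ _ _ (natBits_length _ _).symm] at ht
  have e : (W ++ [wire W γ ^^ c]).length - 1 = W.length := by simp
  rw [e, hz, wire_append_last, List.length_append, List.length_singleton] at ht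
  have hm : idx.map (wire (W ++ [wire W γ ^^ c])) = idx.map (wire W) :=
    List.map_congr_left fun w hw => wire_append_left _ (hidx w hw)
  rw [hm] at ht
  simp only [matchGates, List.cons_append, evalGates_cons, evalGates_append]
  set V := evalGates (W ++ [wire W γ ^^ c])
    (testGates (idx.zip (natBits idx.length j)) W.length (W.length + 1)) with hV
  have hVl : V.length = W.length + (idx.length + 2) - 1 := by
    rw [hV, evalGates_length, testGates_length, hz]; simp; omega
  rw [← hVl]
  change wire (V ++ [_]) _ = _
  rw [wire_append_last, ht, hV, wire_evalGates _ (by simp), wire_append_left _ (by omega)]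

theorem selectGates_succ (idx : List ℕ) (γ b : ℕ) (msg : List Bool) (k : ℕ) :
    selectGates idx γ b msg (k + 1) = selectGates idx γ b msg k ++
      matchGates idx γ (b + k * (idx.length + 2) - 1) (b + k * (idx.length + 2)) k
        (msg.getD k false) := by
  simp [selectGates, List.range_succ]

theorem selectGates_length (idx : List ℕ) (γ b : ℕ) (msg : List Bool) (k : ℕ) :
    (selectGates idx γ b msg k).length = k * (idx.length + 2) := by
  induction k with
  | zero => simp [selectGates]
  | succ k ih => rw [selectGates_succ, List.length_append, ih, matchGates_length]; ring

theorem selectGates_spec (idx : List ℕ) (γ : ℕ) (msg : List Bool) (W : List Bool)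
    (h0 : 0 < W.length) (hW : wire W (W.length - 1) = false)
    (hidx : ∀ w ∈ idx, w < W.length) (hγ : γ < W.length) (k : ℕ) :
    wire (evalGates W (selectGates idx γ W.length msg k)) (W.length + k * (idx.length + 2) - 1) =
      decide (∃ j < k, idx.map (wire W) = natBits idx.length j ∧
        wire W γ ≠ msg.getD j false) := by
  induction k with
  | zero => simpa [selectGates, evalGates] using hW
  | succ k ih =>
    set V := evalGates W (selectGates idx γ W.length msg k) with hV
    have hVl : V.length = W.length + k * (idx.length + 2) := by
      rw [hV, evalGates_length, selectGates_length]
    have hm := matchGates_spec idx γ k (msg.getD k false) V (by omega)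
      (fun w hw => by have := hidx w hw; omega)
    have hmap : idx.map (wire V) = idx.map (wire W) :=
      List.map_congr_left fun w hw => wire_evalGates _ (hidx w hw)
    have hg : wire V γ = wire W γ := wire_evalGates _ hγ
    rw [selectGates_succ, evalGates_append, ← hV, ← hVl]
    rw [show W.length + (k + 1) * (idx.length + 2) - 1 = V.length + (idx.length + 2) - 1 by
      rw [hVl, add_mul]; omega]
    rw [hm, hmap, hg, hVl, ih, Bool.eq_iff_iff]
    simp only [Bool.or_eq_true, Bool.and_eq_true, decide_eq_true_eq, bne_iff_ne]
    constructor
    · rintro (⟨j, hj, h⟩ | ⟨h1, h2⟩)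
      · exact ⟨j, by omega, h⟩
      · exact ⟨k, by omega, h2, h1⟩
    · rintro ⟨j, hj, h⟩
      rcases Nat.lt_succ_iff_lt_or_eq.1 hj with hj | rfl
      · exact Or.inl ⟨j, hj, h⟩
      · exact Or.inr ⟨h.2, h.1⟩

theorem muxGates_spec (sel : ℕ) : ∀ (l : List (ℕ × ℕ)) (W : List Bool), sel < W.length →
    (∀ p ∈ l, p.1 < W.length ∧ p.2 < W.length) →
    ((List.range l.length).map fun t => W.length + (3 * t + 2)).map
        (wire (evalGates W (muxGates sel l W.length))) =
      l.map fun p => if wire W sel then wire W p.2 else wire W p.1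
  | [], _, _, _ => by simp
  | (f, g) :: l, W, hs, hl => by
    have hfg := hl (f, g) (by simp)
    simp only at hfg
    set u := wire W sel && wire W g with hu
    set v := !wire W sel && wire W f with hv
    have e1 : evalGates W (muxGates sel ((f, g) :: l) W.length) =
        evalGates (W ++ [u, v, u || v]) (muxGates sel l (W ++ [u, v, u || v]).length) := by
      simp only [muxGates, evalGates_cons]
      rw [← hu, wire_append_left [u] hs, wire_append_left [u] hfg.1, ← hv,
        wire_append_left [v] (by simp : W.length < (W ++ [u]).length), wire_append_last]
      have : wire (W ++ [u] ++ [v]) (W.length + 1) = v := by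
        have := wire_append_last (W ++ [u]) v
        simpa using this
      rw [this]
      simp
    have ih := muxGates_spec sel l (W ++ [u, v, u || v]) (by simp; omega)
      (fun p hp => by have := hl p (List.mem_cons_of_mem _ hp); simp; omega)
    rw [e1, List.length_cons, List.range_succ_eq_map, List.map_cons, List.map_cons, List.map_cons]
    congr 1
    · rw [wire_evalGates _ (by simp)]
      have : wire (W ++ [u, v, u || v]) (W.length + (3 * 0 + 2)) = (u || v) := by simp [wire]
      rw [this, hu, hv]
      cases wire W sel <;> simp
    · have hr : (l.map fun p => if wire W sel then wire W p.2 else wire W p.1) =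
          l.map fun p => if wire (W ++ [u, v, u || v]) sel then wire (W ++ [u, v, u || v]) p.2
            else wire (W ++ [u, v, u || v]) p.1 := by
        refine List.map_congr_left fun p hp => ?_
        have := hl p (List.mem_cons_of_mem _ hp)
        rw [wire_append_left _ hs, wire_append_left _ this.1, wire_append_left _ this.2]
      rw [hr, ← ih, List.map_map, List.map_map, List.map_map]
      refine List.map_congr_left fun t _ => ?_
      simp only [Function.comp, List.length_append, List.length_cons, List.length_nil]
      congr 1
      omega

theorem mux_map (c : Bool) (u : List Bool) : ∀ (fs gs : List ℕ), gs.length = fs.length →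
    ((fs.zip gs).map fun p => if c then wire u p.2 else wire u p.1) =
      if c then gs.map (wire u) else fs.map (wire u)
  | [], [], _ => by simp
  | f :: fs, g :: gs, h => by
    have := mux_map c u fs gs (by simpa using h)
    cases c <;> simp_all
  | [], _ :: _, h => by simp at h
  | _ :: _, [], h => by simp at h

theorem getD_map_wire (W : List Bool) (ds : List ℕ) (z i : ℕ) (hz : wire W z = false) :
    wire W (ds.getD i z) = (ds.map (wire W)).getD i false := by
  rw [← hz, List.getD_map]

theorem map_wire_evalGates (W : List Bool) (gs : List Gate) (l : List ℕ)
    (hl : ∀ w ∈ l, w < W.length) : l.map (wire (evalGates W gs)) = l.map (wire W) :=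
  List.map_congr_left fun w hw => wire_evalGates gs (hl w hw)

theorem mem_getD_lt {ds : List ℕ} {N z : ℕ} (h : ∀ w ∈ ds, w < N) (hz : z < N) (i : ℕ) :
    ds.getD i z < N := by
  by_cases hi : i < ds.length
  · rw [List.getD_eq_getElem _ _ hi]; exact h _ (List.getElem_mem _)
  · rw [List.getD_eq_default _ _ (by omega)]; exact hz

/-- The (padded) circuit `D` computes the function that it is meant to compute. -/
theorem circuitD_pad_eval (F Dec G : Circuit) (k : ℕ) (msg x : List Bool) (size : ℕ)
    (hx : x.length = F.numIn) (hDec : Dec.HasArity F.numIn (G.numIn + Nat.clog 2 k + 1 + 1))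
    (hG : G.outs.length = F.outs.length) :
    ((circuitD F Dec G k msg).pad size).eval x =
      if (Dec.eval x).getD 0 false = true ∧ ∃ j < k,
        ((Dec.eval x).drop (1 + G.numIn)).take (Nat.clog 2 k) = natBits (Nat.clog 2 k) j ∧
        (Dec.eval x).getD (1 + G.numIn + Nat.clog 2 k) false ≠ msg.getD j false
      then G.eval (((Dec.eval x).drop 1).take G.numIn) else F.eval x := by
  obtain ⟨hD1, hD2⟩ := hDec
  set n := F.numIn with hn
  set ins := List.range n with hins
  set b1 := n + 1 with hb1
  set b2 := b1 + F.size with hb2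
  set b3 := b2 + Dec.size with hb3
  set b4 := b3 + G.size with hb4
  set fs := F.placedOuts ins b1 n with hfs
  set ds := Dec.placedOuts ins b2 n with hds
  set seed := (ds.drop 1).take G.numIn with hseed
  set idx := (ds.drop (1 + G.numIn)).take (Nat.clog 2 k) with hidx
  set γ := ds.getD (1 + G.numIn + Nat.clog 2 k) n with hγ
  set gs := G.placedOuts seed b3 n with hgs
  set b5 := b4 + 1 + k * (idx.length + 2) with hb5
  set zero : Gate := ⟨fun _ _ => false, 0, 0⟩ with hzero
  have hdsl : ds.length = G.numIn + Nat.clog 2 k + 1 + 1 := by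
    rw [hds, Circuit.placedOuts, List.length_map, hD2]
  have hidxl : idx.length = Nat.clog 2 k := by
    rw [hidx, List.length_take, List.length_drop, hdsl]; omega
  have hseedl : seed.length = G.numIn := by
    rw [hseed, List.length_take, List.length_drop, hdsl]; omega
  have hfsl : fs.length = F.outs.length := by rw [hfs, Circuit.placedOuts, List.length_map]
  have hgsl : gs.length = fs.length := by rw [hgs, Circuit.placedOuts, List.length_map, hG, hfsl]
  have hinsl : ins.length = n := by simp [hins]
  -- the successive lists of wire values
  set W1 := evalGates x [zero] with hW1
  set W2 := evalGates W1 (F.placedGates ins b1 n) with hW2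
  set W3 := evalGates W2 (Dec.placedGates ins b2 n) with hW3
  set W4 := evalGates W3 (G.placedGates seed b3 n) with hW4
  set W5 := evalGates W4 [zero] with hW5
  set W6 := evalGates W5 (selectGates idx γ (b4 + 1) msg k) with hW6
  set W7 := evalGates W6 [⟨fun s t => s && t, ds.getD 0 n, b5 - 1⟩] with hW7
  have l1 : W1.length = b1 := by rw [hW1, evalGates_length, hx]; rfl
  have l2 : W2.length = b2 := by
    rw [hW2, evalGates_length, l1]; simp [Circuit.placedGates, hb2, Circuit.size]
  have l3 : W3.length = b3 := by
    rw [hW3, evalGates_length, l2]; simp [Circuit.placedGates, hb3, Circuit.size]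
  have l4 : W4.length = b4 := by
    rw [hW4, evalGates_length, l3]; simp [Circuit.placedGates, hb4, Circuit.size]
  have l5 : W5.length = b4 + 1 := by rw [hW5, evalGates_length, l4]; rfl
  have l6 : W6.length = b5 := by rw [hW6, evalGates_length, l5, selectGates_length]
  have l7 : W7.length = b5 + 1 := by rw [hW7, evalGates_length, l6]; rfl
  have z1 : wire W1 n = false := by
    change wire (x ++ [false]) n = false
    rw [← hx]; exact wire_append_last x false
  have z2 : wire W2 n = false := by rw [hW2, wire_evalGates _ (by omega), z1]
  have z3 : wire W3 n = false := by rw [hW3, wire_evalGates _ (by omega), z2]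
  have insx : ins.map (wire x) = x := by
    apply List.ext_getElem
    · simp [hins, hx]
    · intro i h1 h2
      simp [hins, wire, h2]
  have ins_lt : ∀ a ∈ ins, a < n := fun a ha => List.mem_range.1 ha
  have ins1 : ins.map (wire W1) = x := by
    rw [hW1, map_wire_evalGates _ _ _ (fun a ha => by have := ins_lt a ha; omega), insx]
  have ins2 : ins.map (wire W2) = x := by
    rw [hW2, map_wire_evalGates _ _ _ (fun a ha => by have := ins_lt a ha; omega), ins1]
  have fs_lt : ∀ w ∈ fs, w < b2 := placedOuts_lt F ins n b1 hinsl
    (fun a ha => by have := ins_lt a ha; omega) (by omega)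
  have ds_lt : ∀ w ∈ ds, w < b3 := placedOuts_lt Dec ins n b2 (by rw [hinsl, hD1])
    (fun a ha => by have := ins_lt a ha; omega) (by omega)
  have seed_lt : ∀ w ∈ seed, w < b3 := fun w hw =>
    ds_lt w (List.mem_of_mem_drop (List.mem_of_mem_take hw))
  have idx_lt : ∀ w ∈ idx, w < b3 := fun w hw =>
    ds_lt w (List.mem_of_mem_drop (List.mem_of_mem_take hw))
  have gs_lt : ∀ w ∈ gs, w < b4 := placedOuts_lt G seed n b3 hseedl seed_lt (by omega)
  have fF : fs.map (wire W2) = F.eval x := by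
    have := placedOuts_spec F ins n W1 hinsl (fun a ha => by have := ins_lt a ha; omega)
      (by omega) z1
    rwa [ins1, l1] at this
  have dD : ds.map (wire W3) = Dec.eval x := by
    have := placedOuts_spec Dec ins n W2 (by rw [hinsl, hD1])
      (fun a ha => by have := ins_lt a ha; omega) (by omega) z2
    rwa [ins2, l2] at this
  have seedD : seed.map (wire W3) = ((Dec.eval x).drop 1).take G.numIn := by
    rw [hseed, List.map_take, List.map_drop, dD]
  have gG : gs.map (wire W4) = G.eval (((Dec.eval x).drop 1).take G.numIn) := by
    have := placedOuts_spec G seed n W3 hseedl (fun a ha => by have := seed_lt a ha; omega)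
      (by omega) z3
    rwa [seedD, l3] at this
  -- the selecting bit
  have w5 : ∀ w, w < b3 → wire W5 w = wire W3 w := fun w hw => by
    rw [hW5, wire_evalGates _ (by omega), hW4, wire_evalGates _ (by omega)]
  have hγlt : γ < b3 := mem_getD_lt ds_lt (by omega) _
  have hvlt : ds.getD 0 n < b3 := mem_getD_lt ds_lt (by omega) _
  have hW5last : wire W5 (W5.length - 1) = false := by
    rw [l5, Nat.add_sub_cancel, ← l4]; exact wire_append_last W4 false
  have hsel := selectGates_spec idx γ msg W5 (by omega) hW5last
    (fun w hw => by have := idx_lt w hw; omega) (by omega) k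
  have hidx5 : idx.map (wire W5) = ((Dec.eval x).drop (1 + G.numIn)).take (Nat.clog 2 k) := by
    rw [List.map_congr_left fun w hw => w5 w (idx_lt w hw), hidx, List.map_take, List.map_drop, dD]
  have hγ5 : wire W5 γ = (Dec.eval x).getD (1 + G.numIn + Nat.clog 2 k) false := by
    rw [w5 γ hγlt, hγ, getD_map_wire _ _ _ _ z3, dD]
  rw [l5, hidx5, hγ5, ← hW6, ← hb5, hidxl] at hsel
  have hv6 : wire W6 (ds.getD 0 n) = (Dec.eval x).getD 0 false := by
    rw [hW6, wire_evalGates _ (by omega), w5 _ hvlt, getD_map_wire _ _ _ _ z3, dD]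
  have h7 : wire W7 b5 = (wire W6 (ds.getD 0 n) && wire W6 (b5 - 1)) := by
    rw [hW7, ← l6]; exact wire_append_last W6 _
  rw [hv6, hsel] at h7
  have fs7 : fs.map (wire W7) = F.eval x := by
    rw [← fF]
    refine List.map_congr_left fun w hw => ?_
    have := fs_lt w hw
    rw [hW7, wire_evalGates _ (by omega), hW6, wire_evalGates _ (by omega), w5 _ (by omega), hW3,
      wire_evalGates _ (by omega)]
  have gs7 : gs.map (wire W7) = G.eval (((Dec.eval x).drop 1).take G.numIn) := by
    rw [← gG]
    refine List.map_congr_left fun w hw => ?_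
    have := gs_lt w hw
    rw [hW7, wire_evalGates _ (by omega), hW6, wire_evalGates _ (by omega), hW5,
      wire_evalGates _ (by omega)]
  have hmux := muxGates_spec b5 (fs.zip gs) W7 (by omega) (fun p hp => by
    have h1 := fs_lt _ (List.of_mem_zip hp).1
    have h2 := gs_lt _ (List.of_mem_zip hp).2
    omega)
  rw [mux_map _ _ _ _ hgsl, fs7, gs7, l7, h7] at hmux
  have hzl : (fs.zip gs).length = fs.length := by simp [hgsl]
  rw [hzl] at hmux
  have hgates : (circuitD F Dec G k msg).gates = [zero] ++ F.placedGates ins b1 n ++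
      Dec.placedGates ins b2 n ++ G.placedGates seed b3 n ++ [zero] ++
      selectGates idx γ (b4 + 1) msg k ++ [⟨fun s t => s && t, ds.getD 0 n, b5 - 1⟩] ++
      muxGates b5 (fs.zip gs) (b5 + 1) := rfl
  have houts : (circuitD F Dec G k msg).outs =
      (List.range fs.length).map fun t => b5 + 1 + (3 * t + 2) := rfl
  have hmuxl : ∀ (l : List (ℕ × ℕ)) (b : ℕ), (muxGates b5 l b).length = 3 * l.length := by
    intro l
    induction l with
    | nil => intro b; rfl
    | cons p l ih => intro b; simp [muxGates, ih]; omega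
  have hev : evalGates x (circuitD F Dec G k msg).gates =
      evalGates W7 (muxGates b5 (fs.zip gs) (b5 + 1)) := by
    rw [hgates]; simp only [evalGates_append]; rfl
  simp only [Circuit.eval, Circuit.pad]
  rw [evalGates_append, hev, houts, map_wire_evalGates, hmux]
  · refine if_congr ?_ rfl rfl
    rw [Bool.and_eq_true]
    exact and_congr_right fun _ => decide_eq_true_iff
  · intro w hw
    obtain ⟨t, ht, rfl⟩ := List.mem_map.1 hw
    have := List.mem_range.1 ht
    rw [evalGates_length, l7, hmuxl, hzl]
    omega

/-! ## The construction -/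

/-- The scheme `PRF_io` for messages of `k lam` bits. `PRG` has seeds of `l lam` bits, and the circuit
`D` is padded to `pad lam` gates. Public parameters and extraction keys are empty; a PRF key is
a pair of a key of the puncturable PRF and a decryption key; a tag is an encryption key. -/
noncomputable def prfIO (k l : ℕ → ℕ) (PRF : PuncturablePRF) (PE : PuncturableEnc)
    (iO : ℕ → Circuit → PMF Circuit) (PRG : ℕ → Circuit) (pad : ℕ → ℕ) :
    ExtractionLessWM Unit Unit (Val × Val) Val where
  setup _ := pure ((), ())
  gen lam _ := do
    let F ← PRF.gen lam
    let (ek, dk) ← PE.gen lam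
    pure ((F, dk), ek)
  eval lam prfk x := PRF.F lam prfk.1 x
  mark lam _ prfk msg :=
    iO lam ((circuitD (PRF.evalCirc lam prfk.1) (PE.decCirc lam prfk.2) (PRG lam) (k lam) msg).pad
      (pad lam))
  sim lam _ ek i := do
    let γ ← unifBit
    let s ← unifBits (l lam)
    let y := (PRG lam).eval s
    let x ← PE.enc lam ek (s ++ natBits (Nat.clog 2 (k lam)) i ++ [γ])
    pure (γ, x, y)

end ELWM

namespace ELWM

/-! ## Closure properties of polynomial time -/

/-! For a fixed message and a fixed label `γ`, simulated and real samples differ essentially in what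
happens at one input `x`. In a simulated sample `x` encrypts `s ‖ i ‖ γ` and `y = PRG(s)`. The
marked circuit then has the value `F_K(x)` at `x` if `γ` is the `i`-th message bit, and `PRG(s)`
otherwise. In a real sample `x` is uniform, hence almost never a valid ciphertext, and the marked
circuit has the value `F_K(x)` there; `y` is uniform if `γ` is the message bit, and `F_K(x)`
otherwise. So if `γ` differs from the message bit, `y` is the value of the circuit at `x` on both
sides, and if not, `y` looks unrelated to the circuit on both sides.

Accordingly, obfuscation allows replacing the marked circuit by one in which both keys are punctured
at `x` and the value at `x` is hardwired (`Tools.sim_indist`). Now `dk` occurs only in punctured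
form, and strong ciphertext pseudorandomness makes `x` uniform (`Tools.sim_indist_prg`). The seed
then occurs only through `PRG(s)`, which becomes uniform (`Tools.prg_indist_unif`). If `γ` differs
from the message bit, the hardwired uniform value becomes `F_K(x)` by punctured pseudorandomness,
and otherwise nothing changes (`Tools.unif_indist_real`). Finally obfuscation removes the
puncturing, since a uniform `x` decrypts with negligible probability only
(`Tools.realPunctured_indist`).

Adversaries are non-uniform, which keeps the reductions simple: by averaging
(`exists_mem_support_abs_le`), any randomness that a step does not touch can be fixed to a best
outcome of polynomial size and handed over as advice. This gives `Indist.mix`, the form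
`IsSecureIO.indist_mix` of obfuscation security, and in `TwoStage.exists_distinguisher` it turns the
message and the quantum state left by the first stage into fixed advice.

The rest is efficiency. Polynomial-time programs are closed under bounded loops and folds
(`PolyTime.while_loop`, `PolyTime.foldl_of_growth`), PPT algorithms under sequential composition
(`PPT.bind`), and thus all circuits above are computable in polynomial time. In particular a
polynomial `P₀` bounds their sizes (`Tools.exists_sizeBound`), so that padding to `P ≥ P₀` gates
gives circuits of equal size, as obfuscation security requires. -/

theorem polyEval_mono (p : Polynomial ℕ) {x y : ℕ} (h : x ≤ y) : p.eval x ≤ p.eval y := by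
  induction p using Polynomial.induction_on' with
  | add p q hp hq => simpa using Nat.add_le_add hp hq
  | monomial n a => simpa using Nat.mul_le_mul_left a (Nat.pow_le_pow_left h n)

/-- Every instruction is charged for the tree that it reads, so the time spent pays for the output.
This bounds the input of the second program in a composition. -/
theorem Runs.size_le {c : Code} {x y : Val} {t : ℕ} (h : Runs c x y t) : y.size ≤ t := by
  induction h <;> (try simp only [Val.size] at *) <;> omega

section basic

variable {α β γ σ : Type} [TreeEnc α] [TreeEnc β] [TreeEnc γ] [TreeEnc σ]

theorem esize_pos (a : α) : 0 < esize a := by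
  unfold esize
  cases TreeEnc.enc a <;> simp [Val.size]

theorem esize_prod (a : α × β) : esize a = esize a.1 + esize a.2 + 1 := rfl

theorem esize_nat (n : ℕ) : esize n = 2 * n + 1 := by
  induction n with
  | zero => rfl
  | succ n ih =>
    change Val.size (.node .leaf (encNat n)) = _
    have : (encNat n).size = 2 * n + 1 := ih
    simp only [Val.size, this]; omega

theorem esize_nil : esize ([] : List α) = 1 := rfl

theorem esize_cons (a : α) (l : List α) : esize (a :: l) = esize a + esize l + 1 := rfl

theorem esize_bool_le (b : Bool) : esize b ≤ 3 := by cases b <;> decide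

theorem esize_append (l l' : List α) : esize (l ++ l') + 1 = esize l + esize l' := by
  induction l with
  | nil => simp [esize_nil, add_comm]
  | cons a l ih => rw [List.cons_append, esize_cons, esize_cons]; omega

theorem esize_mem_le {l : List α} {a : α} (h : a ∈ l) : esize a ≤ esize l := by
  induction l with
  | nil => simp at h
  | cons b l ih =>
    rw [esize_cons]
    rcases List.mem_cons.1 h with rfl | h
    · omega
    · have := ih h; omega

theorem length_le_esize (l : List α) : l.length ≤ esize l := by
  induction l with
  | nil => simp
  | cons b l ih => rw [esize_cons, List.length_cons]; omega

theorem esize_list_le {l : List α} {B : ℕ} (h : ∀ a ∈ l, esize a ≤ B) :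
    esize l ≤ l.length * (B + 1) + 1 := by
  induction l with
  | nil => simp [esize_nil]
  | cons a l ih =>
    rw [esize_cons, List.length_cons, add_mul]
    have := ih fun b hb => h b (List.mem_cons_of_mem _ hb)
    have := h a (by simp)
    omega

/-- Values of `f` have polynomial size. -/
def PolyBounded (f : α → β) : Prop := ∃ p : Polynomial ℕ, ∀ a, esize (f a) ≤ p.eval (esize a)

theorem PolyTime.polyBounded {f : α → β} (hf : PolyTime f) : PolyBounded f := by
  obtain ⟨c, p, h⟩ := hf
  refine ⟨p, fun a => ?_⟩
  obtain ⟨t, ht, hr⟩ := h a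
  exact hr.size_le.trans ht

theorem PolyTime.congr {f g : α → β} (hf : PolyTime f) (h : ∀ a, g a = f a) : PolyTime g :=
  funext h ▸ hf

attribute [fun_prop] PolyTime

@[fun_prop]
theorem PolyTime.id : PolyTime fun a : α => a :=
  ⟨.id, Polynomial.X + 1, fun a => ⟨_, by simp [esize], Runs.id _⟩⟩

@[fun_prop]
theorem PolyTime.comp {g : β → γ} {f : α → β} (hg : PolyTime g) (hf : PolyTime f) :
    PolyTime fun a => g (f a) := by
  obtain ⟨cf, pf, hf⟩ := hf
  obtain ⟨cg, pg, hg⟩ := hg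
  refine ⟨.comp cg cf, pf + pg.comp pf + 1, fun a => ?_⟩
  obtain ⟨s, hs, hrs⟩ := hf a
  obtain ⟨t, ht, hrt⟩ := hg (f a)
  refine ⟨_, ?_, Runs.comp hrs hrt⟩
  have := polyEval_mono pg (hrs.size_le.trans hs)
  simp only [Polynomial.eval_add, Polynomial.eval_comp, Polynomial.eval_one]
  exact Nat.add_le_add_right (Nat.add_le_add hs (ht.trans this)) 1

@[fun_prop]
theorem PolyTime.prodMk {f : α → β} {g : α → γ} (hf : PolyTime f) (hg : PolyTime g) :
    PolyTime fun a => (f a, g a) := by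
  obtain ⟨cf, pf, hf⟩ := hf
  obtain ⟨cg, pg, hg⟩ := hg
  refine ⟨.pair cf cg, pf + pg + Polynomial.X + 1, fun a => ?_⟩
  obtain ⟨s, hs, hrs⟩ := hf a
  obtain ⟨t, ht, hrt⟩ := hg a
  refine ⟨_, ?_, Runs.pair hrs hrt⟩
  simp only [Polynomial.eval_add, Polynomial.eval_X, Polynomial.eval_one]
  exact Nat.add_le_add_right (Nat.add_le_add_right (Nat.add_le_add hs ht) _) 1

/-- Programs see encodings only, so any operation on trees with the right encoded values computes
`f`. Constructors and projections of encoded types reduce to operations on trees in this way. -/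
theorem PolyTime.of_enc {f : α → β} {g : α → Val} (hg : PolyTime g)
    (h : ∀ a, TreeEnc.enc (f a) = g a) : PolyTime f := by
  obtain ⟨c, p, hc⟩ := hg
  refine ⟨c, p, fun a => ?_⟩
  rw [h]
  exact hc a

@[fun_prop]
theorem PolyTime.enc {f : α → β} (hf : PolyTime f) : PolyTime fun a => TreeEnc.enc (f a) := hf

def Val.fst : Val → Val
  | .leaf => .leaf
  | .node a _ => a

def Val.snd : Val → Val
  | .leaf => .leaf
  | .node _ b => b

def Val.isNode : Val → Bool
  | .leaf => false
  | .node _ _ => true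

@[fun_prop]
theorem polyTime_val_fst : PolyTime Val.fst := by
  refine ⟨.left, Polynomial.X + 1, fun a => ?_⟩
  cases a with
  | leaf => exact ⟨_, by simp [esize, TreeEnc.enc, Val.size], Runs.left_leaf⟩
  | node a b => exact ⟨_, by simp [esize, TreeEnc.enc], Runs.left_node a b⟩

@[fun_prop]
theorem polyTime_val_snd : PolyTime Val.snd := by
  refine ⟨.right, Polynomial.X + 1, fun a => ?_⟩
  cases a with
  | leaf => exact ⟨_, by simp [esize, TreeEnc.enc, Val.size], Runs.right_leaf⟩
  | node a b => exact ⟨_, by simp [esize, TreeEnc.enc], Runs.right_node a b⟩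

@[fun_prop]
theorem PolyTime.node {f g : α → Val} (hf : PolyTime f) (hg : PolyTime g) :
    PolyTime fun a => Val.node (f a) (g a) :=
  (hf.prodMk hg).enc

@[fun_prop]
theorem PolyTime.leaf : PolyTime fun _ : α => Val.leaf :=
  ⟨.nil, Polynomial.X + 1, fun a => ⟨_, by simp [esize], Runs.nil _⟩⟩

theorem PolyTime.constVal (v : Val) : PolyTime fun _ : α => v := by
  induction v with
  | leaf => exact .leaf
  | node a b ha hb => exact ha.node hb

@[fun_prop]
theorem PolyTime.const (b : β) : PolyTime fun _ : α => b :=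
  .of_enc (.constVal (TreeEnc.enc b)) fun _ => rfl

@[fun_prop]
theorem PolyTime.fst {f : α → β × γ} (hf : PolyTime f) : PolyTime fun a => (f a).1 :=
  .of_enc (g := fun a => (TreeEnc.enc (f a)).fst) (by fun_prop) fun _ => rfl

@[fun_prop]
theorem PolyTime.snd {f : α → β × γ} (hf : PolyTime f) : PolyTime fun a => (f a).2 :=
  .of_enc (g := fun a => (TreeEnc.enc (f a)).snd) (by fun_prop) fun _ => rfl

@[fun_prop]
theorem PolyTime.cond {c : α → Bool} {f g : α → β} (hc : PolyTime c) (hf : PolyTime f)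
    (hg : PolyTime g) : PolyTime fun a => bif c a then f a else g a := by
  obtain ⟨cc, pc, hc⟩ := hc
  obtain ⟨cf, pf, hf⟩ := hf
  obtain ⟨cg, pg, hg⟩ := hg
  refine ⟨.cond cc cf cg, pc + (pf + pg) + Polynomial.X + 1, fun a => ?_⟩
  obtain ⟨r, hr, hrr⟩ := hc a
  obtain ⟨s, hs, hrs⟩ := hf a
  obtain ⟨t, ht, hrt⟩ := hg a
  simp only [Polynomial.eval_add, Polynomial.eval_X, Polynomial.eval_one]
  cases hca : c a <;> rw [hca] at hrr
  · exact ⟨_, by simp only [esize] at *; omega, Runs.cond_false hrr hrt⟩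
  · exact ⟨_, by simp only [esize] at *; omega, Runs.cond_true hrr hrs⟩

theorem PolyTime.ite {c : α → Prop} [∀ a, Decidable (c a)] {f g : α → β}
    (hc : PolyTime fun a => decide (c a)) (hf : PolyTime f) (hg : PolyTime g) :
    PolyTime fun a => if c a then f a else g a := by
  have := PolyTime.cond hc hf hg
  simpa only [Bool.cond_decide] using this

@[fun_prop]
theorem polyTime_isNode : PolyTime Val.isNode := by
  refine ⟨.cond .id (.pair .nil .nil) .nil, 6 * Polynomial.X + 6, fun a => ?_⟩
  cases a with
  | leaf => exact ⟨_, by simp [esize, TreeEnc.enc, Val.size], Runs.cond_false (.id _) (.nil _)⟩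
  | node a b =>
    refine ⟨_, ?_, Runs.cond_true (.id _) (.pair (.nil _) (.nil _))⟩
    simp [esize, TreeEnc.enc]; omega

/-- Induction on the number of rounds. Every test and every body runs on a state of size at most
`B`, hence within the values of `pc` and `pf` at `B`; the summand `B + 1` is the charge of the loop
instruction itself. -/
theorem loop_runs {c : σ → Bool} {f : σ → σ} {cc cf : Code} {pc pf : Polynomial ℕ}
    (hc : ∀ a, ∃ t, t ≤ pc.eval (esize a) ∧ Runs cc (TreeEnc.enc a) (TreeEnc.enc (c a)) t)
    (hf : ∀ a, ∃ t, t ≤ pf.eval (esize a) ∧ Runs cf (TreeEnc.enc a) (TreeEnc.enc (f a)) t)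
    (B N : ℕ) : ∀ s : σ, c (f^[N] s) = false → (∀ i < N, c (f^[i] s) = true) →
      (∀ i ≤ N, esize (f^[i] s) ≤ B) →
      ∃ t, t ≤ (N + 1) * (pc.eval B + pf.eval B + B + 1) ∧
        Runs (.loop cc cf) (TreeEnc.enc s) (TreeEnc.enc (f^[N] s)) t := by
  induction N with
  | zero =>
    intro s h0 _ hB
    obtain ⟨t, ht, hr⟩ := hc s
    have hs : esize s ≤ B := hB 0 le_rfl
    have := polyEval_mono pc hs
    rw [Function.iterate_zero, _root_.id] at h0
    rw [h0] at hr
    exact ⟨_, by simp only [esize] at *; omega, Runs.loop_stop hr⟩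
  | succ N ih =>
    intro s h0 h1 hB
    obtain ⟨u, hu, hru⟩ := ih (f s) h0 (fun i hi => h1 (i + 1) (by omega))
      (fun i hi => hB (i + 1) (by omega))
    obtain ⟨r, hr, hrr⟩ := hc s
    obtain ⟨t, ht, hrt⟩ := hf s
    have hs : esize s ≤ B := hB 0 (Nat.zero_le _)
    have := polyEval_mono pc hs
    have := polyEval_mono pf hs
    have hcs : c s = true := h1 0 (by omega)
    rw [hcs] at hrr
    refine ⟨_, ?_, Runs.loop_step hrr hrt hru⟩
    rw [add_mul (N + 1)]
    simp only [esize] at *; omega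

/-- Polynomially many rounds of a loop with states of polynomial size. -/
theorem PolyTime.while_loop {c : σ → Bool} {f : σ → σ} (hc : PolyTime c) (hf : PolyTime f)
    {init out : α → σ} (hi : PolyTime init) (p : Polynomial ℕ)
    (h : ∀ a, ∃ N ≤ p.eval (esize a), out a = f^[N] (init a) ∧ c (f^[N] (init a)) = false ∧
      (∀ i < N, c (f^[i] (init a)) = true) ∧
      ∀ i ≤ N, esize (f^[i] (init a)) ≤ p.eval (esize a)) : PolyTime out := by
  obtain ⟨cc, pc, hc⟩ := hc
  obtain ⟨cf, pf, hf⟩ := hf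
  obtain ⟨ci, pi, hi⟩ := hi
  -- The polynomial `p` plays two roles: it bounds the number of rounds (factor `p + 1`) and the
  -- size of the states (inner argument of `pc` and `pf`).
  refine ⟨.comp (.loop cc cf) ci, pi + (p + 1) * (pc.comp p + pf.comp p + p + 1) + 1, fun a => ?_⟩
  obtain ⟨N, hN, ho, h0, h1, hB⟩ := h a
  obtain ⟨t, ht, hrt⟩ := loop_runs hc hf (p.eval (esize a)) N (init a) h0 h1 hB
  obtain ⟨s, hs, hrs⟩ := hi a
  rw [ho]
  refine ⟨_, ?_, Runs.comp hrs hrt⟩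
  simp only [Polynomial.eval_add, Polynomial.eval_mul, Polynomial.eval_comp, Polynomial.eval_one]
  have := Nat.mul_le_mul_right (pc.eval (p.eval (esize a)) + pf.eval (p.eval (esize a)) +
    p.eval (esize a) + 1) (Nat.add_le_add_right hN 1)
  omega

/-! ### Lists -/

@[fun_prop]
theorem PolyTime.cons {f : α → β} {g : α → List β} (hf : PolyTime f) (hg : PolyTime g) :
    PolyTime fun a => f a :: g a := (hf.prodMk hg).enc

@[fun_prop]
theorem PolyTime.tail {f : α → List β} (hf : PolyTime f) : PolyTime fun a => (f a).tail :=
  .of_enc (g := fun a => (TreeEnc.enc (f a)).snd) (by fun_prop) fun a => by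
    cases f a <;> rfl

@[fun_prop]
theorem PolyTime.isEmpty {f : α → List β} (hf : PolyTime f) : PolyTime fun a => (f a).isEmpty := by
  have : PolyTime fun a => bif (TreeEnc.enc (f a)).isNode then false else true := by fun_prop
  refine .of_enc this.enc fun a => ?_
  cases f a <;> rfl

@[fun_prop]
theorem PolyTime.headD {f : α → List β} {d : α → β} (hf : PolyTime f) (hd : PolyTime d) :
    PolyTime fun a => (f a).headD (d a) := by
  have : PolyTime fun a => bif (TreeEnc.enc (f a)).isNode then (TreeEnc.enc (f a)).fst
    else TreeEnc.enc (d a) := by fun_prop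
  refine .of_enc this fun a => ?_
  cases f a <;> rfl

/-- The fold is a loop on triples of remaining list, parameter and accumulator. The bound on all
partial folds cannot be dropped: polynomially many polynomial-time rounds may blow up the state
exponentially. -/
theorem PolyTime.foldl {L : α → List β} {s₀ : α → σ} {g : α → σ → β → σ}
    (hg : PolyTime fun t : α × σ × β => g t.1 t.2.1 t.2.2) (hL : PolyTime L) (hs : PolyTime s₀)
    (p : Polynomial ℕ)
    (hp : ∀ a, ∀ i ≤ (L a).length, esize (((L a).take i).foldl (g a) (s₀ a)) ≤ p.eval (esize a)) :
    PolyTime fun a => (L a).foldl (g a) (s₀ a) := by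
  -- An element of `β` is needed as a default for the head of an empty list, although the loop stops
  -- before this default matters. Without such an element all lists are empty.
  rcases isEmpty_or_nonempty β with hβ | ⟨⟨b₀⟩⟩
  · have : ∀ a, L a = [] := fun a => List.eq_nil_of_length_eq_zero (by
      rcases h : L a with _ | ⟨b, l⟩
      · rfl
      · exact hβ.elim b)
    simpa [this] using hs
  set f : List β × α × σ → List β × α × σ := fun t =>
    (t.1.tail, t.2.1, g t.2.1 t.2.2 (t.1.headD b₀)) with hf
  have hfp : PolyTime f := by
    have h2 : PolyTime fun t : List β × α × σ => (t.2.1, t.2.2, t.1.headD b₀) := by fun_prop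
    have := hg.comp h2
    exact PolyTime.prodMk (by fun_prop) (PolyTime.prodMk (by fun_prop) this)
  have hit : ∀ a, ∀ i ≤ (L a).length, f^[i] (L a, a, s₀ a) =
      ((L a).drop i, a, ((L a).take i).foldl (g a) (s₀ a)) := by
    intro a i
    induction i with
    | zero => intro _; simp
    | succ i ih =>
      intro hi
      rw [Function.iterate_succ_apply', ih (by omega), hf]
      simp only [List.tail_drop, Prod.mk.injEq, true_and]
      rw [List.take_add_one, List.foldl_append, List.getElem?_eq_getElem (by omega)]
      have : ((L a).drop i).headD b₀ = (L a)[i] := by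
        rw [List.drop_eq_getElem_cons (by omega)]; rfl
      rw [this]; rfl
  obtain ⟨pL, hpL⟩ := hL.polyBounded
  have key : PolyTime fun a => (([] : List β), a, (L a).foldl (g a) (s₀ a)) := by
    refine PolyTime.while_loop (c := fun t : List β × α × σ => !t.1.isEmpty) (f := f)
      (init := fun a => (L a, a, s₀ a)) ?_ hfp (by fun_prop) (pL + Polynomial.X + p + 2) ?_
    · have : PolyTime fun t : List β × α × σ => bif t.1.isEmpty then false else true := by fun_prop
      convert this using 2 with t
      cases t.1.isEmpty <;> rfl
    · intro a
      have hlen := (length_le_esize (L a)).trans (hpL a)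
      refine ⟨(L a).length, by simp; omega, ?_, ?_, ?_, ?_⟩
      · rw [hit a _ le_rfl]; simp
      · rw [hit a _ le_rfl]; simp
      · intro i hi
        rw [hit a _ hi.le]; simpa using hi
      · intro i hi
        rw [hit a _ hi]
        have h1 : esize ((L a).drop i) ≤ esize (L a) := by
          have := esize_append ((L a).take i) ((L a).drop i)
          rw [List.take_append_drop] at this
          have := esize_pos ((L a).take i)
          omega
        have h2 := hp a i hi
        have h3 := hpL a
        simp only [esize_prod, Polynomial.eval_add, Polynomial.eval_X, Polynomial.eval_ofNat]
        omega
  exact key.snd.snd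

/-- Iteration over a list where every step adds a bounded amount to the size of the state. -/
theorem PolyTime.foldl_of_growth {L : α → List β} {s₀ : α → σ} {g : α → σ → β → σ}
    (hg : PolyTime fun t : α × σ × β => g t.1 t.2.1 t.2.2) (hL : PolyTime L) (hs : PolyTime s₀)
    (q : Polynomial ℕ)
    (hq : ∀ a s b, esize (g a s b) ≤ esize s + q.eval (esize a + esize b)) :
    PolyTime fun a => (L a).foldl (g a) (s₀ a) := by
  obtain ⟨pL, hpL⟩ := hL.polyBounded
  obtain ⟨ps, hps⟩ := hs.polyBounded
  -- There are at most `pL` rounds, and every list entry is no larger than the whole list, so each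
  -- round adds at most `q` at the size of the parameter plus `pL`.
  refine hg.foldl hL hs (ps + pL * q.comp (Polynomial.X + pL)) fun a i hi => ?_
  have key : ∀ (l : List β) (s : σ), (∀ b ∈ l, esize b ≤ esize (L a)) →
      esize (l.foldl (g a) s) ≤ esize s + l.length * q.eval (esize a + esize (L a)) := by
    intro l
    induction l with
    | nil => intro s _; simp
    | cons b l ih =>
      intro s hl
      have h1 := ih (g a s b) fun b' hb' => hl b' (List.mem_cons_of_mem _ hb')
      have h2 := hq a s b
      have h3 := polyEval_mono q (Nat.add_le_add_left (hl b (by simp)) (esize a))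
      rw [List.foldl_cons, List.length_cons, add_mul]
      omega
  have h1 := key ((L a).take i) (s₀ a) fun b hb => esize_mem_le (List.mem_of_mem_take hb)
  have h2 := hps a
  have h3 : ((L a).take i).length ≤ pL.eval (esize a) := by
    rw [List.length_take]
    exact (min_le_right _ _).trans ((length_le_esize _).trans (hpL a))
  have h4 := polyEval_mono q (Nat.add_le_add_left (hpL a) (esize a))
  have h5 := Nat.mul_le_mul h3 h4
  simp only [Polynomial.eval_add, Polynomial.eval_mul, Polynomial.eval_comp, Polynomial.eval_X]
  omega

end basic

section lists

variable {α β γ σ : Type} [TreeEnc α] [TreeEnc β] [TreeEnc γ] [TreeEnc σ]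

@[fun_prop]
theorem PolyTime.reverse {f : α → List β} (hf : PolyTime f) : PolyTime fun a => (f a).reverse := by
  have := PolyTime.foldl_of_growth (L := f) (s₀ := fun _ => ([] : List β))
    (g := fun _ s b => b :: s) (by fun_prop) hf (by fun_prop) (Polynomial.X + 1)
    (fun a s b => by simp [esize_cons]; omega)
  refine PolyTime.congr (this) fun a => ?_
  simp

/-- The values are pushed onto an accumulator, where each step adds a bounded amount, and the list
obtained is reversed at the end. -/
theorem PolyTime.map {L : α → List β} {h : α → β → γ} (hh : PolyTime fun t : α × β => h t.1 t.2)
    (hL : PolyTime L) : PolyTime fun a => (L a).map (h a) := by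
  obtain ⟨p, hp⟩ := hh.polyBounded
  have h2 : PolyTime fun t : α × List γ × β => (t.1, t.2.2) := by fun_prop
  have h3 := hh.comp h2
  have := PolyTime.foldl_of_growth (L := L) (s₀ := fun _ => ([] : List γ))
    (g := fun a s b => h a b :: s) (by fun_prop) hL (by fun_prop) (p.comp (Polynomial.X + 1) + 1)
    (fun a s b => by
      have := hp (a, b)
      simp only [esize_prod] at this
      simp [esize_cons]; omega)
  refine PolyTime.congr (this.reverse) fun a => ?_
  have : ∀ (l : List β) (acc : List γ),
      l.foldl (fun s b => h a b :: s) acc = (l.map (h a)).reverse ++ acc := by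
    intro l
    induction l with
    | nil => simp
    | cons b l ih => intro acc; simp [ih]
  simp [this]

@[fun_prop]
theorem PolyTime.append {f g : α → List β} (hf : PolyTime f) (hg : PolyTime g) :
    PolyTime fun a => f a ++ g a := by
  have := PolyTime.foldl_of_growth (L := fun a => (f a).reverse) (s₀ := g)
    (g := fun _ s b => b :: s) (by fun_prop) (by fun_prop) hg (Polynomial.X + 1)
    (fun a s b => by simp [esize_cons]; omega)
  refine PolyTime.congr (this) fun a => ?_
  simp

@[fun_prop]
theorem PolyTime.flatten {f : α → List (List β)} (hf : PolyTime f) :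
    PolyTime fun a => (f a).flatten := by
  have := PolyTime.foldl_of_growth (L := f) (s₀ := fun _ => ([] : List β))
    (g := fun _ s b => s ++ b) (by fun_prop) hf (by fun_prop) Polynomial.X
    (fun a s b => by have := esize_append s b; simp; omega)
  refine PolyTime.congr (this) fun a => ?_
  have : ∀ (l : List (List β)) (acc : List β), l.foldl (fun s b => s ++ b) acc =
      acc ++ l.flatten := by
    intro l
    induction l with
    | nil => simp
    | cons b l ih => intro acc; simp [ih]
  simp [this]

theorem PolyTime.flatMap {L : α → List β} {h : α → β → List γ}
    (hh : PolyTime fun t : α × β => h t.1 t.2) (hL : PolyTime L) :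
    PolyTime fun a => (L a).flatMap (h a) := by
  simpa only [List.flatMap_def] using (PolyTime.map hh hL).flatten

@[fun_prop]
theorem PolyTime.zip {f : α → List β} {g : α → List γ} (hf : PolyTime f) (hg : PolyTime g) :
    PolyTime fun a => (f a).zip (g a) := by
  rcases isEmpty_or_nonempty γ with hγ | ⟨⟨c₀⟩⟩
  · have : ∀ a, g a = [] := fun a => List.eq_nil_of_length_eq_zero (by
      rcases h : g a with _ | ⟨b, l⟩
      · rfl
      · exact hγ.elim b)
    simpa [this] using PolyTime.const (α := α) ([] : List (β × γ))
  have h1 := PolyTime.foldl_of_growth (L := f) (s₀ := fun a => (g a, ([] : List (β × γ))))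
    (g := fun _ s b => bif s.1.isEmpty then s else (s.1.tail, (b, s.1.headD c₀) :: s.2))
    (by fun_prop) hf (by fun_prop) (Polynomial.X + 2)
    (fun a s b => by
      rcases s with ⟨_ | ⟨c, l⟩, acc⟩
      · simp
      · simp [esize_cons, esize_prod]; omega)
  refine PolyTime.congr (h1.snd.reverse) fun a => ?_
  have : ∀ (l : List β) (l' : List γ) (acc : List (β × γ)),
      (l.foldl (fun (s : List γ × List (β × γ)) b =>
        bif s.1.isEmpty then s else (s.1.tail, (b, s.1.headD c₀) :: s.2)) (l', acc)).2 =
      (l.zip l').reverse ++ acc := by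
    intro l
    induction l with
    | nil => simp
    | cons b l ih =>
      intro l' acc
      rw [List.foldl_cons]
      cases l' with
      | nil => simpa using ih [] acc
      | cons c l' =>
        have := ih l' ((b, c) :: acc)
        simpa [-List.headD_eq_head?_getD] using this
  rw [this]; simp

/-! ### Booleans and natural numbers -/

@[fun_prop]
theorem PolyTime.not {f : α → Bool} (hf : PolyTime f) : PolyTime fun a => !f a := by
  refine PolyTime.congr (hf.cond (.const false) (.const true)) fun a => ?_
  cases f a <;> rfl

@[fun_prop]
theorem PolyTime.and {f g : α → Bool} (hf : PolyTime f) (hg : PolyTime g) :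
    PolyTime fun a => f a && g a := by
  refine PolyTime.congr (hf.cond hg (.const false)) fun a => ?_
  cases f a <;> rfl

@[fun_prop]
theorem PolyTime.or {f g : α → Bool} (hf : PolyTime f) (hg : PolyTime g) :
    PolyTime fun a => f a || g a := by
  refine PolyTime.congr (hf.cond (.const true) hg) fun a => ?_
  cases f a <;> rfl

@[fun_prop]
theorem PolyTime.xor {f g : α → Bool} (hf : PolyTime f) (hg : PolyTime g) :
    PolyTime fun a => f a ^^ g a := by
  refine PolyTime.congr (hf.cond hg.not hg) fun a => ?_
  cases f a <;> simp

theorem PolyTime.beqBool {f g : α → Bool} (hf : PolyTime f) (hg : PolyTime g) :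
    PolyTime fun a => f a == g a := by
  refine PolyTime.congr (hf.cond hg hg.not) fun a => ?_
  cases f a <;> simp

/-- A natural number in unary is a list of units. -/
@[fun_prop]
theorem PolyTime.units {f : α → ℕ} (hf : PolyTime f) :
    PolyTime fun a => List.replicate (f a) () := by
  refine .of_enc hf.enc fun a => ?_
  induction f a with
  | zero => rfl
  | succ n ih =>
    change Val.node .leaf (TreeEnc.enc (List.replicate n ())) = Val.node .leaf (TreeEnc.enc n)
    rw [ih]

theorem enc_length_units (l : List Unit) : TreeEnc.enc l.length = TreeEnc.enc l := by
  induction l with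
  | nil => rfl
  | cons b l ih =>
    change Val.node .leaf (TreeEnc.enc l.length) = Val.node .leaf (TreeEnc.enc l)
    rw [ih]

@[fun_prop]
theorem PolyTime.length {f : α → List β} (hf : PolyTime f) : PolyTime fun a => (f a).length := by
  have h : PolyTime fun a => (f a).map fun _ => () :=
    PolyTime.map (h := fun _ _ => ()) (by fun_prop) hf
  refine .of_enc h.enc fun a => ?_
  rw [← enc_length_units, List.length_map]

@[fun_prop]
theorem PolyTime.add {f g : α → ℕ} (hf : PolyTime f) (hg : PolyTime g) :
    PolyTime fun a => f a + g a := by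
  refine PolyTime.congr ((hf.units.append hg.units).length) fun a => ?_
  simp

@[fun_prop]
theorem PolyTime.replicate {f : α → ℕ} {b : α → β} (hf : PolyTime f) (hb : PolyTime b) :
    PolyTime fun a => List.replicate (f a) (b a) := by
  have : PolyTime fun a => (List.replicate (f a) ()).map fun _ => b a :=
    PolyTime.map (h := fun a _ => b a) (by fun_prop) hf.units
  simpa using this

@[fun_prop]
theorem PolyTime.mul {f g : α → ℕ} (hf : PolyTime f) (hg : PolyTime g) :
    PolyTime fun a => f a * g a := by
  have : PolyTime fun a => (List.replicate (f a) (List.replicate (g a) ())).flatten.length := by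
    fun_prop
  simpa using this

@[fun_prop]
theorem PolyTime.drop {f : α → List β} {n : α → ℕ} (hn : PolyTime n) (hf : PolyTime f) :
    PolyTime fun a => (f a).drop (n a) := by
  have := PolyTime.foldl_of_growth (L := fun a => List.replicate (n a) ()) (s₀ := f)
    (g := fun _ s _ => s.tail) (by fun_prop) (by fun_prop) hf 0
    (fun a s b => by cases s <;> simp [esize_cons]; omega)
  refine PolyTime.congr (this) fun a => ?_
  have : ∀ (n : ℕ) (l : List β), (List.replicate n ()).foldl (fun s _ => s.tail) l = l.drop n := by
    intro n
    induction n with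
    | zero => simp
    | succ n ih => intro l; rw [List.replicate_succ, List.foldl_cons, ih]; simp
  rw [this]

@[fun_prop]
theorem PolyTime.sub {f g : α → ℕ} (hf : PolyTime f) (hg : PolyTime g) :
    PolyTime fun a => f a - g a := by
  have : PolyTime fun a => ((List.replicate (f a) ()).drop (g a)).length := by fun_prop
  simpa using this

theorem PolyTime.lt {f g : α → ℕ} (hf : PolyTime f) (hg : PolyTime g) :
    PolyTime fun a => decide (f a < g a) := by
  have : PolyTime fun a => !(List.replicate (g a - f a) ()).isEmpty := by fun_prop
  refine PolyTime.congr (this) fun a => ?_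
  rw [Bool.eq_iff_iff]; simp; omega

theorem PolyTime.natEq {f g : α → ℕ} (hf : PolyTime f) (hg : PolyTime g) :
    PolyTime fun a => decide (f a = g a) := by
  refine PolyTime.congr (((hf.lt hg).or (hg.lt hf)).not) fun a => ?_
  rw [Bool.eq_iff_iff]; simp; omega

-- The criterion `PolyTime.foldl_of_growth` does not apply, because the size of the entry appended
-- depends on the state. Instead the partial folds are recognised as initial ranges, whose size is
-- at most quadratic.
@[fun_prop]
theorem PolyTime.range {f : α → ℕ} (hf : PolyTime f) : PolyTime fun a => List.range (f a) := by
  have hp : ∀ n i : ℕ, (List.replicate n ()).take i = List.replicate (min i n) () := by simp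
  have hr : ∀ n : ℕ, (List.replicate n ()).foldl (fun s _ => s ++ [s.length]) [] =
      List.range n := by
    intro n
    induction n with
    | zero => rfl
    | succ n ih =>
      rw [List.replicate_succ', List.foldl_append, ih, List.range_succ]; simp
  obtain ⟨p, hpb⟩ := hf.polyBounded
  have := PolyTime.foldl (L := fun a => List.replicate (f a) ()) (s₀ := fun _ => ([] : List ℕ))
    (g := fun _ s _ => s ++ [s.length]) (by fun_prop) (by fun_prop) (by fun_prop)
    (p * (p + 1) + 1)
    (fun a i hi => by
      rw [hp, hr]
      have h1 := hpb a
      rw [esize_nat] at h1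
      have h2 : ∀ j ∈ List.range (min i (f a)), esize j ≤ p.eval (esize a) := by
        intro j hj
        have := List.mem_range.1 hj
        rw [esize_nat]; omega
      have h3 := esize_list_le h2
      have h4 : (List.range (min i (f a))).length ≤ p.eval (esize a) := by simp; omega
      have := Nat.mul_le_mul_right (p.eval (esize a) + 1) h4
      simp only [Polynomial.eval_add, Polynomial.eval_mul, Polynomial.eval_one]
      omega)
  refine PolyTime.congr (this) fun a => ?_
  rw [hr]

@[fun_prop]
theorem PolyTime.take {f : α → List β} {n : α → ℕ} (hn : PolyTime n) (hf : PolyTime f) :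
    PolyTime fun a => (f a).take (n a) := by
  have : PolyTime fun a => ((f a).zip (List.range (n a))).map Prod.fst :=
    PolyTime.map (h := fun (_ : α) (t : β × ℕ) => t.1) (by fun_prop) (by fun_prop)
  refine PolyTime.congr (this) fun a => ?_
  apply List.ext_getElem
  · simp [min_comm]
  · intro i h1 h2; simp

@[fun_prop]
theorem PolyTime.getD {f : α → List β} {n : α → ℕ} {d : α → β} (hf : PolyTime f)
    (hn : PolyTime n) (hd : PolyTime d) : PolyTime fun a => (f a).getD (n a) (d a) := by
  have : PolyTime fun a => ((f a).drop (n a)).headD (d a) := by fun_prop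
  refine PolyTime.congr (this) fun a => ?_
  simp [List.getD_eq_getElem?_getD, List.headD_eq_head?_getD]

theorem PolyTime.polyEval (p : Polynomial ℕ) {f : α → ℕ} (hf : PolyTime f) :
    PolyTime fun a => p.eval (f a) := by
  induction p using Polynomial.induction_on' with
  | add p q hp hq => simpa using hp.add hq
  | monomial n c =>
    have : PolyTime fun a => f a ^ n := by
      induction n with
      | zero => simpa using PolyTime.const (α := α) (1 : ℕ)
      | succ n ih => simpa [pow_succ] using ih.mul hf
    simpa using (PolyTime.const c).mul this

/-- Depth-first traversal with a stack of pending subtrees and a counter: every round removes one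
vertex. Programs need sizes because the place where a random tape is cut is a polynomial in the size
of the input. -/
theorem PolyTime.valSize : PolyTime Val.size := by
  set f : List Val × ℕ → List Val × ℕ := fun s =>
    (bif (s.1.headD .leaf).isNode then
        (s.1.headD .leaf).fst :: (s.1.headD .leaf).snd :: s.1.tail
      else s.1.tail, s.2 + 1) with hf
  have hfp : PolyTime f := by fun_prop
  have hit : ∀ (v : Val) (l : List Val) (c : ℕ), f^[v.size] (v :: l, c) = (l, c + v.size) := by
    intro v
    induction v with
    | leaf => intro l c; rfl
    | node a b iha ihb =>
      intro l c
      have h0 : f (Val.node a b :: l, c) = (a :: b :: l, c + 1) := rfl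
      rw [Val.size, Function.iterate_succ_apply, h0, add_comm a.size, Function.iterate_add_apply,
        iha, ihb]
      simp; omega
  have hv : ∀ v : Val, esize v = v.size := fun _ => rfl
  -- Replacing a node by its two children leaves the size of the stack unchanged, and the unary
  -- counter grows by 2; the constant 5 is generous.
  have hs : ∀ (s : List Val × ℕ) (i : ℕ), esize (f^[i] s) ≤ esize s + 5 * i := by
    intro s i
    induction i with
    | zero => simp
    | succ i ih =>
      rw [Function.iterate_succ_apply']
      have : ∀ s, esize (f s) ≤ esize s + 5 := by
        rintro ⟨_ | ⟨_ | ⟨a, b⟩, l⟩, c⟩ <;>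
          simp [hf, esize_prod, esize_nat, esize_cons, esize_nil, Val.isNode, Val.fst, Val.snd,
            hv, Val.size] <;>
          omega
      have := this (f^[i] s)
      omega
  -- The stack stays nonempty until all of `v` has been consumed, so the loop does not stop early.
  have h1 : ∀ (v : Val) (l : List Val) (c i : ℕ), i < v.size → (f^[i] (v :: l, c)).1 ≠ [] := by
    intro v
    induction v with
    | leaf =>
      intro l c i hi
      simp [Val.size] at hi
      simp [hi]
    | node a b iha ihb =>
      intro l c i hi
      have h0 : f (Val.node a b :: l, c) = (a :: b :: l, c + 1) := rfl
      rcases i with _ | i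
      · simp
      · rw [Function.iterate_succ_apply, h0]
        by_cases hia : i < a.size
        · exact iha _ _ _ hia
        · rw [Val.size] at hi
          obtain ⟨j, rfl⟩ := Nat.exists_eq_add_of_le (not_lt.1 hia)
          rw [add_comm a.size, Function.iterate_add_apply, hit]
          exact ihb _ _ _ (by omega)
  have key : PolyTime fun v : Val => (([] : List Val), v.size) := by
    refine PolyTime.while_loop (c := fun s : List Val × ℕ => !s.1.isEmpty) (f := f)
      (init := fun v => ([v], 0)) (by fun_prop) hfp (by fun_prop)
      (6 * Polynomial.X + 10) fun v => ⟨v.size, ?_, ?_, ?_, ?_, ?_⟩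
    · simp [esize, TreeEnc.enc]; omega
    · rw [hit]; simp
    · rw [hit]; rfl
    · intro i hi
      have := h1 v [] 0 i hi
      cases h : (f^[i] ([v], 0)).1 <;> simp_all
    · intro i hi
      have := hs ([v], 0) i
      simp only [esize_prod, esize_nat, esize_cons, esize_nil, Polynomial.eval_add,
        Polynomial.eval_mul, Polynomial.eval_X, Polynomial.eval_ofNat] at this ⊢
      have e : esize v = v.size := rfl
      omega
  exact key.snd

@[fun_prop]
theorem PolyTime.esize {f : α → β} (hf : PolyTime f) : PolyTime fun a => ELWM.esize (f a) :=
  PolyTime.valSize.comp hf.enc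

end lists

section circuits

variable {α β γ σ : Type} [TreeEnc α] [TreeEnc β] [TreeEnc γ] [TreeEnc σ]

/-! ### Binary digits -/

/-- A scan of the unary number keeps the parity and increases the quotient whenever the parity
returns from odd to even. -/
theorem PolyTime.halve {f : α → ℕ} (hf : PolyTime f) :
    PolyTime fun a => (f a % 2 == 1, f a / 2) := by
  have := PolyTime.foldl_of_growth (L := fun a => List.replicate (f a) ())
    (s₀ := fun _ => (false, 0)) (g := fun _ s _ => (!s.1, bif s.1 then s.2 + 1 else s.2))
    (by fun_prop) (by fun_prop) (by fun_prop) 4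
    (fun a s b => by
      have h1 : ELWM.esize true = 3 := rfl
      have h0 : ELWM.esize false = 1 := rfl
      rcases s with ⟨_ | _, n⟩ <;> simp [esize_prod, esize_nat, h0, h1] <;> omega)
  refine this.congr fun a => ?_
  induction f a with
  | zero => rfl
  | succ n ih =>
    rw [List.replicate_succ', List.foldl_append, ← ih]
    rcases Nat.mod_two_eq_zero_or_one n with h | h
    · have h1 : (n + 1) % 2 = 1 := by omega
      have h2 : (n + 1) / 2 = n / 2 := by omega
      simp [h, h1, h2]
    · have h1 : (n + 1) % 2 = 0 := by omega
      have h2 : (n + 1) / 2 = n / 2 + 1 := by omega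
      simp [h, h1, h2]

@[fun_prop]
theorem PolyTime.modTwo {f : α → ℕ} (hf : PolyTime f) : PolyTime fun a => f a % 2 == 1 :=
  hf.halve.fst

@[fun_prop]
theorem PolyTime.divTwo {f : α → ℕ} (hf : PolyTime f) : PolyTime fun a => f a / 2 :=
  hf.halve.snd

@[fun_prop]
theorem PolyTime.natBits {w i : α → ℕ} (hw : PolyTime w) (hi : PolyTime i) :
    PolyTime fun a => natBits (w a) (i a) := by
  have := PolyTime.foldl_of_growth (L := fun a => List.replicate (w a) ())
    (s₀ := fun a => (i a, ([] : List Bool)))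
    (g := fun _ s _ => (s.1 / 2, (s.1 % 2 == 1) :: s.2))
    (by fun_prop) (by fun_prop) (by fun_prop) 4
    (fun a s b => by
      have := esize_bool_le (s.1 % 2 == 1)
      simp [esize_prod, esize_nat, esize_cons]; omega)
  refine this.snd.reverse.congr fun a => ?_
  have : ∀ (w i : ℕ) (acc : List Bool), ((List.replicate w ()).foldl
      (fun (s : ℕ × List Bool) _ => (s.1 / 2, (s.1 % 2 == 1) :: s.2)) (i, acc)).2 =
      (ELWM.natBits w i).reverse ++ acc := by
    intro w
    induction w with
    | zero => intro i acc; rfl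
    | succ w ih => intro i acc; rw [List.replicate_succ, List.foldl_cons, ih]; simp [ELWM.natBits]
  rw [this]; simp

-- The recursion `clog n = clog ((n + 1) / 2) + 1` for `n > 1` is iterated and counted. Each
-- effective round decreases `n`, so `n` rounds are enough.
@[fun_prop]
theorem PolyTime.clog {f : α → ℕ} (hf : PolyTime f) : PolyTime fun a => Nat.clog 2 (f a) := by
  have := PolyTime.foldl_of_growth (L := fun a => List.replicate (f a) ())
    (s₀ := fun a => (f a, 0))
    (g := fun _ s _ => bif decide (1 < s.1) then ((s.1 + 1) / 2, s.2 + 1)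
      else s)
    (by
      refine PolyTime.cond (PolyTime.lt ?_ ?_) ?_ ?_ <;> fun_prop)
    (by fun_prop) (by fun_prop) 4
    (fun a s b => by
      rcases s with ⟨n, c⟩
      by_cases h : 1 < n
      · simp [esize_prod, esize_nat, h]; omega
      · simp [h])
  refine this.snd.congr fun a => ?_
  have : ∀ (w n c : ℕ), n ≤ w + 1 → ((List.replicate w ()).foldl
      (fun (s : ℕ × ℕ) _ => bif decide (1 < s.1) then ((s.1 + 1) / 2, s.2 + 1) else s) (n, c)).2 =
      c + Nat.clog 2 n := by
    intro w
    induction w with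
    | zero => intro n c h; simp [Nat.clog_of_right_le_one (by omega : n ≤ 1)]
    | succ w ih =>
      intro n c h
      rw [List.replicate_succ, List.foldl_cons]
      by_cases hn : 1 < n
      · simp only [hn, decide_true, cond_true]
        rw [Nat.clog_of_two_le (n := n) (by norm_num) (by omega), ih _ _ (by omega)]
        simp only [Nat.add_succ_sub_one]; omega
      · simp only [hn, decide_false, cond_false]
        by_cases hn' : n ≤ w + 1
        · exact ih _ _ hn'
        · omega
  rw [this _ _ _ (by omega)]; simp

/-! ### Circuits -/

-- The operation of a gate is written down as its truth table, so it is enough to compute four bits.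
@[fun_prop]
theorem PolyTime.gate {op : α → Bool → Bool → Bool} {i j : α → ℕ}
    (h : ∀ s t, PolyTime fun a => op a s t) (hi : PolyTime i) (hj : PolyTime j) :
    PolyTime fun a => (⟨op a, i a, j a⟩ : Gate) :=
  PolyTime.of_enc (g := fun a => TreeEnc.enc
    (op a false false, op a false true, op a true false, op a true true, i a, j a))
    (((h _ _).prodMk ((h _ _).prodMk ((h _ _).prodMk ((h _ _).prodMk (hi.prodMk hj))))).enc)
    fun _ => rfl

@[fun_prop]
theorem PolyTime.gateTuple {f : α → Gate} (hf : PolyTime f) : PolyTime fun a => (f a).toTuple :=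
  .of_enc hf.enc fun _ => rfl

@[fun_prop]
theorem PolyTime.gate_i {f : α → Gate} (hf : PolyTime f) : PolyTime fun a => (f a).i :=
  hf.gateTuple.snd.snd.snd.snd.fst

@[fun_prop]
theorem PolyTime.gate_j {f : α → Gate} (hf : PolyTime f) : PolyTime fun a => (f a).j :=
  hf.gateTuple.snd.snd.snd.snd.snd

@[fun_prop]
theorem PolyTime.gate_op {f : α → Gate} {s t : α → Bool} (hf : PolyTime f) (hs : PolyTime s)
    (ht : PolyTime t) : PolyTime fun a => (f a).op (s a) (t a) := by
  have T := hf.gateTuple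
  refine (hs.cond (ht.cond T.snd.snd.snd.fst T.snd.snd.fst) (ht.cond T.snd.fst T.fst)).congr
    fun a => ?_
  cases s a <;> cases t a <;> rfl

@[fun_prop]
theorem PolyTime.circuit {n : α → ℕ} {g : α → List Gate} {o : α → List ℕ} (hn : PolyTime n)
    (hg : PolyTime g) (ho : PolyTime o) : PolyTime fun a => (⟨n a, g a, o a⟩ : Circuit) :=
  .of_enc (hn.prodMk (hg.prodMk ho)).enc fun _ => rfl

theorem PolyTime.circuitTuple {f : α → Circuit} (hf : PolyTime f) :
    PolyTime fun a => ((f a).numIn, (f a).gates, (f a).outs) :=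
  .of_enc hf.enc fun _ => rfl

@[fun_prop]
theorem PolyTime.numIn {f : α → Circuit} (hf : PolyTime f) : PolyTime fun a => (f a).numIn :=
  hf.circuitTuple.fst

@[fun_prop]
theorem PolyTime.gates {f : α → Circuit} (hf : PolyTime f) : PolyTime fun a => (f a).gates :=
  hf.circuitTuple.snd.fst

@[fun_prop]
theorem PolyTime.outs {f : α → Circuit} (hf : PolyTime f) : PolyTime fun a => (f a).outs :=
  hf.circuitTuple.snd.snd

@[fun_prop]
theorem PolyTime.circuitSize {f : α → Circuit} (hf : PolyTime f) : PolyTime fun a => (f a).size :=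
  hf.gates.length

theorem Circuit.size_le_esize (C : Circuit) : C.size ≤ esize C := by
  have h1 : esize C = esize (C.numIn, C.gates, C.outs) := rfl
  have h2 := length_le_esize C.gates
  rw [h1, esize_prod, esize_prod, Circuit.size]
  simp only; omega

@[fun_prop]
theorem PolyTime.wire {f : α → List Bool} {w : α → ℕ} (hf : PolyTime f) (hw : PolyTime w) :
    PolyTime fun a => wire (f a) (w a) := hf.getD hw (.const false)

@[fun_prop]
theorem PolyTime.evalGates {ws : α → List Bool} {gs : α → List Gate} (hw : PolyTime ws)
    (hg : PolyTime gs) : PolyTime fun a => evalGates (ws a) (gs a) :=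
  PolyTime.foldl_of_growth (L := gs) (s₀ := ws)
    (g := fun _ ws g => ws ++ [g.op (ELWM.wire ws g.i) (ELWM.wire ws g.j)]) (by fun_prop) hg hw 4
    (fun a ws g => by
      have := esize_append ws [g.op (ELWM.wire ws g.i) (ELWM.wire ws g.j)]
      have := esize_bool_le (g.op (ELWM.wire ws g.i) (ELWM.wire ws g.j))
      simp only [esize_cons, esize_nil, Polynomial.eval_ofNat] at *; omega)

@[fun_prop]
theorem PolyTime.circuitEval {C : α → Circuit} {x : α → List Bool} (hC : PolyTime C)
    (hx : PolyTime x) : PolyTime fun a => (C a).eval (x a) :=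
  PolyTime.map (h := fun a w => ELWM.wire (ELWM.evalGates (x a) (C a).gates) w)
    (by fun_prop) (by fun_prop)

@[fun_prop]
theorem PolyTime.place {C : α → Circuit} {args : α → List ℕ} {b z w : α → ℕ} (hC : PolyTime C)
    (ha : PolyTime args) (hb : PolyTime b) (hz : PolyTime z) (hw : PolyTime w) :
    PolyTime fun a => (C a).place (args a) (b a) (z a) (w a) := by
  unfold Circuit.place
  refine PolyTime.ite (PolyTime.lt ?_ ?_) ?_ (PolyTime.ite (PolyTime.lt ?_ ?_) ?_ ?_) <;> fun_prop

@[fun_prop]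
theorem PolyTime.placedGates {C : α → Circuit} {args : α → List ℕ} {b z : α → ℕ} (hC : PolyTime C)
    (ha : PolyTime args) (hb : PolyTime b) (hz : PolyTime z) :
    PolyTime fun a => (C a).placedGates (args a) (b a) (z a) := by
  refine PolyTime.map (h := fun a (g : Gate) => (⟨g.op, (C a).place (args a) (b a) (z a) g.i,
    (C a).place (args a) (b a) (z a) g.j⟩ : Gate)) ?_ (by fun_prop)
  exact PolyTime.gate (by intro s t; fun_prop) (by fun_prop) (by fun_prop)

@[fun_prop]
theorem PolyTime.placedOuts {C : α → Circuit} {args : α → List ℕ} {b z : α → ℕ} (hC : PolyTime C)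
    (ha : PolyTime args) (hb : PolyTime b) (hz : PolyTime z) :
    PolyTime fun a => (C a).placedOuts (args a) (b a) (z a) :=
  PolyTime.map (h := fun a w => (C a).place (args a) (b a) (z a) w) (by fun_prop) (by fun_prop)

/-- The recursion passes on changing wire numbers; a closed form by position brings `PolyTime.map`
within reach. The gate at position 0 continues from `w`, and each later one reads the wire of its
predecessor, whence the shift by one. -/
theorem testGates_eq (l : List (ℕ × Bool)) (w b : ℕ) :
    testGates l w b = (l.zip (List.range l.length)).map fun p =>
      ⟨fun s t => s && (t == p.1.2), if p.2 = 0 then w else b + (p.2 - 1), p.1.1⟩ := by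
  induction l generalizing w b with
  | nil => rfl
  | cons p l ih =>
    obtain ⟨v, c⟩ := p
    rw [testGates, ih, List.length_cons, List.range_succ_eq_map, List.zip_cons_cons, List.map_cons,
      List.zip_map_right, List.map_map]
    simp only [if_true, List.cons.injEq, true_and]
    refine List.map_congr_left fun q _ => ?_
    simp only [Function.comp, Prod.map, Gate.mk.injEq]
    refine ⟨rfl, ?_, rfl⟩
    rcases q with ⟨q1, _ | n⟩ <;> simp; omega

@[fun_prop]
theorem PolyTime.testGates {l : α → List (ℕ × Bool)} {w b : α → ℕ} (hl : PolyTime l)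
    (hw : PolyTime w) (hb : PolyTime b) : PolyTime fun a => testGates (l a) (w a) (b a) := by
  simp only [testGates_eq]
  refine PolyTime.map (h := fun a (p : (ℕ × Bool) × ℕ) => (⟨fun s t => s && (t == p.1.2),
    if p.2 = 0 then w a else b a + (p.2 - 1), p.1.1⟩ : Gate)) ?_ (by fun_prop)
  refine PolyTime.gate (fun s t => ?_) ?_ (by fun_prop)
  · exact PolyTime.and (.const s) (.beqBool (.const t) (by fun_prop))
  · refine PolyTime.ite (PolyTime.natEq ?_ ?_) ?_ ?_ <;> fun_prop

@[fun_prop]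
theorem PolyTime.matchGates {idx : α → List ℕ} {γ' acc b j : α → ℕ} {c : α → Bool}
    (hi : PolyTime idx) (hγ : PolyTime γ') (ha : PolyTime acc) (hb : PolyTime b) (hj : PolyTime j)
    (hc : PolyTime c) :
    PolyTime fun a => matchGates (idx a) (γ' a) (acc a) (b a) (j a) (c a) := by
  unfold ELWM.matchGates
  refine PolyTime.append (PolyTime.cons (PolyTime.gate (fun s t => ?_) hγ hγ) (by fun_prop))
    (PolyTime.cons (PolyTime.gate (fun s t => ?_) ha (by fun_prop)) (by fun_prop))
  · exact PolyTime.xor (.const s) hc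
  · exact .const _

@[fun_prop]
theorem PolyTime.selectGates {idx : α → List ℕ} {γ' b k : α → ℕ} {msg : α → List Bool}
    (hi : PolyTime idx) (hγ : PolyTime γ') (hb : PolyTime b) (hm : PolyTime msg)
    (hk : PolyTime k) :
    PolyTime fun a => selectGates (idx a) (γ' a) (b a) (msg a) (k a) :=
  PolyTime.flatMap (h := fun a j => ELWM.matchGates (idx a) (γ' a)
    (b a + j * ((idx a).length + 2) - 1) (b a + j * ((idx a).length + 2)) j ((msg a).getD j false))
    (by fun_prop) (by fun_prop)

/-- Each selected pair occupies three wires, so the block at position `j` starts at `b + 3 * j`;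
this closed form replaces the recursion. -/
theorem muxGates_eq (sel : ℕ) (l : List (ℕ × ℕ)) (b : ℕ) :
    muxGates sel l b = (l.zip (List.range l.length)).flatMap fun p =>
      [⟨fun s t => s && t, sel, p.1.2⟩, ⟨fun s t => !s && t, sel, p.1.1⟩,
        ⟨fun s t => s || t, b + 3 * p.2, b + 3 * p.2 + 1⟩] := by
  induction l generalizing b with
  | nil => rfl
  | cons p l ih =>
    obtain ⟨f, g⟩ := p
    rw [muxGates, ih, List.length_cons, List.range_succ_eq_map, List.zip_cons_cons,
      List.flatMap_cons, List.zip_map_right, List.flatMap_map]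
    have e : ∀ j, b + 3 * (j + 1) = b + 3 + 3 * j := fun j => by ring
    simp [Prod.map, e]

@[fun_prop]
theorem PolyTime.muxGates {sel b : α → ℕ} {l : α → List (ℕ × ℕ)} (hs : PolyTime sel)
    (hl : PolyTime l) (hb : PolyTime b) : PolyTime fun a => muxGates (sel a) (l a) (b a) := by
  simp only [muxGates_eq]
  refine PolyTime.flatMap (h := fun a (p : (ℕ × ℕ) × ℕ) =>
    [(⟨fun s t => s && t, sel a, p.1.2⟩ : Gate), ⟨fun s t => !s && t, sel a, p.1.1⟩,
      ⟨fun s t => s || t, b a + 3 * p.2, b a + 3 * p.2 + 1⟩]) ?_ (by fun_prop)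
  refine PolyTime.cons (PolyTime.gate (fun s t => .const _) ?_ ?_) (PolyTime.cons
    (PolyTime.gate (fun s t => .const _) ?_ ?_) (PolyTime.cons
    (PolyTime.gate (fun s t => .const _) ?_ ?_) (.const _))) <;> fun_prop

@[fun_prop]
theorem PolyTime.circuitD {F D G : α → Circuit} {k : α → ℕ} {msg : α → List Bool}
    (hF : PolyTime F) (hD : PolyTime D) (hG : PolyTime G) (hk : PolyTime k) (hm : PolyTime msg) :
    PolyTime fun a => circuitD (F a) (D a) (G a) (k a) (msg a) := by
  unfold ELWM.circuitD
  refine PolyTime.circuit (by fun_prop) ?_ ?_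
  · refine PolyTime.append (PolyTime.append (by fun_prop)
      (.cons (.gate (fun s t => .const _) ?_ ?_) (.const _))) ?_ <;> fun_prop
  · refine PolyTime.map (h := fun a t => (F a).numIn + 1 + (F a).size + (D a).size + (G a).size + 1 +
      k a * ((((D a).placedOuts (List.range (F a).numIn) ((F a).numIn + 1 + (F a).size)
        (F a).numIn).drop (1 + (G a).numIn)).take (Nat.clog 2 (k a))).length.add 2 + 1 +
      (3 * t + 2)) ?_ ?_
    · simp only [Nat.add_eq]; fun_prop
    · fun_prop

@[fun_prop]
theorem PolyTime.pad {C : α → Circuit} {s : α → ℕ} (hC : PolyTime C) (hs : PolyTime s) :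
    PolyTime fun a => (C a).pad (s a) := by
  unfold Circuit.pad
  fun_prop

end circuits

/-! ### Decoding in polynomial time, used to unpack advice strings -/

section decoding

/-- Types whose elements can be recovered in polynomial time from their representation. -/
class TreeDec (α : Type) [TreeEnc α] where
  dec : Val → α
  dec_enc : ∀ a : α, dec (TreeEnc.enc a) = a
  dec_poly : PolyTime dec

variable {α β γ : Type} [TreeEnc α] [TreeEnc β] [TreeEnc γ]

@[fun_prop]
theorem PolyTime.dec [TreeDec β] {f : α → Val} (hf : PolyTime f) :
    PolyTime fun a => (TreeDec.dec (f a) : β) := TreeDec.dec_poly.comp hf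

instance : TreeDec Val := ⟨fun v => v, fun _ => rfl, .id⟩

instance : TreeDec Unit := ⟨fun _ => (), fun _ => rfl, .const _⟩

instance : TreeDec Bool := ⟨Val.isNode, fun b => by cases b <;> rfl, polyTime_isNode⟩

instance [TreeDec α] [TreeDec β] : TreeDec (α × β) :=
  ⟨fun v => (TreeDec.dec v.fst, TreeDec.dec v.snd),
    fun a => Prod.ext (TreeDec.dec_enc a.1) (TreeDec.dec_enc a.2), by fun_prop⟩

/-- The list of left children along the right spine of a tree. -/
def Val.spine : Val → List Val
  | .leaf => []
  | .node a b => a :: b.spine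

theorem Val.enc_spine (v : Val) : TreeEnc.enc v.spine = v := by
  induction v with
  | leaf => rfl
  | node a b _ ih =>
    change Val.node a (TreeEnc.enc b.spine) = _
    rw [ih]

@[fun_prop]
theorem PolyTime.spine {f : α → Val} (hf : PolyTime f) : PolyTime fun a => (f a).spine :=
  .of_enc hf fun a => (f a).enc_spine

theorem spine_enc_list (l : List α) : (TreeEnc.enc l).spine = l.map TreeEnc.enc := by
  induction l with
  | nil => rfl
  | cons a l ih =>
    change TreeEnc.enc a :: (TreeEnc.enc l).spine = _
    rw [ih]; rfl

instance [TreeDec α] : TreeDec (List α) :=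
  ⟨fun v => v.spine.map TreeDec.dec, fun l => by
    simp [spine_enc_list, Function.comp_def, TreeDec.dec_enc],
    PolyTime.map (h := fun (_ : Val) v => (TreeDec.dec v : α)) (by fun_prop) (by fun_prop)⟩

instance : TreeDec ℕ :=
  ⟨fun v => v.spine.length, fun n => by
    induction n with
    | zero => rfl
    | succ n ih =>
      change (Val.leaf :: (TreeEnc.enc n).spine).length = _
      rw [List.length_cons, ih], by fun_prop⟩

def Gate.ofTuple (t : Bool × Bool × Bool × Bool × ℕ × ℕ) : Gate :=
  ⟨fun a b => bif a then (bif b then t.2.2.2.1 else t.2.2.1) else (bif b then t.2.1 else t.1),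
    t.2.2.2.2.1, t.2.2.2.2.2⟩

instance : TreeDec Gate :=
  ⟨fun v => Gate.ofTuple (TreeDec.dec v), fun g => by
    apply Gate.toTuple_inj
    have : TreeDec.dec (TreeEnc.enc g) = g.toTuple := TreeDec.dec_enc g.toTuple
    rw [this]; rfl,
    PolyTime.of_enc (g := fun v => TreeEnc.enc
      (TreeDec.dec v : Bool × Bool × Bool × Bool × ℕ × ℕ)) (by fun_prop) fun _ => rfl⟩

instance : TreeDec Circuit :=
  ⟨fun v => ⟨(TreeDec.dec v : ℕ × List Gate × List ℕ).1,
    (TreeDec.dec v : ℕ × List Gate × List ℕ).2.1, (TreeDec.dec v : ℕ × List Gate × List ℕ).2.2⟩,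
    fun C => by
      have : (TreeDec.dec (TreeEnc.enc C) : ℕ × List Gate × List ℕ) = (C.numIn, C.gates, C.outs) :=
        TreeDec.dec_enc (C.numIn, C.gates, C.outs)
      rw [this], by fun_prop⟩

end decoding

/-! ## Random tapes -/

theorem unifBits_apply (n : ℕ) (l : List Bool) :
    unifBits n l = if l.length = n then (2 ^ n : ENNReal)⁻¹ else 0 := by
  rw [unifBits, PMF.map_apply]
  split_ifs with h
  · subst h
    rw [tsum_eq_single fun i => l[i]]
    · have : l = List.ofFn fun i : Fin l.length => l[i] := by simp
      rw [if_pos this, PMF.uniformOfFintype_apply]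
      simp
    · intro f hf
      rw [if_neg]
      rintro h
      apply hf
      have : List.ofFn (fun i : Fin l.length => l[i]) = List.ofFn f := by rw [← h]; simp
      exact (List.ofFn_injective this).symm
  · rw [ENNReal.tsum_eq_zero]
    intro f
    rw [if_neg]
    rintro rfl
    simp at h

theorem length_of_mem_unifBits {n : ℕ} {l : List Bool} (h : l ∈ (unifBits n).support) :
    l.length = n := by
  rw [PMF.mem_support_iff, unifBits_apply] at h
  by_contra h'
  simp [h'] at h

/-- A tape consists of two independent tapes. In the sum over prefixes only the prefix of length `u`
of the given string contributes. -/
theorem unifBits_add (u v : ℕ) :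
    unifBits (u + v) = (unifBits u).bind fun r => (unifBits v).map fun r' => r ++ r' := by
  ext l
  rw [PMF.bind_apply, unifBits_apply]
  have hm : ∀ r : List Bool, ((unifBits v).map fun r' => r ++ r') l =
      if r = l.take r.length ∧ l.length = r.length + v then (2 ^ v : ENNReal)⁻¹ else 0 := by
    intro r
    rw [PMF.map_apply, tsum_eq_single (l.drop r.length)]
    · rw [unifBits_apply]
      have e : l = r ++ l.drop r.length ↔ r = l.take r.length := by
        conv_lhs => lhs; rw [← List.take_append_drop r.length l]
        constructor
        · intro h
          have := List.append_cancel_right h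
          exact this.symm
        · intro h; rw [← h]
      by_cases h1 : r = l.take r.length
      · have h3 : r.length ≤ l.length := by
          have := congrArg List.length h1
          rw [List.length_take] at this; omega
        rw [if_pos (e.2 h1)]
        refine if_congr ?_ rfl rfl
        rw [List.length_drop]
        constructor
        · intro h; exact ⟨h1, by omega⟩
        · intro h; omega
      · rw [if_neg (fun h => h1 (e.1 h)), if_neg (fun h => h1 h.1)]
    · intro r' hr'
      rw [if_neg]
      rintro rfl
      simp at hr'
  simp only [hm, unifBits_apply]
  split_ifs with h
  · rw [tsum_eq_single (l.take u)]
    · have h1 : (l.take u).length = u := by rw [List.length_take]; omega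
      rw [if_pos h1, if_pos ⟨by rw [h1], by omega⟩, pow_add, ENNReal.mul_inv] <;> simp
    · intro r hr
      by_cases h1 : r.length = u
      · rw [if_neg (c := _ ∧ _), mul_zero]
        rintro ⟨h2, _⟩
        exact hr (by rw [h2, h1])
      · simp [h1]
  · symm
    rw [ENNReal.tsum_eq_zero]
    intro r
    by_cases h1 : r.length = u
    · rw [if_neg (c := _ ∧ _), mul_zero]
      rintro ⟨_, h2⟩
      exact h (by omega)
    · simp [h1]

/-- Bits that are not read integrate out, so a tape may be longer than needed. -/
theorem unifBits_map_take {u n : ℕ} (h : u ≤ n) :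
    (unifBits n).map (List.take u) = unifBits u := by
  obtain ⟨v, rfl⟩ := Nat.exists_eq_add_of_le h
  rw [unifBits_add, PMF.map_bind]
  have : ∀ r ∈ (unifBits u).support,
      ((unifBits v).map fun r' => r ++ r').map (List.take u) = PMF.pure r := by
    intro r hr
    have hl := length_of_mem_unifBits hr
    rw [PMF.map_comp]
    have : (List.take u ∘ fun r' => r ++ r') = Function.const _ r := by
      funext r'; simp [← hl]
    rw [this, PMF.map_const]
  have h2 : (unifBits u).bind (fun r => ((unifBits v).map fun r' => r ++ r').map (List.take u)) =
      (unifBits u).bind PMF.pure := by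
    ext l
    rw [PMF.bind_apply, PMF.bind_apply]
    refine tsum_congr fun r => ?_
    by_cases hr : r ∈ (unifBits u).support
    · rw [this r hr]
    · rw [PMF.mem_support_iff, not_not] at hr
      simp [hr]
  rw [h2, PMF.bind_pure]

theorem pmf_bind_congr {α β : Type} {p : PMF α} {f g : α → PMF β}
    (h : ∀ a ∈ p.support, f a = g a) : p.bind f = p.bind g := by
  ext b
  rw [PMF.bind_apply, PMF.bind_apply]
  refine tsum_congr fun a => ?_
  by_cases ha : a ∈ p.support
  · rw [h a ha]
  · rw [PMF.mem_support_iff, not_not] at ha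
    simp [ha]

theorem unifBits_one : unifBits 1 = unifBit.map fun b => [b] := by
  ext l
  rw [unifBits_apply, PMF.map_apply]
  simp only [tsum_bool, unifBit, PMF.uniformOfFintype_apply]
  rcases l with _ | ⟨b, _ | ⟨c, l⟩⟩
  · simp
  · cases b <;> simp
  · simp

/-! ### Closure properties of probabilistic polynomial time -/

section tapes

variable {α β γ : Type} [TreeEnc α] [TreeEnc β] [TreeEnc γ]

/-- PPT algorithms, in a form where the random tape may be longer than needed. -/
def TapePPT (A : α → PMF β) : Prop :=
  ∃ (f : α × List Bool → β) (q : Polynomial ℕ), PolyTime f ∧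
    ∀ a N, q.eval (esize a) ≤ N → A a = (unifBits N).map fun r => f (a, r)

theorem TapePPT.ppt {A : α → PMF β} (h : TapePPT A) : PPT A := by
  obtain ⟨f, q, hf, h⟩ := h
  exact ⟨f, q, hf, fun a => h a _ le_rfl⟩

/-- The program computes the required length from the size of its input and cuts off the surplus
bits. -/
theorem PPT.tapePPT {A : α → PMF β} (h : PPT A) : TapePPT A := by
  obtain ⟨f, p, hf, h⟩ := h
  refine ⟨fun t => f (t.1, t.2.take (p.eval (esize t.1))), p, ?_, fun a N hN => ?_⟩
  · have h1 : PolyTime fun t : α × List Bool => p.eval (esize t.1) :=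
      PolyTime.polyEval p (by fun_prop)
    have h2 : PolyTime fun t : α × List Bool => (t.1, t.2.take (p.eval (esize t.1))) :=
      PolyTime.prodMk (by fun_prop) (h1.take (by fun_prop))
    exact hf.comp h2
  · rw [h a, ← unifBits_map_take hN, PMF.map_comp]
    rfl

theorem PPT.comp {A : β → PMF γ} (hA : PPT A) {f : α → β} (hf : PolyTime f) :
    PPT fun a => A (f a) := by
  obtain ⟨g, q, hg, h⟩ := hA.tapePPT
  obtain ⟨p, hp⟩ := hf.polyBounded
  refine TapePPT.ppt ⟨fun t => g (f t.1, t.2), q.comp p, ?_, fun a N hN => h _ _ ?_⟩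
  · exact hg.comp (by fun_prop)
  · rw [Polynomial.eval_comp] at hN
    exact (polyEval_mono q (hp a)).trans hN

theorem PPT.pure {f : α → β} (hf : PolyTime f) : PPT fun a => (PMF.pure (f a)) :=
  TapePPT.ppt ⟨fun t => f t.1, 0, by fun_prop, fun a N _ => by
    have : (fun r : List Bool => f (a, r).1) = Function.const _ (f a) := rfl
    rw [this, PMF.map_const]⟩

/-- A single tape serves both algorithms: `A` uses the first bits and `B` all the others. The length
that `B` needs varies with the output of `A`; as `B` tolerates a tape that is too long, an upper
bound over all these outputs suffices. -/
theorem PPT.bind {A : α → PMF β} {B : α → β → PMF γ} (hA : PPT A)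
    (hB : PPT fun t : α × β => B t.1 t.2) : PPT fun a => (A a).bind (B a) := by
  obtain ⟨f, p, hf, hA⟩ := hA
  obtain ⟨g, q, hg, hB⟩ := hB.tapePPT
  obtain ⟨b, hb⟩ := hf.polyBounded
  have h1 : PolyTime fun t : α × List Bool => p.eval (esize t.1) :=
    PolyTime.polyEval p (by fun_prop)
  have h2 : PolyTime fun t : α × List Bool => f (t.1, t.2.take (p.eval (esize t.1))) :=
    hf.comp (PolyTime.prodMk (by fun_prop) (h1.take (by fun_prop)))
  have h3 : PolyTime fun t : α × List Bool => t.2.drop (p.eval (esize t.1)) :=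
    h1.drop (by fun_prop)
  have h4 : PolyTime fun t : α × List Bool =>
      ((t.1, f (t.1, t.2.take (p.eval (esize t.1)))), t.2.drop (p.eval (esize t.1))) := by
    fun_prop
  -- A tape of `p` bits has an encoding of size at most `4 * p + 1`. Hence `b` bounds the output of
  -- `A` at `X + (4 * p + 1) + 1`, and `q` is taken at the size of the pair of input and output.
  refine TapePPT.ppt ⟨_, p + q.comp (Polynomial.X + b.comp (Polynomial.X + (4 * p + 1) + 1) + 1), hg.comp h4,
    fun a N hN => ?_⟩
  simp only [Polynomial.eval_add, Polynomial.eval_comp, Polynomial.eval_mul, Polynomial.eval_X,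
    Polynomial.eval_one, Polynomial.eval_ofNat] at hN
  obtain ⟨v, rfl⟩ := Nat.exists_eq_add_of_le ((Nat.le_add_right _ _).trans hN)
  beta_reduce
  rw [unifBits_add, PMF.map_bind, hA a, PMF.bind_map]
  refine pmf_bind_congr fun r hr => ?_
  have hr' := length_of_mem_unifBits hr
  rw [PMF.map_comp]
  simp only [Function.comp_def, ← hr', List.take_left, List.drop_left]
  refine hB (a, f (a, r)) v ?_
  refine le_trans (polyEval_mono q ?_) (Nat.le_of_add_le_add_left hN)
  have h5 := hb (a, r)
  have h6 : esize r ≤ 4 * r.length + 1 := by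
    have := esize_list_le (l := r) (B := 3) fun b _ => esize_bool_le b
    omega
  have h7 := polyEval_mono b (x := esize (a, r)) (y := esize a + (4 * p.eval (esize a) + 1) + 1) (by
    rw [esize_prod]; simp only; omega)
  rw [esize_prod]
  simp only
  omega

theorem PPT.map {A : α → PMF β} {f : α → β → γ} (hA : PPT A)
    (hf : PolyTime fun t : α × β => f t.1 t.2) : PPT fun a => (A a).map (f a) := by
  simpa only [← PMF.bind_pure_comp] using PPT.bind hA (PPT.pure hf)

theorem PPT.unifBits {n : α → ℕ} (hn : PolyTime n) : PPT fun a => unifBits (n a) := by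
  obtain ⟨p, hp⟩ := hn.polyBounded
  refine TapePPT.ppt ⟨fun t => t.2.take (n t.1), p, ?_, fun a N hN => ?_⟩
  · exact (hn.comp (by fun_prop)).take (by fun_prop)
  · refine (unifBits_map_take (le_trans ?_ ((hp a).trans hN))).symm
    rw [esize_nat]; omega

theorem PPT.unifBit : PPT fun _ : α => unifBit := by
  have := (PPT.unifBits (.const (α := α) 1)).map (f := fun _ l => l.headD false) (by fun_prop)
  have e : (ELWM.unifBits 1).map (fun l => l.headD false) = ELWM.unifBit := by
    rw [unifBits_one, PMF.map_comp]
    exact PMF.map_id _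
  rwa [e] at this

end tapes

/-! ## Probabilities -/

theorem pmf_bind_eq {α β : Type} (p : PMF α) (f : α → PMF β) : p >>= f = p.bind f := rfl

theorem pmf_pure_eq {α : Type} (a : α) : (pure a : PMF α) = PMF.pure a := rfl

theorem prTrue_nonneg (p : PMF Bool) : 0 ≤ prTrue p := ENNReal.toReal_nonneg

theorem prTrue_le_one (p : PMF Bool) : prTrue p ≤ 1 := by
  have := ENNReal.toReal_mono ENNReal.one_ne_top (p.coe_le_one true)
  simpa [prTrue] using this

theorem pmf_summable {α : Type} (p : PMF α) : Summable fun a => (p a).toReal :=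
  ENNReal.summable_toReal p.tsum_coe_ne_top

theorem pmf_tsum_toReal {α : Type} (p : PMF α) : ∑' a, (p a).toReal = 1 := by
  rw [← ENNReal.tsum_toReal_eq fun a => p.apply_ne_top a, p.tsum_coe, ENNReal.toReal_one]

theorem prTrue_bind {α : Type} (p : PMF α) (f : α → PMF Bool) :
    prTrue (p.bind f) = ∑' a, (p a).toReal * prTrue (f a) := by
  rw [prTrue, PMF.bind_apply, ENNReal.tsum_toReal_eq fun a =>
    ENNReal.mul_ne_top (p.apply_ne_top a) ((f a).apply_ne_top true)]
  simp [prTrue, ENNReal.toReal_mul]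

theorem summable_mul_of_abs_le {α : Type} (p : PMF α) {g : α → ℝ} {B : ℝ} (h : ∀ a, |g a| ≤ B) :
    Summable fun a => (p a).toReal * g a := by
  refine Summable.of_norm_bounded ((pmf_summable p).mul_right B) fun a => ?_
  rw [norm_mul, Real.norm_eq_abs, abs_of_nonneg ENNReal.toReal_nonneg]
  exact mul_le_mul_of_nonneg_left (h a) ENNReal.toReal_nonneg

theorem prTrue_sub_abs_le_one (p q : PMF Bool) : |prTrue p - prTrue q| ≤ 1 := by
  rw [abs_le]
  have := prTrue_nonneg p; have := prTrue_nonneg q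
  have := prTrue_le_one p; have := prTrue_le_one q
  constructor <;> linarith

theorem abs_prTrue_bind_sub_le {α : Type} (p : PMF α) (f g : α → PMF Bool) :
    |prTrue (p.bind f) - prTrue (p.bind g)| ≤
      ∑' a, (p a).toReal * |prTrue (f a) - prTrue (g a)| := by
  have h : ∀ f : α → PMF Bool, Summable fun a => (p a).toReal * prTrue (f a) := fun f =>
    summable_mul_of_abs_le p (B := 1) fun a => by
      rw [abs_of_nonneg (prTrue_nonneg _)]; exact prTrue_le_one _
  rw [prTrue_bind, prTrue_bind, ← (h f).tsum_sub (h g)]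
  have h1 : Summable fun a => (p a).toReal * |prTrue (f a) - prTrue (g a)| :=
    summable_mul_of_abs_le p (B := 1) fun a => by
      rw [abs_abs]; exact prTrue_sub_abs_le_one _ _
  have h2 : ∀ a, ‖(p a).toReal * prTrue (f a) - (p a).toReal * prTrue (g a)‖ =
      (p a).toReal * |prTrue (f a) - prTrue (g a)| := fun a => by
    rw [← mul_sub, norm_mul, Real.norm_eq_abs, Real.norm_eq_abs,
      abs_of_nonneg ENNReal.toReal_nonneg]
  have := norm_tsum_le_tsum_norm (h1.congr fun a => (h2 a).symm)
  simpa only [h2, Real.norm_eq_abs] using this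

/-- Averaging: some outcome is at least as good as the average. -/
theorem exists_mem_support_abs_le {α : Type} (p : PMF α) (f g : α → PMF Bool) :
    ∃ a ∈ p.support, |prTrue (p.bind f) - prTrue (p.bind g)| ≤ |prTrue (f a) - prTrue (g a)| := by
  by_contra! hc
  set t := |prTrue (p.bind f) - prTrue (p.bind g)| with ht
  obtain ⟨a₀, ha₀⟩ := p.support_nonempty
  have h1 : Summable fun a => (p a).toReal * |prTrue (f a) - prTrue (g a)| :=
    summable_mul_of_abs_le p (B := 1) fun a => by
      rw [abs_abs]; exact prTrue_sub_abs_le_one _ _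
  have hpos : ∀ a ∈ p.support, 0 < (p a).toReal := fun a ha =>
    ENNReal.toReal_pos ((p.mem_support_iff a).1 ha) (p.apply_ne_top a)
  -- If every outcome in the support fell short of `t`, so would the weighted average, strictly
  -- because the support is nonempty; but the average is at least `t`.
  have h2 : ∑' a, (p a).toReal * |prTrue (f a) - prTrue (g a)| < ∑' a, (p a).toReal * t := by
    refine h1.tsum_lt_tsum (i := a₀) (fun a => ?_) ?_ ((pmf_summable p).mul_right t)
    · by_cases ha : a ∈ p.support
      · exact mul_le_mul_of_nonneg_left (hc a ha).le ENNReal.toReal_nonneg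
      · rw [PMF.mem_support_iff, not_not] at ha
        simp [ha]
    · exact mul_lt_mul_of_pos_left (hc a₀ ha₀) (hpos a₀ ha₀)
  rw [tsum_mul_right, pmf_tsum_toReal, one_mul] at h2
  exact absurd (abs_prTrue_bind_sub_le p f g) (not_le.2 h2)

/-- Off `s` the contributions cancel, and on `s` a difference of two probabilities is at most 1. -/
theorem abs_prTrue_bind_sub_le_of_eq_off {α : Type} (p : PMF α) (f g : α → PMF Bool) (s : Set α)
    (h : ∀ a ∈ p.support, a ∉ s → f a = g a) :
    |prTrue (p.bind f) - prTrue (p.bind g)| ≤ (p.toOuterMeasure s).toReal := by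
  refine (abs_prTrue_bind_sub_le p f g).trans ?_
  rw [PMF.toOuterMeasure_apply, ENNReal.tsum_toReal_eq fun a => by
    by_cases ha : a ∈ s
    · simp [ha, p.apply_ne_top a]
    · simp [ha]]
  have hs : Summable fun a => (s.indicator p a).toReal := by
    refine (pmf_summable p).of_nonneg_of_le (fun a => ENNReal.toReal_nonneg) fun a => ?_
    by_cases ha : a ∈ s <;> simp [ha]
  refine Summable.tsum_le_tsum (fun a => ?_) ?_ hs
  · by_cases ha : a ∈ s
    · rw [Set.indicator_of_mem ha]
      exact mul_le_of_le_one_right ENNReal.toReal_nonneg (prTrue_sub_abs_le_one _ _)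
    · by_cases hp : a ∈ p.support
      · simp [h a hp ha]
      · rw [PMF.mem_support_iff, not_not] at hp
        simp [hp]
  · exact summable_mul_of_abs_le p (B := 1) fun a => by
      rw [abs_abs]; exact prTrue_sub_abs_le_one _ _

theorem prTrue_map {α : Type} (p : PMF α) (b : α → Bool) :
    prTrue (p.map b) = (p.toOuterMeasure {a | b a = true}).toReal := by
  rw [prTrue, PMF.map_apply, PMF.toOuterMeasure_apply]
  congr 2
  funext a
  by_cases h : b a = true <;> simp [h, Set.indicator]

theorem prTrue_map_not (p : PMF Bool) : prTrue (p.map not) = 1 - prTrue p := by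
  have h := pmf_tsum_toReal p
  rw [tsum_bool] at h
  rw [prTrue, PMF.map_apply, tsum_bool]
  simp [prTrue]
  linarith

/-- When the coin is 0 a correct guess is the answer 0, so the success probability is the mean of
`prTrue (F true)` and `1 - prTrue (F false)`. This translates guessing games into distinguishing
games. -/
theorem prTrue_coin (F : Bool → PMF Bool) :
    2 * |prTrue (unifBit.bind fun c => (F c).map fun c' => c == c') - 1 / 2| =
      |prTrue (F true) - prTrue (F false)| := by
  have h1 : (fun c' : Bool => true == c') = id := by funext c; cases c <;> rfl
  have h2 : (fun c' : Bool => false == c') = not := by funext c; cases c <;> rfl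
  rw [prTrue_bind, tsum_bool, h1, h2, prTrue_map_not, PMF.map_id]
  have hu : ∀ b : Bool, (unifBit b).toReal = 1 / 2 := fun b => by
    simp [unifBit, PMF.uniformOfFintype_apply]
  rw [hu, hu]
  have : 1 / 2 * (1 - prTrue (F false)) + 1 / 2 * prTrue (F true) - 1 / 2 =
    (prTrue (F true) - prTrue (F false)) / 2 := by ring
  rw [this, abs_div, abs_two]
  ring

/-! ## Negligible functions -/

theorem Negligible.of_abs_le {f g : ℕ → ℝ} (hg : Negligible g) (h : ∀ lam, |f lam| ≤ |g lam|) :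
    Negligible f :=
  Asymptotics.SuperpolynomialDecay.trans_abs_le hg h

theorem Negligible.add {f g : ℕ → ℝ} (hf : Negligible f) (hg : Negligible g) :
    Negligible fun lam => f lam + g lam :=
  Asymptotics.SuperpolynomialDecay.add hf hg

theorem negligible_zero : Negligible fun _ => 0 := Asymptotics.superpolynomialDecay_zero _ _

/-! ## Computational indistinguishability -/

section indist

variable {α β γ σ ω : Type} [TreeEnc α] [TreeEnc β] [TreeEnc γ] [TreeEnc ω]

/-- A sequence of objects of polynomial size. -/
def PolySizeSeq (w : ℕ → ω) : Prop := ∃ p : Polynomial ℕ, ∀ lam, esize (w lam) ≤ p.eval lam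

theorem polySizeSeq_id : PolySizeSeq fun lam : ℕ => lam :=
  ⟨2 * Polynomial.X + 1, fun lam => by simp [esize_nat]⟩

theorem polySizeSeq_const (a : α) : PolySizeSeq fun _ : ℕ => a :=
  ⟨Polynomial.C (esize a), fun lam => by simp⟩

theorem PolySizeSeq.prodMk {v : ℕ → α} {w : ℕ → β} (hv : PolySizeSeq v) (hw : PolySizeSeq w) :
    PolySizeSeq fun lam => (v lam, w lam) := by
  obtain ⟨p, hp⟩ := hv
  obtain ⟨q, hq⟩ := hw
  refine ⟨p + q + 1, fun lam => ?_⟩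
  have := hp lam; have := hq lam
  simp only [esize_prod, Polynomial.eval_add, Polynomial.eval_one]
  omega

theorem PolySizeSeq.comp {f : α → β} (hf : PolyTime f) {w : ℕ → α} (hw : PolySizeSeq w) :
    PolySizeSeq fun lam => f (w lam) := by
  obtain ⟨p, hp⟩ := hw
  obtain ⟨q, hq⟩ := hf.polyBounded
  refine ⟨q.comp p, fun lam => ?_⟩
  rw [Polynomial.eval_comp]
  exact (hq _).trans (polyEval_mono q (hp lam))

theorem PolySizeSeq.ite {v w : ℕ → α} (hv : PolySizeSeq v) (hw : PolySizeSeq w) {c : ℕ → Prop}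
    [∀ lam, Decidable (c lam)] : PolySizeSeq fun lam => if c lam then v lam else w lam := by
  obtain ⟨p, hp⟩ := hv
  obtain ⟨q, hq⟩ := hw
  refine ⟨p + q, fun lam => ?_⟩
  have := hp lam; have := hq lam
  simp only [Polynomial.eval_add]
  split_ifs <;> omega

theorem PolyTime.polySizeSeq {w : ℕ → α} (hw : PolyTime w) : PolySizeSeq w :=
  PolySizeSeq.comp hw polySizeSeq_id

theorem esize_bits_le (l : List Bool) : esize l ≤ 4 * l.length + 1 := by
  have := esize_list_le (l := l) (B := 3) fun b _ => esize_bool_le b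
  omega

theorem polySizeSeq_bits {w : ℕ → List Bool} {n : ℕ → ℕ} (hn : PolySizeSeq n)
    (h : ∀ lam, (w lam).length = n lam) : PolySizeSeq w := by
  obtain ⟨p, hp⟩ := hn
  refine ⟨4 * p + 1, fun lam => ?_⟩
  have h1 := hp lam
  have h2 := esize_bits_le (w lam)
  rw [esize_nat] at h1
  rw [h] at h2
  simp only [Polynomial.eval_add, Polynomial.eval_mul, Polynomial.eval_one, Polynomial.eval_ofNat]
  omega

theorem PPT.support_bound {A : α → PMF β} (hA : PPT A) :
    ∃ p : Polynomial ℕ, ∀ a, ∀ b ∈ (A a).support, esize b ≤ p.eval (esize a) := by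
  obtain ⟨f, p, hf, hA⟩ := hA
  obtain ⟨q, hq⟩ := hf.polyBounded
  refine ⟨q.comp (Polynomial.X + (4 * p + 1) + 1), fun a b hb => ?_⟩
  rw [hA, PMF.mem_support_map_iff] at hb
  obtain ⟨r, hr, rfl⟩ := hb
  refine (hq _).trans ?_
  rw [Polynomial.eval_comp]
  refine polyEval_mono q ?_
  have := esize_bits_le r
  rw [length_of_mem_unifBits hr] at this
  rw [esize_prod]
  simp
  omega

/-- The elements of the supports of `X lam` have polynomial size. -/
def PolySupport (X : ℕ → PMF α) : Prop :=
  ∃ p : Polynomial ℕ, ∀ lam, ∀ a ∈ (X lam).support, esize a ≤ p.eval lam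

theorem PPT.polySupport {A : α → PMF β} (hA : PPT A) {v : ℕ → α} (hv : PolySizeSeq v) :
    PolySupport fun lam => A (v lam) := by
  obtain ⟨p, hp⟩ := hA.support_bound
  obtain ⟨q, hq⟩ := hv
  refine ⟨p.comp q, fun lam a ha => ?_⟩
  rw [Polynomial.eval_comp]
  exact (hp _ _ ha).trans (polyEval_mono p (hq lam))

theorem PolySupport.polySizeSeq {X : ℕ → PMF α} (hX : PolySupport X) {w : ℕ → α}
    (hw : ∀ lam, w lam ∈ (X lam).support) : PolySizeSeq w := by
  obtain ⟨p, hp⟩ := hX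
  exact ⟨p, fun lam => hp lam _ (hw lam)⟩

theorem PPT.polySizeSeq {A : α → PMF β} (hA : PPT A) {v : ℕ → α} {w : ℕ → β} (hv : PolySizeSeq v)
    (hw : ∀ lam, w lam ∈ (A (v lam)).support) : PolySizeSeq w :=
  (hA.polySupport hv).polySizeSeq hw

/-- Computational indistinguishability. -/
def Indist (X Y : ℕ → PMF α) : Prop :=
  ∀ D : Distinguisher α, Negligible fun lam =>
    |prTrue ((X lam).bind (D.run lam)) - prTrue ((Y lam).bind (D.run lam))|

theorem Indist.symm {X Y : ℕ → PMF α} (h : Indist X Y) : Indist Y X := fun D => by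
  simpa only [abs_sub_comm] using h D

theorem Indist.trans {X Y Z : ℕ → PMF α} (h : Indist X Y) (h' : Indist Y Z) : Indist X Z :=
  fun D => ((h D).add (h' D)).of_abs_le fun lam => by
    rw [abs_abs]
    refine (abs_sub_le _ (prTrue ((Y lam).bind (D.run lam))) _).trans (le_abs_self _)

theorem Indist.congr {X Y X' Y' : ℕ → PMF α} (h : Indist X Y) (hX : ∀ lam, X' lam = X lam)
    (hY : ∀ lam, Y' lam = Y lam) : Indist X' Y' := by
  rw [funext hX, funext hY]; exact h

/-- It is enough to prove indistinguishability when a part of the randomness is fixed. -/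
theorem Indist.mix (p : ℕ → PMF σ) {X Y : ℕ → σ → PMF α}
    (h : ∀ s : ℕ → σ, (∀ lam, s lam ∈ (p lam).support) →
      Indist (fun lam => X lam (s lam)) fun lam => Y lam (s lam)) :
    Indist (fun lam => (p lam).bind (X lam)) fun lam => (p lam).bind (Y lam) := by
  intro D
  -- The fixed outcome is chosen for each security parameter after the distinguisher, so it may
  -- depend on it; this is harmless because the hypothesis covers all sequences of outcomes.
  choose s hs hle using fun lam => exists_mem_support_abs_le (p lam)
    (fun a => (X lam a).bind (D.run lam)) fun a => (Y lam a).bind (D.run lam)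
  refine (h s hs D).of_abs_le fun lam => ?_
  simpa only [PMF.bind_bind, abs_abs] using hle lam

theorem Indist.of_statistical (p : ℕ → PMF σ) {X Y : ℕ → σ → PMF α} (s : ℕ → Set σ)
    (hs : Negligible fun lam => ((p lam).toOuterMeasure (s lam)).toReal)
    (h : ∀ lam, ∀ a ∈ (p lam).support, a ∉ s lam → X lam a = Y lam a) :
    Indist (fun lam => (p lam).bind (X lam)) fun lam => (p lam).bind (Y lam) := fun D => by
  refine hs.of_abs_le fun lam => ?_
  rw [abs_abs, abs_of_nonneg ENNReal.toReal_nonneg]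
  simp only [PMF.bind_bind]
  exact abs_prTrue_bind_sub_le_of_eq_off _ _ _ _ fun a ha ha' => by rw [h lam a ha ha']

/-- Used where a hybrid step is needed at some security parameters only and the two experiments
coincide at the others. -/
theorem Indist.ite {X Y Z : ℕ → PMF α} (h : Indist X Y) (c : ℕ → Bool) :
    Indist (fun lam => if c lam then Z lam else X lam) fun lam =>
      if c lam then Z lam else Y lam := fun D => by
  refine (h D).of_abs_le fun lam => ?_
  by_cases hc : c lam = true <;> simp [hc]

/-! ### Reductions -/

/-- The classical preprocessing is carried out twice, for the choice of the circuit and for the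
final output; the quantum part is untouched. -/
def QAlg.precomp (A : QAlg β γ) (f : α → β) (hf : PolyTime f) : QAlg α γ where
  circ a := A.circ (f a)
  post t := A.post (f t.1, t.2)
  circ_poly := A.circ_poly.comp hf
  post_poly := A.post_poly.comp (by fun_prop)

theorem polySize_enc {w : ℕ → ω} (hw : PolySizeSeq w) : PolySize fun lam => TreeEnc.enc (w lam) := hw

/-- Compute the input of a distinguisher with the help of additional advice. -/
def Distinguisher.precomp [TreeDec ω] (D : Distinguisher α) {w : ℕ → ω} (hw : PolySizeSeq w)
    (f : ℕ × ω × β → α) (hf : PolyTime f) : Distinguisher β where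
  adv :=
    { str := fun lam => TreeEnc.enc (D.adv.str lam, w lam)
      reg := D.adv.reg
      str_poly := polySize_enc (PolySizeSeq.prodMk D.adv.str_poly hw)
      reg_poly := D.adv.reg_poly }
  alg := D.alg.precomp (fun t : ℕ × Val × β =>
      (t.1, t.2.1.fst, f (t.1, TreeDec.dec t.2.1.snd, t.2.2))) (by fun_prop)

theorem Distinguisher.precomp_run [TreeDec ω] (D : Distinguisher α) {w : ℕ → ω}
    (hw : PolySizeSeq w) (f : ℕ × ω × β → α) (hf : PolyTime f) (lam : ℕ) (b : β) :
    (D.precomp hw f hf).run lam b = D.run lam (f (lam, w lam, b)) := by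
  have : (D.precomp hw f hf).run lam b =
    D.run lam (f (lam, TreeDec.dec (TreeEnc.enc (w lam)), b)) := rfl
  rw [this, TreeDec.dec_enc]

theorem Indist.map [TreeDec ω] {X Y : ℕ → PMF β} (h : Indist X Y) {w : ℕ → ω} (hw : PolySizeSeq w)
    {f : ℕ × ω × β → α} (hf : PolyTime f) :
    Indist (fun lam => (X lam).map fun b => f (lam, w lam, b)) fun lam =>
      (Y lam).map fun b => f (lam, w lam, b) := fun D => by
  have := h (D.precomp hw f hf)
  simp only [PMF.bind_map, Function.comp_def]
  have e : ∀ lam, (D.precomp hw f hf).run lam = fun b => D.run lam (f (lam, w lam, b)) :=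
    fun lam => funext fun b => D.precomp_run hw f hf lam b
  simpa only [e] using this

/-- The coins of `B` are independent of the sample, so they can be drawn beforehand and fixed as
advice, which leaves a deterministic computation. One tape length has to serve all samples of both
families, and this is why their supports must have polynomial size. -/
theorem Indist.bind [TreeDec ω] {X Y : ℕ → PMF β} (h : Indist X Y) (hX : PolySupport X)
    (hY : PolySupport Y) {w : ℕ → ω} (hw : PolySizeSeq w) {B : ℕ × ω × β → PMF α} (hB : PPT B) :
    Indist (fun lam => (X lam).bind fun b => B (lam, w lam, b)) fun lam =>
      (Y lam).bind fun b => B (lam, w lam, b) := by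
  obtain ⟨f, q, hf, hB⟩ := hB.tapePPT
  obtain ⟨p₁, hp₁⟩ := hX
  obtain ⟨p₂, hp₂⟩ := hY
  obtain ⟨p₃, hp₃⟩ := hw
  -- The input of `B` consists of the unary security parameter (size `2 * lam + 1`), the advice and
  -- the sample, with two pairings of one vertex each.
  set N : Polynomial ℕ := q.comp (2 * Polynomial.X + p₁ + p₂ + p₃ + 3) with hN
  have key : ∀ Z : ℕ → PMF β,
      (∀ lam, ∀ b ∈ (Z lam).support, esize b ≤ p₁.eval lam + p₂.eval lam) → ∀ lam,
      ((Z lam).bind fun b => B (lam, w lam, b)) = (unifBits (N.eval lam)).bind fun r =>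
        (Z lam).map fun b => f ((lam, w lam, b), r) := by
    intro Z hZ lam
    simp only [← PMF.bind_pure_comp]
    rw [PMF.bind_comm]
    refine pmf_bind_congr fun b hb => ?_
    simp only [Function.comp_def]
    have : B (lam, w lam, b) = _ := hB (lam, w lam, b) (N.eval lam) (by
      rw [hN, Polynomial.eval_comp]
      refine polyEval_mono q ?_
      have := hZ lam b hb
      have := hp₃ lam
      simp [esize_prod, esize_nat]
      omega)
    rw [this, ← PMF.bind_pure_comp]
    rfl
  refine Indist.congr (Indist.mix (fun lam => unifBits (N.eval lam))
    (X := fun lam r => (X lam).map fun b => f ((lam, w lam, b), r))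
    (Y := fun lam r => (Y lam).map fun b => f ((lam, w lam, b), r)) fun r hr => ?_)
    (key X fun lam b hb => (hp₁ lam b hb).trans (by omega))
    (key Y fun lam b hb => (hp₂ lam b hb).trans (by omega))
  have hr' : PolySizeSeq r := polySizeSeq_bits
    (PolyTime.polySizeSeq (PolyTime.polyEval N .id)) fun lam => length_of_mem_unifBits (hr lam)
  exact h.map (w := fun lam => (w lam, r lam)) (PolySizeSeq.prodMk ⟨p₃, hp₃⟩ hr')
    (f := fun t => f ((t.1, t.2.1.1, t.2.2), t.2.1.2)) (hf.comp (by fun_prop))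

end indist

/-! ### The security assumptions as statements of indistinguishability -/

section tools

variable {α β γ σ ω : Type} [TreeEnc α] [TreeEnc β] [TreeEnc γ] [TreeEnc ω]

theorem IsSecurePRG.indist {PRG : ℕ → Circuit} {l m : ℕ → ℕ} (h : IsSecurePRG PRG l m) :
    Indist (fun lam => (unifBits (l lam)).map (PRG lam).eval) fun lam => unifBits (m lam) := by
  intro D
  have := h.pseudorandom D
  simp only [PMF.bind_map]
  exact this

/-- A sampler may read a fixed pair of circuits from its advice, so obfuscation security applies to
arbitrary sequences of equivalent circuits of polynomial size. -/
theorem IsSecureIO.indist {iO : ℕ → Circuit → PMF Circuit} (h : IsSecureIO iO) {C₀ C₁ : ℕ → Circuit}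
    (h₀ : PolySizeSeq C₀) (h₁ : PolySizeSeq C₁) (he : ∀ lam, (C₀ lam).Equivalent (C₁ lam)) :
    Indist (fun lam => iO lam (C₀ lam)) fun lam => iO lam (C₁ lam) := by
  intro D
  have hS : NonuniformPPTSampler fun lam => (PMF.pure (C₀ lam, C₁ lam, Val.leaf)) := by
    refine ⟨fun lam => TreeEnc.enc (C₀ lam, C₁ lam, Val.leaf),
      fun a => PMF.pure (TreeDec.dec a.2 : Circuit × Circuit × Val),
      polySize_enc (h₀.prodMk (h₁.prodMk (polySizeSeq_const _))), PPT.pure (by fun_prop),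
      fun lam => ?_⟩
    simp only [TreeDec.dec_enc]
  have := h.indistinguishability _ hS
    (D.precomp (w := fun _ => ()) (polySizeSeq_const _) (fun t : ℕ × Unit × Circuit × Val => t.2.2.1)
      (by fun_prop)) (negligible_zero.of_abs_le fun lam => by
        simp [PMF.toOuterMeasure_pure_apply, he lam])
  refine this.of_abs_le fun lam => ?_
  simp only [pmf_bind_eq, PMF.pure_bind, Distinguisher.precomp_run]
  exact le_rfl

theorem Circuit.Equivalent.refl (C : Circuit) : C.Equivalent C :=
  ⟨rfl, ⟨rfl, rfl⟩, fun _ _ => rfl⟩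

/-- Obfuscations of equivalent circuits are indistinguishable, also in the presence of auxiliary
information and if the circuits are equivalent with overwhelming probability only. -/
theorem IsSecureIO.indist_mix [TreeDec ω] {iO : ℕ → Circuit → PMF Circuit} (h : IsSecureIO iO)
    (p : ℕ → PMF σ) {C₀ C₁ : ℕ → σ → Circuit} {aux : ℕ → σ → ω}
    (h₀ : ∀ s : ℕ → σ, (∀ lam, s lam ∈ (p lam).support) → PolySizeSeq fun lam => C₀ lam (s lam))
    (h₁ : ∀ s : ℕ → σ, (∀ lam, s lam ∈ (p lam).support) → PolySizeSeq fun lam => C₁ lam (s lam))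
    (ha : ∀ s : ℕ → σ, (∀ lam, s lam ∈ (p lam).support) → PolySizeSeq fun lam => aux lam (s lam))
    (bad : ℕ → σ → Bool) (hb : Negligible fun lam => prTrue ((p lam).map (bad lam)))
    (he : ∀ lam, ∀ s ∈ (p lam).support, bad lam s = false → (C₀ lam s).Equivalent (C₁ lam s))
    {f : ℕ × ω × Circuit → α} (hf : PolyTime f) :
    Indist (fun lam => (p lam).bind fun s => (iO lam (C₀ lam s)).map fun C => f (lam, aux lam s, C))
      fun lam => (p lam).bind fun s => (iO lam (C₁ lam s)).map fun C => f (lam, aux lam s, C) := by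
  classical
  -- Once the randomness is fixed, a pair of circuits is either equivalent or not, and the small
  -- probability of failure is lost. The intermediate circuit separates the issues: it differs from
  -- `C₀` for bad outcomes only, a statistical difference, and it is equivalent to `C₁` for every
  -- outcome.
  set C' : ℕ → σ → Circuit := fun lam s =>
    if (C₀ lam s).Equivalent (C₁ lam s) then C₀ lam s else C₁ lam s with hC'
  refine Indist.trans (Y := fun lam => (p lam).bind fun s =>
    (iO lam (C' lam s)).map fun C => f (lam, aux lam s, C)) ?_ ?_
  · refine Indist.of_statistical p (fun lam => {s | bad lam s = true}) ?_ fun lam s hs hb => ?_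
    · simpa only [prTrue_map] using hb
    · have : (C₀ lam s).Equivalent (C₁ lam s) := he lam s hs (by simpa using hb)
      simp only [hC', if_pos this]
  · refine Indist.mix p fun s hs => ?_
    obtain ⟨q₀, h₀⟩ := h₀ s hs
    obtain ⟨q₁, h₁⟩ := h₁ s hs
    refine Indist.map (h.indist (C₀ := fun lam => C' lam (s lam)) ⟨q₀ + q₁, fun lam => ?_⟩
      ⟨q₁, h₁⟩ fun lam => ?_) (w := fun lam => aux lam (s lam)) (ha s hs) hf
    · have e₀ : esize (C₀ lam (s lam)) ≤ _ := h₀ lam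
      have e₁ : esize (C₁ lam (s lam)) ≤ _ := h₁ lam
      simp only [hC', Polynomial.eval_add]
      split_ifs <;> omega
    · simp only [hC']
      split_ifs with hh
      · exact hh
      · exact .refl _

/-- Punctured pseudorandomness for one-point sets, the only case that the proof needs; the
one-element list of values is replaced by its entry. -/
theorem PuncturablePRF.IsSecure.indist {P : PuncturablePRF} {n m : ℕ → ℕ} (h : P.IsSecure n m)
    (x : ℕ → List Bool) (hx : ∀ lam, (x lam).length = n lam) :
    Indist (fun lam => (P.gen lam).bind fun K => (P.puncture lam K [x lam]).map fun K' =>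
        (K', P.F lam K (x lam)))
      fun lam => (P.gen lam).bind fun K => (P.puncture lam K [x lam]).bind fun K' =>
        (unifBits (m lam)).map fun y => (K', y) := by
  intro D
  have := h.punctured_pseudorandom (fun lam => [x lam])
    (fun lam => ⟨List.nodup_singleton _, by simpa using hx lam⟩) ⟨1, by simp⟩
    (D.precomp (w := fun _ => ()) (polySizeSeq_const _)
      (fun t : ℕ × Unit × Val × List (List Bool) => (t.2.2.1, t.2.2.2.headD [])) (by fun_prop))
  refine this.of_abs_le fun lam => ?_
  simp only [pmf_bind_eq, Distinguisher.precomp_run, PMF.bind_bind, PMF.bind_map,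
    unifStrings, List.length_singleton, List.map_cons, List.map_nil, pmf_pure_eq,
    PMF.pure_bind, Function.comp_def, List.headD_cons]
  exact le_rfl

/-- No ancilla is added and nothing is measured, so the state is not disturbed. A two-stage
adversary can thus carry quantum advice through an idle first stage. -/
theorem QCircuit.run_trivial (ψ : QReg) : (⟨0, [], []⟩ : QCircuit).run ψ = PMF.pure ([], ψ) := by
  obtain ⟨n, ψ⟩ := ψ
  have he : ψ.extend 0 = ψ := by
    obtain ⟨v, hv⟩ := ψ
    simp only [QState.extend, QState.mk.injEq]
    funext b
    rw [if_pos (fun j => j.elim0)]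
    rfl
  -- The only possible outcome has probability 1, so the renormalisation divides by 1.
  have hc : ψ.collapse (fun _ => []) [] = ψ := by
    obtain ⟨v, hv⟩ := ψ
    have h1 : ∑ b, (if ([] : List Bool) = [] then ‖v b‖ ^ 2 else 0) = 1 := by simpa using hv
    unfold QState.collapse
    rw [dif_neg (by rw [h1]; exact one_ne_zero)]
    simp only [QState.mk.injEq]
    simp [hv]
  simp only [QCircuit.run, List.foldl_nil, QState.measurePart, PMF.map_comp]
  change (QState.measure (ψ.extend 0 : QState n)).map (fun _ => (([] : List Bool),
    (⟨n, QState.collapse (ψ.extend 0 : QState n) (fun _ => []) []⟩ : QReg))) = _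
  rw [he, hc]
  exact PMF.map_const _ _

/-- Strong ciphertext pseudorandomness for a fixed sequence of plaintexts. -/
theorem PuncturableEnc.IsSecure.indist {E : PuncturableEnc} {lp lct : ℕ → ℕ}
    (h : E.IsSecure lp lct) (msg : ℕ → List Bool) (hlen : ∀ lam, (msg lam).length = lp lam)
    (hsize : PolySizeSeq msg) :
    Indist (fun lam => (E.gen lam).bind fun key => (E.enc lam key.1 (msg lam)).bind fun c =>
        (E.puncture lam key.2 c).map fun dk' => (c, key.1, dk'))
      fun lam => (E.gen lam).bind fun key => (unifBits (lct lam)).bind fun c =>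
        (E.puncture lam key.2 c).map fun dk' => (c, key.1, dk') := by
  intro D
  -- The first stage sends the plaintext stored in the advice and leaves the register alone; the
  -- second stage is `D`.
  let A : TwoStage Unit (List Bool × Val × Val) lp :=
    { adv :=
        { str := fun lam => TreeEnc.enc (D.adv.str lam, msg lam)
          reg := D.adv.reg
          str_poly := polySize_enc (PolySizeSeq.prodMk D.adv.str_poly hsize)
          reg_poly := D.adv.reg_poly }
      stage1 :=
        { circ := fun _ => ⟨0, [], []⟩
          post := fun t => TreeDec.dec t.1.2.1.snd
          circ_poly := .const _
          post_poly := by fun_prop }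
      stage2 := D.alg.precomp (fun t => (t.1, t.2.1.fst, t.2.2.2.2)) (by fun_prop)
      stage1_length := fun lam a o => by
        change (TreeDec.dec (TreeEnc.enc (msg lam)) : List Bool).length = _
        rw [TreeDec.dec_enc, hlen] }
  have h1 : ∀ lam, A.first lam () = PMF.pure (msg lam, D.adv.reg lam) := by
    intro lam
    simp only [TwoStage.first, QAlg.run, A, QCircuit.run_trivial, PMF.pure_map]
    congr 2
    exact TreeDec.dec_enc (msg lam)
  have h2 : ∀ lam b, A.second lam () (msg lam) b (D.adv.reg lam) = D.run lam b := fun lam b => rfl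
  refine (h.strong_ciphertext_pseudorandom A).of_abs_le fun lam => ?_
  -- The coin is independent of the keys, the ciphertext and the uniform string, so it can be tossed
  -- before them; of the two candidates for the challenge the unused one later integrates out.
  have key : E.expSCPR lp lct A lam = unifBit.bind fun coin => ((E.gen lam).bind fun key =>
      (E.enc lam key.1 (msg lam)).bind fun c => (unifBits (lct lam)).bind fun r =>
      (E.puncture lam key.2 (if coin then r else c)).bind fun dk' =>
        D.run lam (if coin then r else c, key.1, dk')).map fun coin' => coin == coin' := by
    simp only [PuncturableEnc.expSCPR, h1, pmf_bind_eq, pmf_pure_eq,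
      PMF.pure_bind, h2, PMF.map_bind]
    rw [PMF.bind_comm unifBit]
    refine congrArg _ (funext fun key => ?_)
    rw [PMF.bind_comm unifBit]
    refine congrArg _ (funext fun c => ?_)
    rw [PMF.bind_comm unifBit]
    refine congrArg _ (funext fun r => ?_)
    rfl
  rw [key, prTrue_coin, abs_abs, abs_abs, abs_sub_comm]
  simp only [if_true, Bool.false_eq_true, if_false, PMF.bind_const, PMF.bind_bind, PMF.bind_map,
    Function.comp_def]
  exact le_rfl

theorem QAlg.run_support {A : QAlg α β} {a : α} {ψ : QReg} {r : β × QReg}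
    (h : r ∈ (A.run a ψ).support) :
    (∃ o, r.1 = A.post (a, o)) ∧ r.2.1 = ψ.1 + (A.circ a).anc := by
  simp only [QAlg.run, QCircuit.run, QState.measurePart, PMF.map_comp, PMF.mem_support_map_iff] at h
  obtain ⟨b, _, rfl⟩ := h
  exact ⟨⟨_, rfl⟩, rfl⟩

/-- A two-stage adversary can be replaced by a distinguisher that gets as advice an outcome of the
first stage. -/
theorem TwoStage.exists_distinguisher {len : ℕ → ℕ} (A : TwoStage α β len) (hlen : PolySizeSeq len)
    (a : α) [TreeDec α] (R : ℕ → List Bool → (β → PMF Bool) → PMF Bool) :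
    ∃ (msg : ℕ → List Bool) (D : Distinguisher β), (∀ lam, (msg lam).length = len lam) ∧
      ∀ lam, |prTrue ((A.first lam a).bind fun s =>
          R lam s.1 fun b => A.second lam a s.1 b s.2) - 1 / 2| ≤
        |prTrue (R lam (msg lam) (D.run lam)) - 1 / 2| := by
  -- Writing `1 / 2` as the success probability of a fair coin turns the guessing advantage into a
  -- difference of two experiments, to which averaging over the outcome of the first stage applies.
  have hu : prTrue unifBit = 1 / 2 := by simp [prTrue, unifBit, PMF.uniformOfFintype_apply]
  choose s hs hle using fun lam => exists_mem_support_abs_le (A.first lam a)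
    (fun s => R lam s.1 fun b => A.second lam a s.1 b s.2) fun _ => unifBit
  simp only [PMF.bind_const, hu] at hle
  have hs1 : ∀ lam, (s lam).1.length = len lam := fun lam => by
    obtain ⟨⟨o, ho⟩, _⟩ := QAlg.run_support (hs lam)
    rw [ho]; exact A.stage1_length lam a o
  have hs2 : ∃ p : Polynomial ℕ, ∀ lam, (s lam).2.1 ≤ p.eval lam := by
    obtain ⟨p, hp⟩ := A.adv.reg_poly
    obtain ⟨q, hq⟩ := (PolySizeSeq.comp A.stage1.circ_poly
      (polySizeSeq_id.prodMk (PolySizeSeq.prodMk (w := fun _ => a) A.adv.str_poly (polySizeSeq_const a))))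
    refine ⟨p + q, fun lam => ?_⟩
    obtain ⟨_, h2⟩ := QAlg.run_support (hs lam)
    have h3 := hp lam
    have h4 : esize (A.stage1.circ (lam, A.adv.str lam, a)) ≤ q.eval lam := hq lam
    -- The number of ancillas is written in unary, so a circuit produced in polynomial time enlarges
    -- the register by polynomially many qubits only.
    have h5 : ∀ C : QCircuit, C.anc ≤ esize C := fun C => by
      have : esize C = esize (C.anc, C.gates, C.out) := rfl
      rw [this, esize_prod, esize_nat]; simp only; omega
    have h6 := h5 (A.stage1.circ (lam, A.adv.str lam, a))
    simp only [Polynomial.eval_add]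
    omega
  refine ⟨fun lam => (s lam).1,
    { adv :=
        { str := fun lam => TreeEnc.enc (A.adv.str lam, (s lam).1)
          reg := fun lam => (s lam).2
          str_poly := polySize_enc (PolySizeSeq.prodMk A.adv.str_poly (polySizeSeq_bits hlen hs1))
          reg_poly := hs2 }
      alg := A.stage2.precomp (fun t : ℕ × Val × β =>
        (t.1, t.2.1.fst, a, TreeDec.dec t.2.1.snd, t.2.2)) (by fun_prop) }, hs1, fun lam => ?_⟩
  refine (hle lam).trans (le_of_eq ?_)
  congr 4
  funext b
  have : A.second lam a (s lam).1 b (s lam).2 =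
    (A.stage2.run (lam, A.adv.str lam, a, (s lam).1, b) (s lam).2).map Prod.fst := rfl
  rw [this]
  conv_lhs => rw [← TreeDec.dec_enc (s lam).1]
  rfl

end tools

/-! ## Hardwiring a value into a circuit -/

/-- The equality test with `x`: the output on `x'` is `[x' = x, 0]`. -/
def eqCircuit (x : List Bool) : Circuit where
  numIn := x.length
  gates := ⟨fun _ _ => true, 0, 0⟩ ::
    testGates ((List.range x.length).zip x) x.length (x.length + 1)
  outs := [x.length + x.length, x.length + x.length + 1]

theorem map_wire_range (x : List Bool) (v : List Bool) :
    (List.range x.length).map (wire (x ++ v)) = x := by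
  apply List.ext_getElem
  · simp
  · intro i h1 h2
    simp [wire, List.getElem?_append_left h2, h2]

theorem eqCircuit_eval {x y : List Bool} (h : y.length = x.length) :
    (eqCircuit x).eval y = [decide (y = x), false] := by
  have hz : ((List.range x.length).zip x).length = x.length := by simp
  have ht := testGates_spec ((List.range x.length).zip x) (y ++ [true]) (by simp) (by
    intro p hp
    have := List.mem_range.1 (List.of_mem_zip hp).1
    simp; omega)
  rw [zip_all_eq _ _ _ (by simp), hz, ← h, map_wire_range] at ht
  simp only [List.length_append, List.length_singleton, Nat.add_sub_cancel, wire_append_last,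
    Bool.true_and] at ht
  simp only [eqCircuit, Circuit.eval, evalGates_cons, List.map_cons, List.map_nil, ← h]
  -- The second output wire lies just beyond the last gate, and therefore reads 0.
  rw [ht, wire_of_le]
  rw [evalGates_length, testGates_length]
  simp [h]; omega

/-- The circuit without inputs that outputs `y`. -/
def constCircuit (y : List Bool) : Circuit where
  numIn := 0
  gates := [⟨fun _ _ => true, 0, 0⟩]
  outs := y.map fun b => bif b then 0 else 1

/-- Wire 0 is the constant gate; wire 1 does not exist and reads 0. -/
theorem constCircuit_eval (y : List Bool) : (constCircuit y).eval [] = y := by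
  simp only [constCircuit, Circuit.eval, List.map_map]
  conv_rhs => rw [← List.map_id y]
  refine List.map_congr_left fun b _ => ?_
  cases b <;> rfl

/-- `C` with its value at `x` replaced by `y`. -/
def Circuit.hardwire (C : Circuit) (x y : List Bool) : Circuit :=
  circuitD C (eqCircuit x) (constCircuit y) 1 [true]

theorem circuitD_arity (F Dec G : Circuit) (k : ℕ) (msg : List Bool) :
    (circuitD F Dec G k msg).HasArity F.numIn F.outs.length :=
  ⟨rfl, by simp [circuitD, Circuit.placedOuts]⟩

/-- Hardwiring reuses the marking mechanism: the equality test plays the decryption circuit and the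
constant circuit the generator. The seed is empty, an index below 1 takes no bits, and the remaining
plaintext bit 0 differs from the only message bit 1, so the special branch is taken exactly at `x`.
-/
theorem Circuit.hardwire_pad_eval (C : Circuit) {x y x' : List Bool} (s : ℕ)
    (hx' : x'.length = C.numIn) (hx : x.length = C.numIn) (hy : y.length = C.outs.length) :
    ((C.hardwire x y).pad s).eval x' = if x' = x then y else C.eval x' := by
  rw [Circuit.hardwire, circuitD_pad_eval C _ _ _ _ _ _ hx' ⟨hx, by simp [eqCircuit, constCircuit]⟩
    (by simp [constCircuit, hy])]
  rw [eqCircuit_eval (by rw [hx, hx'])]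
  have h1 : (constCircuit y).numIn = 0 := rfl
  simp only [h1, List.take_zero, constCircuit_eval]
  refine if_congr ?_ rfl rfl
  simp [natBits]

section

variable {α : Type} [TreeEnc α]

@[fun_prop]
theorem PolyTime.eqCircuit {x : α → List Bool} (hx : PolyTime x) :
    PolyTime fun a => eqCircuit (x a) := by
  unfold ELWM.eqCircuit
  refine PolyTime.circuit (by fun_prop) (PolyTime.cons (.const _) (by fun_prop)) (by fun_prop)

@[fun_prop]
theorem PolyTime.constCircuit {y : α → List Bool} (hy : PolyTime y) :
    PolyTime fun a => constCircuit (y a) := by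
  unfold ELWM.constCircuit
  exact PolyTime.circuit (.const _) (.const _)
    (PolyTime.map (h := fun (_ : α) b => bif b then 0 else 1) (by fun_prop) hy)

@[fun_prop]
theorem PolyTime.hardwire {C : α → Circuit} {x y : α → List Bool} (hC : PolyTime C)
    (hx : PolyTime x) (hy : PolyTime y) : PolyTime fun a => (C a).hardwire (x a) (y a) := by
  unfold Circuit.hardwire
  fun_prop

end

theorem Circuit.pad_size {C : Circuit} {s : ℕ} (h : C.size ≤ s) : (C.pad s).size = s := by
  simp only [Circuit.size, Circuit.pad, List.length_append, List.length_replicate] at *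
  omega

theorem Circuit.pad_zero (C : Circuit) : C.pad 0 = C := by
  simp [Circuit.pad]

theorem natBits_inj : ∀ {w i j : ℕ}, i < 2 ^ w → j < 2 ^ w → natBits w i = natBits w j → i = j
  | 0, i, j, hi, hj, _ => by simp at hi hj; omega
  | w + 1, i, j, hi, hj, h => by
    simp only [natBits, List.cons.injEq] at h
    have h2 := natBits_inj (w := w) (by rw [pow_succ] at hi; omega) (by rw [pow_succ] at hj; omega) h.2
    have h1 := h.1
    have : i % 2 = j % 2 := by
      rcases Nat.mod_two_eq_zero_or_one i with hi | hi <;>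
        rcases Nat.mod_two_eq_zero_or_one j with hj | hj <;> simp_all
    omega

/-! ## The circuits of the security proof -/

/-- The cryptographic tools of the construction. -/
structure Tools (k l n m : ℕ → ℕ) (PRF : PuncturablePRF) (PRG : ℕ → Circuit) (PE : PuncturableEnc)
    (iO : ℕ → Circuit → PMF Circuit) : Prop where
  k_poly : PolyTime k
  prf : PRF.IsSecure n m
  prg : IsSecurePRG PRG l m
  pe : PE.IsSecure (fun lam => l lam + Nat.clog 2 (k lam) + 1) n
  io : IsSecureIO iO

/-- The circuit that is obfuscated in the construction. -/
def markedCircuit (k : ℕ → ℕ) (PRF : PuncturablePRF) (PRG : ℕ → Circuit) (PE : PuncturableEnc)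
    (lam : ℕ) (K dk : Val) (msg : List Bool) : Circuit :=
  circuitD (PRF.evalCirc lam K) (PE.decCirc lam dk) (PRG lam) (k lam) msg

/-- The output of the marked circuit on an input with value `y` under the PRF that decrypts
to `d`. -/
def markedValue (k l : ℕ → ℕ) (PRG : ℕ → Circuit) (lam : ℕ) (msg : List Bool)
    (d : Option (List Bool)) (y : List Bool) : List Bool :=
  match d with
  | some d =>
    if ∃ j < k lam, (d.drop (l lam)).take (Nat.clog 2 (k lam)) = natBits (Nat.clog 2 (k lam)) j ∧
        d.getD (l lam + Nat.clog 2 (k lam)) false ≠ msg.getD j false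
    then (PRG lam).eval (d.take (l lam)) else y
  | none => y

/-- Since `k ≤ 2 ^ clog k`, different indices have different digits, so the search over all `j` can
succeed for `j = i` only. -/
theorem markedValue_plaintext {k l : ℕ → ℕ} {PRG : ℕ → Circuit} {lam : ℕ} {msg s y : List Bool}
    {i : ℕ} {γ : Bool} (hs : s.length = l lam) (hi : i < k lam) :
    markedValue k l PRG lam msg (some (s ++ natBits (Nat.clog 2 (k lam)) i ++ [γ])) y =
      if γ = msg.getD i false then y else (PRG lam).eval s := by
  have hk : k lam ≤ 2 ^ Nat.clog 2 (k lam) := Nat.le_pow_clog (by norm_num) _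
  set w := Nat.clog 2 (k lam)
  have hw := natBits_length w i
  have h1 : ((s ++ natBits w i ++ [γ]).drop (l lam)).take w = natBits w i := by
    rw [← hs, List.append_assoc, List.drop_left, List.take_left' hw]
  have h2 : (s ++ natBits w i ++ [γ]).getD (l lam + w) false = γ := by
    have : (s ++ natBits w i).length = l lam + w := by simp [hs, hw]
    rw [← this]; simp
  have h3 : (s ++ natBits w i ++ [γ]).take (l lam) = s := by
    rw [← hs, List.append_assoc, List.take_left]
  simp only [markedValue]
  rw [h1, h2, h3]
  by_cases hγ : γ = msg.getD i false
  · rw [if_pos hγ, if_neg]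
    rintro ⟨j, hj, h, h'⟩
    have : i = j := natBits_inj (by omega) (by omega) h
    exact h' (this ▸ hγ)
  · rw [if_neg hγ, if_pos ⟨i, hi, rfl, hγ⟩]

section tools

variable {k l n m : ℕ → ℕ} {PRF : PuncturablePRF} {PRG : ℕ → Circuit} {PE : PuncturableEnc}
  {iO : ℕ → Circuit → PMF Circuit}

theorem Tools.markedCircuit_arity (T : Tools k l n m PRF PRG PE iO) (lam : ℕ) (K dk : Val)
    (msg : List Bool) : (markedCircuit k PRF PRG PE lam K dk msg).HasArity (n lam) (m lam) := by
  obtain ⟨h1, h2⟩ := T.prf.arity lam K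
  have := circuitD_arity (PRF.evalCirc lam K) (PE.decCirc lam dk) (PRG lam) (k lam) msg
  rwa [h1, h2] at this

theorem Tools.markedCircuit_eval (T : Tools k l n m PRF PRG PE iO) (lam : ℕ) (K dk : Val)
    (msg : List Bool) (s : ℕ) {x : List Bool} (hx : x.length = n lam) :
    ((markedCircuit k PRF PRG PE lam K dk msg).pad s).eval x =
      markedValue k l PRG lam msg (PE.dec lam dk x) (PRF.F lam K x) := by
  obtain ⟨h1, h2⟩ := T.prf.arity lam K
  obtain ⟨h3, h4⟩ := T.pe.dec_arity lam dk
  obtain ⟨h5, h6⟩ := T.prg.arity lam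
  rw [markedCircuit, circuitD_pad_eval _ _ _ _ _ _ _ (by rw [hx, h1])
    ⟨by rw [h3, h1], by rw [h4, h5]⟩ (by rw [h6, h2]), h5]
  rw [PuncturableEnc.dec]
  rcases (PE.decCirc lam dk).eval x with _ | ⟨_ | _, d⟩
  · simp [markedValue, PuncturablePRF.F]
  · simp [markedValue, PuncturablePRF.F]
  -- The validity bit in front of the plaintext shifts all positions by one.
  · simp only [markedValue, PuncturablePRF.F, List.getD_cons_zero, true_and, add_comm 1,
      List.drop_succ_cons, List.drop_zero]
    have : l lam + 1 + Nat.clog 2 (k lam) = l lam + Nat.clog 2 (k lam) + 1 := by omega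
    simp only [this, List.getD_cons_succ]

/-- Puncturing and hardwiring the right value do not change the function of the marked
circuit. -/
theorem Tools.equivalent (T : Tools k l n m PRF PRG PE iO) {lam : ℕ} {K K' dk' : Val}
    {key : Val × Val} {msg x v : List Bool} {s : ℕ} (hK : K ∈ (PRF.gen lam).support)
    (hkey : key ∈ (PE.gen lam).support) (hx : x.length = n lam) (hv : v.length = m lam)
    (hK' : K' ∈ (PRF.puncture lam K [x]).support) (hdk' : dk' ∈ (PE.puncture lam key.2 x).support)
    (h : v = markedValue k l PRG lam msg (PE.dec lam key.2 x) (PRF.F lam K x))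
    (hs : (markedCircuit k PRF PRG PE lam K key.2 msg).size ≤ s)
    (hs' : ((markedCircuit k PRF PRG PE lam K' dk' msg).hardwire x v).size ≤ s) :
    ((markedCircuit k PRF PRG PE lam K key.2 msg).pad s).Equivalent
      (((markedCircuit k PRF PRG PE lam K' dk' msg).hardwire x v).pad s) := by
  obtain ⟨a1, a2⟩ := T.markedCircuit_arity lam K key.2 msg
  obtain ⟨b1, b2⟩ := T.markedCircuit_arity lam K' dk' msg
  refine ⟨by rw [Circuit.pad_size hs, Circuit.pad_size hs'], ?_, fun x' hx' => ?_⟩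
  · have := circuitD_arity (markedCircuit k PRF PRG PE lam K' dk' msg) (eqCircuit x)
      (constCircuit v) 1 [true]
    rw [b1, b2] at this
    change Circuit.HasArity _ (markedCircuit k PRF PRG PE lam K key.2 msg).numIn
      (markedCircuit k PRF PRG PE lam K key.2 msg).outs.length
    rw [a1, a2]
    exact this
  · have hx'' : x'.length = n lam := hx'.trans a1
    rw [Circuit.hardwire_pad_eval _ _ (by rw [hx'', b1]) (by rw [hx, b1]) (by rw [hv, b2]),
      T.markedCircuit_eval lam K key.2 msg s hx'']
    split_ifs with hxx
    · rw [h, hxx]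
    -- Away from `x` both punctured keys agree with the full keys. Padding to 0 gates changes
    -- nothing and brings the circuit into the form of the evaluation lemma.
    · rw [← Circuit.pad_zero (markedCircuit k PRF PRG PE lam K' dk' msg),
        T.markedCircuit_eval lam K' dk' msg 0 hx'',
        T.pe.punctured_correctness lam key hkey x hx dk' hdk' x' hx'' hxx,
        T.prf.punctured_correctness lam [x] ⟨List.nodup_singleton _, by simpa using hx⟩ x' hx''
          (by simpa using hxx) K hK K' hK']

/-- The arity is the same for all keys, so it can be read off from the circuit of a dummy key. In
this way the efficiency of `n`, and likewise of `m` and `l`, follows from that of the tools. -/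
theorem Tools.n_poly (T : Tools k l n m PRF PRG PE iO) : PolyTime n := by
  have h : PolyTime fun lam : ℕ => (lam, Val.leaf) := by fun_prop
  refine (T.prf.evalCirc_poly.comp h).numIn.congr fun lam => ?_
  exact (T.prf.arity lam Val.leaf).1.symm

theorem Tools.m_poly (T : Tools k l n m PRF PRG PE iO) : PolyTime m :=
  T.prg.poly.outs.length.congr fun lam => (T.prg.arity lam).2.symm

theorem Tools.l_poly (T : Tools k l n m PRF PRG PE iO) : PolyTime l :=
  T.prg.poly.numIn.congr fun lam => (T.prg.arity lam).1.symm

theorem Tools.markedCircuit_poly (T : Tools k l n m PRF PRG PE iO) {α : Type} [TreeEnc α]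
    {lam : α → ℕ} {K dk : α → Val} {msg : α → List Bool} (hl : PolyTime lam) (hK : PolyTime K)
    (hd : PolyTime dk) (hm : PolyTime msg) :
    PolyTime fun a => markedCircuit k PRF PRG PE (lam a) (K a) (dk a) (msg a) :=
  PolyTime.circuitD (T.prf.evalCirc_poly.comp (hl.prodMk hK))
    (T.pe.decCirc_poly.comp (hl.prodMk hd)) (T.prg.poly.comp hl) (T.k_poly.comp hl) hm

theorem Tools.F_poly (T : Tools k l n m PRF PRG PE iO) {α : Type} [TreeEnc α]
    {lam : α → ℕ} {K : α → Val} {x : α → List Bool} (hl : PolyTime lam) (hK : PolyTime K)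
    (hx : PolyTime x) : PolyTime fun a => PRF.F (lam a) (K a) (x a) :=
  PolyTime.circuitEval (T.prf.evalCirc_poly.comp (hl.prodMk hK)) hx

theorem Tools.F_length (T : Tools k l n m PRF PRG PE iO) (lam : ℕ) (K : Val) (x : List Bool) :
    (PRF.F lam K x).length = m lam := by
  rw [PuncturablePRF.F, Circuit.eval, List.length_map, (T.prf.arity lam K).2]

theorem Tools.PRG_length (T : Tools k l n m PRF PRG PE iO) (lam : ℕ) (s : List Bool) :
    ((PRG lam).eval s).length = m lam := by
  rw [Circuit.eval, List.length_map, (T.prg.arity lam).2]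

/-- `P₀` is a polynomial bound for the sizes of the circuits in the security proof. -/
def SizeBound (k n m : ℕ → ℕ) (PRF : PuncturablePRF) (PRG : ℕ → Circuit) (PE : PuncturableEnc)
    (s : ℕ → ℕ) : Prop :=
  ∀ lam, ∀ K ∈ (PRF.gen lam).support, ∀ key ∈ (PE.gen lam).support, ∀ msg : List Bool,
    msg.length = k lam →
    (markedCircuit k PRF PRG PE lam K key.2 msg).size ≤ s lam ∧
    ∀ x v : List Bool, x.length = n lam → v.length = m lam →
      ∀ K' ∈ (PRF.puncture lam K [x]).support, ∀ dk' ∈ (PE.puncture lam key.2 x).support,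
        ((markedCircuit k PRF PRG PE lam K' dk' msg).hardwire x v).size ≤ s lam

/-- The circuits are outputs of PPT algorithms that generate the keys, puncture them and build the
circuit. Such outputs have polynomial size on the whole support, and a circuit has no more gates
than its encoding has vertices. -/
theorem Tools.exists_sizeBound (T : Tools k l n m PRF PRG PE iO) :
    ∃ P₀ : Polynomial ℕ, SizeBound k n m PRF PRG PE fun lam => P₀.eval lam := by
  have h1 : PPT fun a : ℕ × List Bool => (PRF.gen a.1).bind fun K => (PE.gen a.1).map fun key =>
      markedCircuit k PRF PRG PE a.1 K key.2 a.2 := by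
    refine PPT.bind (T.prf.gen_ppt.comp (by fun_prop)) (PPT.map (T.pe.gen_ppt.comp (by fun_prop)) ?_)
    apply T.markedCircuit_poly <;> fun_prop
  have h2 : PPT fun a : ℕ × List Bool × List Bool × List Bool => (PRF.gen a.1).bind fun K =>
      (PE.gen a.1).bind fun key => (PRF.puncture a.1 K [a.2.2.1]).bind fun K' =>
      (PE.puncture a.1 key.2 a.2.2.1).map fun dk' =>
      (markedCircuit k PRF PRG PE a.1 K' dk' a.2.1).hardwire a.2.2.1 a.2.2.2 := by
    refine PPT.bind (T.prf.gen_ppt.comp (by fun_prop)) (PPT.bind (T.pe.gen_ppt.comp (by fun_prop))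
      (PPT.bind (T.prf.puncture_ppt.comp (f := fun t : ((ℕ × List Bool × List Bool × List Bool) × Val) × Val × Val =>
        (t.1.1.1, t.1.2, [t.1.1.2.2.1])) (by fun_prop))
      (PPT.map (T.pe.puncture_ppt.comp (
        f := fun t : (((ℕ × List Bool × List Bool × List Bool) × Val) × Val × Val) × Val =>
        (t.1.1.1.1, t.1.2.2, t.1.1.1.2.2.1)) (by fun_prop)) ?_)))
    apply PolyTime.hardwire
    · apply T.markedCircuit_poly <;> fun_prop
    · fun_prop
    · fun_prop
  obtain ⟨p, hp⟩ := h1.support_bound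
  obtain ⟨q, hq⟩ := h2.support_bound
  obtain ⟨a, ha⟩ := T.k_poly.polySizeSeq
  obtain ⟨b, hb⟩ := T.n_poly.polySizeSeq
  obtain ⟨c, hc⟩ := T.m_poly.polySizeSeq
  -- The arguments of `p` and `q` bound the sizes of the tuples `(lam, msg)` and `(lam, msg, x, v)`:
  -- `2 * lam + 1` for the unary parameter, `4 * length + 1` for every bit string, and 1 for every
  -- pairing.
  refine ⟨p.comp (2 * Polynomial.X + 4 * a + 3) + q.comp (2 * Polynomial.X + 4 * (a + b + c) + 7),
    fun lam K hK key hkey msg hmsg => ?_⟩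
  have e1 := ha lam
  have e2 := hb lam
  have e3 := hc lam
  rw [esize_nat] at e1 e2 e3
  have m1 := esize_bits_le msg
  simp only [Polynomial.eval_add, Polynomial.eval_comp, Polynomial.eval_mul, Polynomial.eval_X,
    Polynomial.eval_ofNat]
  constructor
  · have := hp (lam, msg) _ ((PMF.mem_support_bind_iff _ _ _).2
      ⟨K, hK, (PMF.mem_support_map_iff _ _ _).2 ⟨key, hkey, rfl⟩⟩)
    refine (Circuit.size_le_esize _).trans (this.trans (le_trans (polyEval_mono p ?_)
      (Nat.le_add_right _ _)))
    simp only [esize_prod, esize_nat]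
    omega
  · intro x v hx hv K' hK' dk' hdk'
    have m2 := esize_bits_le x
    have m3 := esize_bits_le v
    have := hq (lam, msg, x, v) _ ((PMF.mem_support_bind_iff _ _ _).2
      ⟨K, hK, (PMF.mem_support_bind_iff _ _ _).2 ⟨key, hkey, (PMF.mem_support_bind_iff _ _ _).2
        ⟨K', hK', (PMF.mem_support_map_iff _ _ _).2 ⟨dk', hdk', rfl⟩⟩⟩⟩)
    refine (Circuit.size_le_esize _).trans (this.trans (le_trans (polyEval_mono q ?_)
      (Nat.le_add_left _ _)))
    simp only [esize_prod, esize_nat]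
    omega

end tools

/-! ### The hybrid experiments, and the steps that use ciphertexts, generator and PRF -/

theorem polySizeSeq_bool (b : ℕ → Bool) : PolySizeSeq b :=
  ⟨3, fun lam => by simpa using esize_bool_le (b lam)⟩

theorem polySupport_unifBits {n : ℕ → ℕ} (hn : PolySizeSeq n) :
    PolySupport fun lam => unifBits (n lam) := by
  obtain ⟨p, hp⟩ := hn
  refine ⟨4 * p + 1, fun lam a ha => ?_⟩
  have h1 := hp lam
  have h2 := esize_bits_le a
  rw [esize_nat] at h1
  rw [length_of_mem_unifBits ha] at h2
  simp only [Polynomial.eval_add, Polynomial.eval_mul, Polynomial.eval_one, Polynomial.eval_ofNat]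
  omega

/-- What the adversary gets in the security game, apart from its state: tag, obfuscated circuit,
and a labelled pair of strings. -/
abbrev View : Type := Val × Circuit × Bool × List Bool × List Bool

/-- The view of the adversary, where the circuit `C` is obfuscated. -/
noncomputable def obfView (iO : ℕ → Circuit → PMF Circuit) (lam : ℕ) (C : Circuit) (ek : Val)
    (γ : Bool) (x y : List Bool) : PMF View :=
  (iO lam C).map fun C' => (ek, C', γ, x, y)

section hybrids

variable (k l n m : ℕ → ℕ) (PRF : PuncturablePRF) (PRG : ℕ → Circuit) (PE : PuncturableEnc)
  (iO : ℕ → Circuit → PMF Circuit) (P : ℕ → ℕ)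

/-- The padded punctured circuit. -/
def puncturedCircuit (lam : ℕ) (K' dk' : Val) (msg x v : List Bool) : Circuit :=
  ((markedCircuit k PRF PRG PE lam K' dk' msg).hardwire x v).pad (P lam)

def plaintext (lam : ℕ) (s : List Bool) (i : ℕ) (γ : Bool) : List Bool :=
  s ++ natBits (Nat.clog 2 (k lam)) i ++ [γ]

/-- Simulated samples. -/
noncomputable def simView (lam : ℕ) (msg : List Bool) (γ : Bool) (i : ℕ) : PMF View :=
  (PRF.gen lam).bind fun K => (unifBits (l lam)).bind fun s => (PE.gen lam).bind fun key =>
  (PE.enc lam key.1 (plaintext k lam s i γ)).bind fun x =>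
  obfView iO lam ((markedCircuit k PRF PRG PE lam K key.2 msg).pad (P lam)) key.1 γ x
    ((PRG lam).eval s)

/-- Simulated samples, with the punctured circuit. -/
noncomputable def simPuncturedView (lam : ℕ) (msg : List Bool) (γ c : Bool) (i : ℕ) : PMF View :=
  (PRF.gen lam).bind fun K => (unifBits (l lam)).bind fun s => (PE.gen lam).bind fun key =>
  (PE.enc lam key.1 (plaintext k lam s i γ)).bind fun x => (PE.puncture lam key.2 x).bind fun dk' =>
  (PRF.puncture lam K [x]).bind fun K' =>
  obfView iO lam (puncturedCircuit k PRF PRG PE P lam K' dk' msg x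
    (bif c then PRF.F lam K x else (PRG lam).eval s)) key.1 γ x ((PRG lam).eval s)

/-- The punctured circuit at a uniform input, with a pseudorandom value. -/
noncomputable def prgPuncturedView (lam : ℕ) (msg : List Bool) (γ c : Bool) : PMF View :=
  (PE.gen lam).bind fun key => (unifBits (n lam)).bind fun x =>
  (PE.puncture lam key.2 x).bind fun dk' => (PRF.gen lam).bind fun K =>
  (PRF.puncture lam K [x]).bind fun K' => (unifBits (l lam)).bind fun s =>
  obfView iO lam (puncturedCircuit k PRF PRG PE P lam K' dk' msg x
    (bif c then PRF.F lam K x else (PRG lam).eval s)) key.1 γ x ((PRG lam).eval s)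

/-- The punctured circuit at a uniform input, with a uniform value. -/
noncomputable def unifPuncturedView (lam : ℕ) (msg : List Bool) (γ c : Bool) : PMF View :=
  (PE.gen lam).bind fun key => (unifBits (n lam)).bind fun x =>
  (PE.puncture lam key.2 x).bind fun dk' => (PRF.gen lam).bind fun K =>
  (PRF.puncture lam K [x]).bind fun K' => (unifBits (m lam)).bind fun y =>
  obfView iO lam (puncturedCircuit k PRF PRG PE P lam K' dk' msg x
    (bif c then PRF.F lam K x else y)) key.1 γ x y

/-- Real samples, with the punctured circuit. -/
noncomputable def realPuncturedView (lam : ℕ) (msg : List Bool) (γ c : Bool) : PMF View :=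
  (PE.gen lam).bind fun key => (unifBits (n lam)).bind fun x =>
  (PE.puncture lam key.2 x).bind fun dk' => (PRF.gen lam).bind fun K =>
  (PRF.puncture lam K [x]).bind fun K' =>
  (bif c then unifBits (m lam) else PMF.pure (PRF.F lam K x)).bind fun y =>
  obfView iO lam (puncturedCircuit k PRF PRG PE P lam K' dk' msg x (PRF.F lam K x)) key.1 γ x y

/-- Real samples. -/
noncomputable def realView (lam : ℕ) (msg : List Bool) (γ c : Bool) : PMF View :=
  (PE.gen lam).bind fun key => (unifBits (n lam)).bind fun x => (PRF.gen lam).bind fun K =>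
  (bif c then unifBits (m lam) else PMF.pure (PRF.F lam K x)).bind fun y =>
  obfView iO lam ((markedCircuit k PRF PRG PE lam K key.2 msg).pad (P lam)) key.1 γ x y

variable {k l n m PRF PRG PE iO P}

theorem Tools.puncturedCircuit_poly (T : Tools k l n m PRF PRG PE iO) (hP : PolyTime P)
    {α : Type} [TreeEnc α] {lam : α → ℕ} {K dk : α → Val} {msg x v : α → List Bool}
    (hl : PolyTime lam) (hK : PolyTime K) (hd : PolyTime dk) (hm : PolyTime msg) (hx : PolyTime x)
    (hv : PolyTime v) :
    PolyTime fun a => puncturedCircuit k PRF PRG PE P (lam a) (K a) (dk a) (msg a) (x a) (v a) :=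
  ((T.markedCircuit_poly hl hK hd hm).hardwire hx hv).pad (hP.comp hl)

theorem Tools.obfView_ppt (T : Tools k l n m PRF PRG PE iO) {α : Type} [TreeEnc α] {lam : α → ℕ}
    {C : α → Circuit} {ek : α → Val} {γ : α → Bool} {x y : α → List Bool} (hl : PolyTime lam)
    (hC : PolyTime C) (he : PolyTime ek) (hγ : PolyTime γ) (hx : PolyTime x) (hy : PolyTime y) :
    PPT fun a => obfView iO (lam a) (C a) (ek a) (γ a) (x a) (y a) :=
  PPT.map (f := fun a C' => (ek a, C', γ a, x a, y a)) (T.io.ppt.comp (hl.prodMk hC)) (by fun_prop)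

/-- Ciphertext pseudorandomness makes the input uniform. -/
theorem Tools.sim_indist_prg (T : Tools k l n m PRF PRG PE iO) (hP : PolyTime P)
    (msg : ℕ → List Bool) (hmsg : ∀ lam, (msg lam).length = k lam) (γ c : ℕ → Bool) (i : ℕ → ℕ) :
    Indist (fun lam => simPuncturedView k l PRF PRG PE iO P lam (msg lam) (γ lam) (c lam) (i lam))
      fun lam => prgPuncturedView k l n PRF PRG PE iO P lam (msg lam) (γ lam) (c lam) := by
  have hm : PolySizeSeq msg := polySizeSeq_bits T.k_poly.polySizeSeq hmsg
  -- The rest of the experiment as an algorithm on the challenge `(x, ek, dk')`. It gets the PRF key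
  -- and the seed as advice, but never the full decryption key.
  have hB : PPT fun t : ℕ × (Val × List Bool × List Bool × Bool × Bool) × List Bool × Val × Val =>
      (PRF.puncture t.1 t.2.1.1 [t.2.2.1]).bind fun K' =>
      obfView iO t.1 (puncturedCircuit k PRF PRG PE P t.1 K' t.2.2.2.2 t.2.1.2.2.1 t.2.2.1
        (bif t.2.1.2.2.2.2 then PRF.F t.1 t.2.1.1 t.2.2.1 else (PRG t.1).eval t.2.1.2.1))
        t.2.2.2.1 t.2.1.2.2.2.1 t.2.2.1 ((PRG t.1).eval t.2.1.2.1) := by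
    refine PPT.bind (T.prf.puncture_ppt.comp (f := fun t : ℕ × (Val × List Bool × List Bool × Bool ×
      Bool) × List Bool × Val × Val => (t.1, t.2.1.1, [t.2.2.1])) (by fun_prop)) ?_
    have hG : PolyTime fun t : (ℕ × (Val × List Bool × List Bool × Bool × Bool) ×
        List Bool × Val × Val) × Val => (PRG t.1.1).eval t.1.2.1.2.1 :=
      (T.prg.poly.comp (by fun_prop)).circuitEval (by fun_prop)
    refine T.obfView_ppt (by fun_prop) (T.puncturedCircuit_poly hP ?_ ?_ ?_ ?_ ?_ (.cond ?_
      (T.F_poly ?_ ?_ ?_) hG)) ?_ ?_ ?_ hG <;> fun_prop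
  have hX : PPT fun t : ℕ × List Bool => (PE.gen t.1).bind fun key =>
      (PE.enc t.1 key.1 t.2).bind fun x => (PE.puncture t.1 key.2 x).map fun dk' =>
      (x, key.1, dk') := by
    refine PPT.bind (T.pe.gen_ppt.comp (by fun_prop)) (PPT.bind (T.pe.enc_ppt.comp
      (f := fun t : (ℕ × List Bool) × Val × Val => (t.1.1, t.2.1, t.1.2)) (by fun_prop)) (PPT.map
      (T.pe.puncture_ppt.comp (f := fun t : ((ℕ × List Bool) × Val × Val) × List Bool =>
        (t.1.1.1, t.1.2.2, t.2)) (by fun_prop)) (by fun_prop)))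
  have hY : PPT fun lam => (PE.gen lam).bind fun key =>
      (unifBits (n lam)).bind fun x => (PE.puncture lam key.2 x).map fun dk' =>
      (x, key.1, dk') := by
    refine PPT.bind T.pe.gen_ppt (PPT.bind ?_ (PPT.map
      (T.pe.puncture_ppt.comp (f := fun t : (ℕ × Val × Val) × List Bool =>
        (t.1.1, t.1.2.2, t.2)) (by fun_prop)) (by fun_prop)))
    exact (PPT.unifBits T.n_poly).comp (by fun_prop)
  have key : Indist
      (fun lam => simPuncturedView k l PRF PRG PE iO P lam (msg lam) (γ lam) (c lam) (i lam))
      fun lam => (PRF.gen lam).bind fun K => (unifBits (l lam)).bind fun s =>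
        (PE.gen lam).bind fun key => (unifBits (n lam)).bind fun x =>
        (PE.puncture lam key.2 x).bind fun dk' => (PRF.puncture lam K [x]).bind fun K' =>
        obfView iO lam (puncturedCircuit k PRF PRG PE P lam K' dk' (msg lam) x
          (bif c lam then PRF.F lam K x else (PRG lam).eval s)) key.1 (γ lam) x
          ((PRG lam).eval s) := by
    -- With the PRF key and the seed fixed, the plaintext is a fixed sequence of strings, as an
    -- adversary against the encryption scheme must announce it before the keys are generated.
    refine Indist.mix _ fun K hK => Indist.mix _ fun s hs => ?_
    have hs' : PolySizeSeq s := (polySupport_unifBits T.l_poly.polySizeSeq).polySizeSeq hs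
    have hp : ∀ lam, (plaintext k lam (s lam) (i lam) (γ lam)).length =
        l lam + Nat.clog 2 (k lam) + 1 := fun lam => by
      simp [plaintext, natBits_length, length_of_mem_unifBits (hs lam), add_assoc]
    have hp' : PolySizeSeq fun lam => plaintext k lam (s lam) (i lam) (γ lam) :=
      polySizeSeq_bits (PolyTime.polySizeSeq (PolyTime.add (T.l_poly.add T.k_poly.clog) (.const 1)))
        hp
    have hw : PolySizeSeq fun lam => (K lam, s lam, msg lam, γ lam, c lam) :=
      (T.prf.gen_ppt.polySizeSeq polySizeSeq_id hK).prodMk (hs'.prodMk (hm.prodMk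
        ((polySizeSeq_bool γ).prodMk (polySizeSeq_bool c))))
    have := (T.pe.indist _ hp hp').bind (hX.polySupport (polySizeSeq_id.prodMk hp'))
      (hY.polySupport polySizeSeq_id) hw hB
    simpa only [PMF.bind_bind, PMF.bind_map, Function.comp_def] using this
  refine key.congr (fun _ => rfl) fun lam => ?_
  rw [prgPuncturedView]
  -- Independent draws are reordered so that the seed comes last. This is possible now that `x` no
  -- longer depends on it.
  simp only [PMF.bind_comm (unifBits (l lam)) (PE.gen lam)]
  rw [PMF.bind_comm (PRF.gen lam)]
  refine congrArg _ (funext fun key => ?_)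
  simp only [PMF.bind_comm (unifBits (l lam)) (unifBits (n lam))]
  rw [PMF.bind_comm (PRF.gen lam)]
  refine congrArg _ (funext fun x => ?_)
  simp only [PMF.bind_comm (unifBits (l lam)) (PE.puncture lam key.2 x)]
  rw [PMF.bind_comm (PRF.gen lam)]
  refine congrArg _ (funext fun dk' => congrArg _ (funext fun K => ?_))
  rw [PMF.bind_comm (unifBits (l lam))]

/-- Pseudorandomness of the generator makes its value uniform. -/
theorem Tools.prg_indist_unif (T : Tools k l n m PRF PRG PE iO) (hP : PolyTime P)
    (msg : ℕ → List Bool) (hmsg : ∀ lam, (msg lam).length = k lam) (γ c : ℕ → Bool) :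
    Indist (fun lam => prgPuncturedView k l n PRF PRG PE iO P lam (msg lam) (γ lam) (c lam))
      fun lam => unifPuncturedView k n m PRF PRG PE iO P lam (msg lam) (γ lam) (c lam) := by
  have hm : PolySizeSeq msg := polySizeSeq_bits T.k_poly.polySizeSeq hmsg
  -- All randomness but the seed is fixed; the seed enters the view through the value of the
  -- generator only.
  refine Indist.mix _ fun key hkey => Indist.mix _ fun x hx => Indist.mix _ fun dk' hdk' =>
    Indist.mix _ fun K hK => Indist.mix _ fun K' hK' => ?_
  have hx' : PolySizeSeq x := (polySupport_unifBits T.n_poly.polySizeSeq).polySizeSeq hx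
  have hkeys := T.pe.gen_ppt.polySizeSeq polySizeSeq_id hkey
  have hKs := T.prf.gen_ppt.polySizeSeq polySizeSeq_id hK
  have hdks : PolySizeSeq dk' := T.pe.puncture_ppt.polySizeSeq
    (v := fun lam => (lam, (key lam).2, x lam))
    (polySizeSeq_id.prodMk ((PolySizeSeq.comp (PolyTime.snd .id) hkeys).prodMk hx')) hdk'
  have hKs' : PolySizeSeq K' := T.prf.puncture_ppt.polySizeSeq (v := fun lam => (lam, K lam, [x lam]))
    (polySizeSeq_id.prodMk (hKs.prodMk (PolySizeSeq.comp (f := fun x : List Bool => [x])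
      (by fun_prop) hx'))) hK'
  have hw : PolySizeSeq fun lam =>
      (msg lam, γ lam, c lam, key lam, x lam, dk' lam, K lam, K' lam) :=
    hm.prodMk ((polySizeSeq_bool γ).prodMk ((polySizeSeq_bool c).prodMk (hkeys.prodMk
      (hx'.prodMk (hdks.prodMk (hKs.prodMk hKs'))))))
  have hB : PPT fun t : ℕ × (List Bool × Bool × Bool × (Val × Val) × List Bool × Val × Val × Val) ×
      List Bool => obfView iO t.1 (puncturedCircuit k PRF PRG PE P t.1 t.2.1.2.2.2.2.2.2.2
        t.2.1.2.2.2.2.2.1 t.2.1.1 t.2.1.2.2.2.2.1 (bif t.2.1.2.2.1 then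
          PRF.F t.1 t.2.1.2.2.2.2.2.2.1 t.2.1.2.2.2.2.1 else t.2.2))
        t.2.1.2.2.2.1.1 t.2.1.2.1 t.2.1.2.2.2.2.1 t.2.2 := by
    refine T.obfView_ppt (by fun_prop) (T.puncturedCircuit_poly hP ?_ ?_ ?_ ?_ ?_ (.cond ?_
      (T.F_poly ?_ ?_ ?_) ?_)) ?_ ?_ ?_ ?_ <;> fun_prop
  have hs : PPT fun lam => (unifBits (l lam)).map (PRG lam).eval :=
    PPT.map (PPT.unifBits T.l_poly)
      (PolyTime.circuitEval (T.prg.poly.comp (by fun_prop)) (by fun_prop))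
  have := T.prg.indist.bind (hs.polySupport polySizeSeq_id)
    (polySupport_unifBits T.m_poly.polySizeSeq) hw hB
  simpa only [PMF.bind_map, Function.comp_def] using this

/-- Pseudorandomness of the PRF at the punctured point. -/
theorem Tools.unif_indist_real (T : Tools k l n m PRF PRG PE iO) (hP : PolyTime P)
    (msg : ℕ → List Bool) (hmsg : ∀ lam, (msg lam).length = k lam) (γ c : ℕ → Bool) :
    Indist (fun lam => unifPuncturedView k n m PRF PRG PE iO P lam (msg lam) (γ lam) (c lam))
      fun lam => realPuncturedView k n m PRF PRG PE iO P lam (msg lam) (γ lam) (c lam) := by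
  have hm : PolySizeSeq msg := polySizeSeq_bits T.k_poly.polySizeSeq hmsg
  refine Indist.mix _ fun key hkey => Indist.mix _ fun x hx => Indist.mix _ fun dk' hdk' => ?_
  have hx' : PolySizeSeq x := (polySupport_unifBits T.n_poly.polySizeSeq).polySizeSeq hx
  have hkeys := T.pe.gen_ppt.polySizeSeq polySizeSeq_id hkey
  have hdks : PolySizeSeq dk' := T.pe.puncture_ppt.polySizeSeq
    (v := fun lam => (lam, (key lam).2, x lam))
    (polySizeSeq_id.prodMk ((PolySizeSeq.comp (PolyTime.snd .id) hkeys).prodMk hx')) hdk'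
  have hw : PolySizeSeq fun lam => (msg lam, γ lam, key lam, x lam, dk' lam) :=
    hm.prodMk ((polySizeSeq_bool γ).prodMk (hkeys.prodMk (hx'.prodMk hdks)))
  have hB : PPT fun t : ℕ × (List Bool × Bool × (Val × Val) × List Bool × Val) ×
      Val × List Bool => obfView iO t.1 (puncturedCircuit k PRF PRG PE P t.1 t.2.2.1
        t.2.1.2.2.2.2 t.2.1.1 t.2.1.2.2.2.1 t.2.2.2)
        t.2.1.2.2.1.1 t.2.1.2.1 t.2.1.2.2.2.1 t.2.2.2 := by
    refine T.obfView_ppt (by fun_prop) (T.puncturedCircuit_poly hP ?_ ?_ ?_ ?_ ?_ ?_)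
      ?_ ?_ ?_ ?_ <;> fun_prop
  have hX : PPT fun t : ℕ × List Bool => (PRF.gen t.1).bind fun K =>
      (PRF.puncture t.1 K [t.2]).map fun K' => (K', PRF.F t.1 K t.2) := by
    refine PPT.bind (T.prf.gen_ppt.comp (by fun_prop)) (PPT.map (T.prf.puncture_ppt.comp
      (f := fun t : (ℕ × List Bool) × Val => (t.1.1, t.2, [t.1.2])) (by fun_prop))
      (PolyTime.prodMk (by fun_prop) (T.F_poly ?_ ?_ ?_))) <;> fun_prop
  have hY : PPT fun t : ℕ × List Bool => (PRF.gen t.1).bind fun K =>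
      (PRF.puncture t.1 K [t.2]).bind fun K' => (unifBits (m t.1)).map fun y => (K', y) := by
    refine PPT.bind (T.prf.gen_ppt.comp (by fun_prop)) (PPT.bind (T.prf.puncture_ppt.comp
      (f := fun t : (ℕ × List Bool) × Val => (t.1.1, t.2, [t.1.2])) (by fun_prop))
      (PPT.map ((PPT.unifBits T.m_poly).comp (by fun_prop)) (by fun_prop)))
  -- If `c` is false, one and the same string is hardwired and shown, and the PRF key occurs
  -- otherwise only in punctured form, so the PRF assumption applies. If `c` is true, `F_K(x)` is
  -- hardwired and a uniform string is shown on both sides, and there is nothing to prove.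
  have := ((T.prf.indist x fun lam => length_of_mem_unifBits (hx lam)).bind
    (hX.polySupport (polySizeSeq_id.prodMk hx')) (hY.polySupport (polySizeSeq_id.prodMk hx'))
    hw hB).symm.ite (Z := fun lam => (PRF.gen lam).bind fun K =>
      (PRF.puncture lam K [x lam]).bind fun K' => (unifBits (m lam)).bind fun y =>
      obfView iO lam (puncturedCircuit k PRF PRG PE P lam K' (dk' lam) (msg lam) (x lam)
        (PRF.F lam K (x lam))) (key lam).1 (γ lam) (x lam) y) c
  refine this.congr (fun lam => ?_) fun lam => ?_
  · cases c lam
    · simp only [Bool.false_eq_true, if_false, PMF.bind_bind, PMF.bind_map, Function.comp_def,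
        cond_false]
    · simp only [if_true, cond_true]
  · cases c lam
    · simp only [Bool.false_eq_true, if_false, PMF.bind_bind, PMF.bind_map, Function.comp_def,
        cond_false, PMF.pure_bind]
    · simp only [if_true, cond_true]

end hybrids

/-! ### The steps that use obfuscation, and the chain of hybrids -/

/-- The randomness of the security proof: PRF key, key pair, a seed or a value, input, punctured
PRF key, punctured decryption key. -/
abbrev Sample : Type := Val × (Val × Val) × List Bool × List Bool × Val × Val

section hybrids

variable {k l n m : ℕ → ℕ} {PRF : PuncturablePRF} {PRG : ℕ → Circuit} {PE : PuncturableEnc}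
  {iO : ℕ → Circuit → PMF Circuit} {P : ℕ → ℕ}

/-- The keys, punctured keys and input in a sample are possible ones. -/
def IsSample (PRF : PuncturablePRF) (PE : PuncturableEnc) (n : ℕ → ℕ) (lam : ℕ) (w : Sample) :
    Prop :=
  w.1 ∈ (PRF.gen lam).support ∧ w.2.1 ∈ (PE.gen lam).support ∧ w.2.2.2.1.length = n lam ∧
    w.2.2.2.2.1 ∈ (PRF.puncture lam w.1 [w.2.2.2.1]).support ∧
    w.2.2.2.2.2 ∈ (PE.puncture lam w.2.1.2 w.2.2.2.1).support

theorem Tools.sample_polySizeSeq (T : Tools k l n m PRF PRG PE iO) {w : ℕ → Sample}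
    (hw : ∀ lam, IsSample PRF PE n lam (w lam)) {L : ℕ → ℕ} (hL : PolySizeSeq L)
    (hs : ∀ lam, (w lam).2.2.1.length = L lam) : PolySizeSeq w := by
  have h1 := T.prf.gen_ppt.polySizeSeq polySizeSeq_id fun lam => (hw lam).1
  have h2 := T.pe.gen_ppt.polySizeSeq polySizeSeq_id fun lam => (hw lam).2.1
  have h3 : PolySizeSeq fun lam => (w lam).2.2.1 := polySizeSeq_bits hL hs
  have h4 : PolySizeSeq fun lam => (w lam).2.2.2.1 :=
    polySizeSeq_bits T.n_poly.polySizeSeq fun lam => (hw lam).2.2.1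
  have h5 := T.prf.puncture_ppt.polySizeSeq
    (v := fun lam => (lam, (w lam).1, [(w lam).2.2.2.1]))
    (polySizeSeq_id.prodMk (h1.prodMk (PolySizeSeq.comp (f := fun x : List Bool => [x])
      (by fun_prop) h4))) fun lam => (hw lam).2.2.2.1
  have h6 := T.pe.puncture_ppt.polySizeSeq
    (v := fun lam => (lam, (w lam).2.1.2, (w lam).2.2.2.1))
    (polySizeSeq_id.prodMk ((PolySizeSeq.comp (PolyTime.snd .id) h2).prodMk h4))
    fun lam => (hw lam).2.2.2.2
  exact h1.prodMk (h2.prodMk (h3.prodMk (h4.prodMk (h5.prodMk h6))))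

theorem Tools.marked_polySizeSeq (T : Tools k l n m PRF PRG PE iO) (hP : PolyTime P)
    {msg : ℕ → List Bool} (hm : PolySizeSeq msg) {w : ℕ → Sample} (hw : PolySizeSeq w) :
    PolySizeSeq fun lam =>
      (markedCircuit k PRF PRG PE lam (w lam).1 (w lam).2.1.2 (msg lam)).pad (P lam) := by
  refine PolySizeSeq.comp (f := fun t : ℕ × List Bool × Sample =>
    (markedCircuit k PRF PRG PE t.1 t.2.2.1 t.2.2.2.1.2 t.2.1).pad (P t.1)) ?_
    (polySizeSeq_id.prodMk (hm.prodMk hw))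
  refine PolyTime.pad (T.markedCircuit_poly ?_ ?_ ?_ ?_) (hP.comp ?_) <;> fun_prop

theorem Tools.punctured_polySizeSeq (T : Tools k l n m PRF PRG PE iO) (hP : PolyTime P)
    {msg : ℕ → List Bool} (hm : PolySizeSeq msg) {w : ℕ → Sample} (hw : PolySizeSeq w)
    {v : ℕ → List Bool} (hv : PolySizeSeq v) :
    PolySizeSeq fun lam => puncturedCircuit k PRF PRG PE P lam (w lam).2.2.2.2.1 (w lam).2.2.2.2.2
      (msg lam) (w lam).2.2.2.1 (v lam) := by
  refine PolySizeSeq.comp (f := fun t : ℕ × List Bool × Sample × List Bool =>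
    puncturedCircuit k PRF PRG PE P t.1 t.2.2.1.2.2.2.2.1 t.2.2.1.2.2.2.2.2 t.2.1
      t.2.2.1.2.2.2.1 t.2.2.2) ?_ (polySizeSeq_id.prodMk (hm.prodMk (hw.prodMk hv)))
  refine T.puncturedCircuit_poly hP ?_ ?_ ?_ ?_ ?_ ?_ <;> fun_prop

theorem SizeBound.equivalent (T : Tools k l n m PRF PRG PE iO)
    (hsz : SizeBound k n m PRF PRG PE P) {lam : ℕ} {msg v : List Bool} {w : Sample}
    (hmsg : msg.length = k lam) (hw : IsSample PRF PE n lam w)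
    (h : v = markedValue k l PRG lam msg (PE.dec lam w.2.1.2 w.2.2.2.1)
      (PRF.F lam w.1 w.2.2.2.1)) (hv : v.length = m lam) :
    ((markedCircuit k PRF PRG PE lam w.1 w.2.1.2 msg).pad (P lam)).Equivalent
      (puncturedCircuit k PRF PRG PE P lam w.2.2.2.2.1 w.2.2.2.2.2 msg w.2.2.2.1 v) := by
  obtain ⟨h1, h2, h3, h4, h5⟩ := hw
  obtain ⟨s1, s2⟩ := hsz lam _ h1 _ h2 msg hmsg
  exact T.equivalent h1 h2 h3 hv h4 h5 h s1 (s2 _ v h3 hv _ h4 _ h5)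

theorem Tools.plaintext_length (lam : ℕ) {s : List Bool} (hs : s ∈ (unifBits (l lam)).support)
    (i : ℕ) (γ : Bool) : (plaintext k lam s i γ).length = l lam + Nat.clog 2 (k lam) + 1 := by
  simp [plaintext, natBits_length, length_of_mem_unifBits hs, add_assoc]

/-- Obfuscation hides the puncturing of the keys in simulated samples. -/
theorem Tools.sim_indist (T : Tools k l n m PRF PRG PE iO) (hP : PolyTime P)
    (hsz : SizeBound k n m PRF PRG PE P)
    (msg : ℕ → List Bool) (hmsg : ∀ lam, (msg lam).length = k lam) (γ : ℕ → Bool) (i : ℕ → ℕ) :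
    Indist (fun lam => if i lam < k lam then
        simView k l PRF PRG PE iO P lam (msg lam) (γ lam) (i lam)
      else simPuncturedView k l PRF PRG PE iO P lam (msg lam) (γ lam)
        (decide (γ lam = (msg lam).getD (i lam) false)) (i lam))
      fun lam => simPuncturedView k l PRF PRG PE iO P lam (msg lam) (γ lam)
        (decide (γ lam = (msg lam).getD (i lam) false)) (i lam) := by
  have hm : PolySizeSeq msg := polySizeSeq_bits T.k_poly.polySizeSeq hmsg
  set c : ℕ → Bool := fun lam => decide (γ lam = (msg lam).getD (i lam) false) with hc
  -- The punctured keys are sampled in both experiments, although one of them ignores them. The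
  -- experiments then differ in the obfuscated circuit alone.
  let p : ℕ → PMF Sample := fun lam =>
    (PRF.gen lam).bind fun K => (unifBits (l lam)).bind fun s => (PE.gen lam).bind fun key =>
    (PE.enc lam key.1 (plaintext k lam s (i lam) (γ lam))).bind fun x =>
    (PE.puncture lam key.2 x).bind fun dk' => (PRF.puncture lam K [x]).map fun K' =>
    (K, key, s, x, K', dk')
  have hp : ∀ lam, ∀ w ∈ (p lam).support, IsSample PRF PE n lam w ∧
      w.2.2.1 ∈ (unifBits (l lam)).support ∧
      PE.dec lam w.2.1.2 w.2.2.2.1 = some (plaintext k lam w.2.2.1 (i lam) (γ lam)) := by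
    intro lam w hw
    simp only [p, PMF.mem_support_bind_iff, PMF.mem_support_map_iff] at hw
    obtain ⟨K, hK, s, hs, key, hkey, x, hx, dk', hdk', K', hK', rfl⟩ := hw
    have hpt := Tools.plaintext_length (k := k) lam hs (i lam) (γ lam)
    exact ⟨⟨hK, hkey, T.pe.enc_length lam _ _ hpt x hx, hK', hdk'⟩, hs,
      T.pe.correctness lam _ hpt key hkey x hx⟩
  have hps : ∀ s : ℕ → Sample, (∀ lam, s lam ∈ (p lam).support) → PolySizeSeq s := fun s hs =>
    T.sample_polySizeSeq (fun lam => (hp lam _ (hs lam)).1) T.l_poly.polySizeSeq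
      fun lam => length_of_mem_unifBits (hp lam _ (hs lam)).2.1
  let v : ℕ → Sample → List Bool := fun lam w =>
    bif c lam then PRF.F lam w.1 w.2.2.2.1 else (PRG lam).eval w.2.2.1
  have hvl : ∀ lam w, (v lam w).length = m lam := fun lam w => by
    simp only [v]
    cases c lam
    · exact T.PRG_length _ _
    · exact T.F_length _ _ _
  let C₁ : ℕ → Sample → Circuit := fun lam w => puncturedCircuit k PRF PRG PE P lam
    w.2.2.2.2.1 w.2.2.2.2.2 (msg lam) w.2.2.2.1 (v lam w)
  -- Where `i` is not an index of a message bit, both circuits are taken to be the punctured one, so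
  -- that equivalence is trivial there.
  let C₀ : ℕ → Sample → Circuit := fun lam w => if i lam < k lam then
    (markedCircuit k PRF PRG PE lam w.1 w.2.1.2 (msg lam)).pad (P lam) else C₁ lam w
  have h₁ : ∀ s : ℕ → Sample, (∀ lam, s lam ∈ (p lam).support) →
      PolySizeSeq fun lam => C₁ lam (s lam) := fun s hs =>
    T.punctured_polySizeSeq hP hm (hps s hs) (polySizeSeq_bits T.m_poly.polySizeSeq fun lam =>
      hvl lam (s lam))
  have h₀ : ∀ s : ℕ → Sample, (∀ lam, s lam ∈ (p lam).support) →
      PolySizeSeq fun lam => C₀ lam (s lam) := fun s hs =>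
    (T.marked_polySizeSeq hP hm (hps s hs)).ite (h₁ s hs)
  have ha : ∀ s : ℕ → Sample, (∀ lam, s lam ∈ (p lam).support) → PolySizeSeq fun lam =>
      ((s lam).2.1.1, γ lam, (s lam).2.2.2.1, (PRG lam).eval (s lam).2.2.1) := fun s hs =>
    (PolySizeSeq.comp (f := fun w : Sample => w.2.1.1) (by fun_prop) (hps s hs)).prodMk
      ((polySizeSeq_bool γ).prodMk ((PolySizeSeq.comp (f := fun w : Sample => w.2.2.2.1)
        (by fun_prop) (hps s hs)).prodMk (polySizeSeq_bits T.m_poly.polySizeSeq fun lam =>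
          T.PRG_length _ _)))
  -- Decryption of honest ciphertexts is perfectly correct, so there is no bad event.
  have key := T.io.indist_mix p (aux := fun lam w => (w.2.1.1, γ lam, w.2.2.2.1, (PRG lam).eval w.2.2.1)) h₀ h₁ ha (fun _ _ => false)
    (negligible_zero.of_abs_le fun lam => by
      rw [prTrue_map]; simp) (fun lam w hw _ => by
      simp only [C₀]
      split_ifs with hi
      · obtain ⟨hs, hs', hd⟩ := hp lam w hw
        refine hsz.equivalent T (hmsg lam) hs ?_ (hvl lam w)
        -- As `x` decrypts to `s ‖ i ‖ γ`, the marked circuit gives `F_K(x)` or `PRG(s)` there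
        -- according to whether `γ` is the message bit, which is the hardwired value.
        rw [hd, plaintext, markedValue_plaintext (length_of_mem_unifBits hs') hi]
        simp only [v, hc, Bool.cond_decide]
      · exact .refl _)
    (f := fun t : ℕ × (Val × Bool × List Bool × List Bool) × Circuit =>
      (t.2.1.1, t.2.2, t.2.1.2.1, t.2.1.2.2.1, t.2.1.2.2.2)) (by fun_prop)
  refine key.congr (fun lam => ?_) fun lam => ?_
  · split_ifs with hi
    · simp only [p, C₀, simView, obfView, if_pos hi, PMF.bind_bind, PMF.bind_map, Function.comp_def,
        PMF.bind_const]
    · simp only [p, C₀, C₁, v, simPuncturedView, obfView, if_neg hi, PMF.bind_bind, PMF.bind_map,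
        Function.comp_def, hc]
  · simp only [p, C₁, v, simPuncturedView, obfView, PMF.bind_bind, PMF.bind_map, Function.comp_def,
      hc]

/-- Obfuscation hides the puncturing of the keys in real samples. -/
theorem Tools.realPunctured_indist (T : Tools k l n m PRF PRG PE iO) (hP : PolyTime P)
    (hsz : SizeBound k n m PRF PRG PE P)
    (msg : ℕ → List Bool) (hmsg : ∀ lam, (msg lam).length = k lam) (γ c : ℕ → Bool) :
    Indist (fun lam => realPuncturedView k n m PRF PRG PE iO P lam (msg lam) (γ lam) (c lam))
      fun lam => realView k n m PRF PRG PE iO P lam (msg lam) (γ lam) (c lam) := by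
  have hm : PolySizeSeq msg := polySizeSeq_bits T.k_poly.polySizeSeq hmsg
  let p : ℕ → PMF Sample := fun lam =>
    (PE.gen lam).bind fun key => (unifBits (n lam)).bind fun x =>
    (PE.puncture lam key.2 x).bind fun dk' => (PRF.gen lam).bind fun K =>
    (PRF.puncture lam K [x]).bind fun K' =>
    (bif c lam then unifBits (m lam) else PMF.pure (PRF.F lam K x)).map fun y =>
    (K, key, y, x, K', dk')
  have hp : ∀ lam, ∀ w ∈ (p lam).support, IsSample PRF PE n lam w ∧ w.2.2.1.length = m lam := by
    intro lam w hw
    simp only [p, PMF.mem_support_bind_iff, PMF.mem_support_map_iff] at hw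
    obtain ⟨key, hkey, x, hx, dk', hdk', K, hK, K', hK', y, hy, rfl⟩ := hw
    refine ⟨⟨hK, hkey, length_of_mem_unifBits hx, hK', hdk'⟩, ?_⟩
    cases hc : c lam <;> rw [hc] at hy
    · have : y = PRF.F lam K x := by simpa using hy
      rw [this]; exact T.F_length _ _ _
    · exact length_of_mem_unifBits hy
  have hps : ∀ s : ℕ → Sample, (∀ lam, s lam ∈ (p lam).support) → PolySizeSeq s := fun s hs =>
    T.sample_polySizeSeq (fun lam => (hp lam _ (hs lam)).1) T.m_poly.polySizeSeq
      fun lam => (hp lam _ (hs lam)).2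
  let C₁ : ℕ → Sample → Circuit := fun lam w => puncturedCircuit k PRF PRG PE P lam
    w.2.2.2.2.1 w.2.2.2.2.2 (msg lam) w.2.2.2.1 (PRF.F lam w.1 w.2.2.2.1)
  let C₀ : ℕ → Sample → Circuit := fun lam w =>
    (markedCircuit k PRF PRG PE lam w.1 w.2.1.2 (msg lam)).pad (P lam)
  have h₁ : ∀ s : ℕ → Sample, (∀ lam, s lam ∈ (p lam).support) →
      PolySizeSeq fun lam => C₁ lam (s lam) := fun s hs =>
    T.punctured_polySizeSeq hP hm (hps s hs) (polySizeSeq_bits T.m_poly.polySizeSeq fun lam =>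
      T.F_length _ _ _)
  have h₀ : ∀ s : ℕ → Sample, (∀ lam, s lam ∈ (p lam).support) →
      PolySizeSeq fun lam => C₀ lam (s lam) := fun s hs => T.marked_polySizeSeq hP hm (hps s hs)
  have ha : ∀ s : ℕ → Sample, (∀ lam, s lam ∈ (p lam).support) → PolySizeSeq fun lam =>
      ((s lam).2.1.1, γ lam, (s lam).2.2.2.1, (s lam).2.2.1) := fun s hs =>
    (PolySizeSeq.comp (f := fun w : Sample => w.2.1.1) (by fun_prop) (hps s hs)).prodMk
      ((polySizeSeq_bool γ).prodMk (PolySizeSeq.comp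
        (f := fun w : Sample => (w.2.2.2.1, w.2.2.1)) (by fun_prop) (hps s hs)))
  -- The bad event is that the uniform input decrypts. All other draws integrate out of its
  -- probability, which leaves the experiment of sparseness. Outside this event the marked circuit
  -- gives `F_K(x)` at `x`.
  have key := T.io.indist_mix p (aux := fun lam w => (w.2.1.1, γ lam, w.2.2.2.1, w.2.2.1)) h₀ h₁ ha (fun lam w => (PE.dec lam w.2.1.2 w.2.2.2.1).isSome)
    (T.pe.sparseness.of_abs_le fun lam => le_of_eq (by
      congr 2
      simp only [p, PMF.map_bind, PMF.map_comp, Function.comp_def]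
      have e : ∀ (q : PMF (List Bool)) (b : Bool), q.map (fun _ => b) = PMF.pure b :=
        fun q b => PMF.map_const q b
      simp only [e, PMF.bind_const]
      rfl)) (fun lam w hw hd => by
      obtain ⟨hs, hs'⟩ := hp lam w hw
      refine hsz.equivalent T (hmsg lam) hs ?_ (T.F_length _ _ _)
      rw [Option.isSome_eq_false_iff, Option.isNone_iff_eq_none] at hd
      rw [hd, markedValue])
    (f := fun t : ℕ × (Val × Bool × List Bool × List Bool) × Circuit =>
      (t.2.1.1, t.2.2, t.2.1.2.1, t.2.1.2.2.1, t.2.1.2.2.2)) (by fun_prop)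
  refine key.symm.congr (fun lam => ?_) fun lam => ?_
  · simp only [p, C₁, realPuncturedView, obfView, PMF.bind_bind, PMF.bind_map, Function.comp_def]
  · simp only [p, C₀, realView, obfView, PMF.bind_bind, PMF.bind_map, Function.comp_def,
      PMF.bind_const]

/-- The flag that tells whether `γ` is the message bit is determined by fixed data, so it stays
constant along the chain and decides which value is hardwired. -/
theorem Tools.sim_indist_real (T : Tools k l n m PRF PRG PE iO) (hP : PolyTime P)
    (hsz : SizeBound k n m PRF PRG PE P)
    (msg : ℕ → List Bool) (hmsg : ∀ lam, (msg lam).length = k lam) (γ : ℕ → Bool) (i : ℕ → ℕ) :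
    Indist (fun lam => if i lam < k lam then
        simView k l PRF PRG PE iO P lam (msg lam) (γ lam) (i lam)
      else simPuncturedView k l PRF PRG PE iO P lam (msg lam) (γ lam)
        (decide (γ lam = (msg lam).getD (i lam) false)) (i lam))
      fun lam => realView k n m PRF PRG PE iO P lam (msg lam) (γ lam)
        (decide (γ lam = (msg lam).getD (i lam) false)) :=
  ((((T.sim_indist hP hsz msg hmsg γ i).trans (T.sim_indist_prg hP msg hmsg γ _ i)).trans
    (T.prg_indist_unif hP msg hmsg γ _)).trans (T.unif_indist_real hP msg hmsg γ _)).trans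
    (T.realPunctured_indist hP hsz msg hmsg γ _)

end hybrids

/-! ### The watermarking scheme: security, correctness and efficiency -/

section construction

variable {k l n m : ℕ → ℕ} {PRF : PuncturablePRF} {PRG : ℕ → Circuit} {PE : PuncturableEnc}
  {iO : ℕ → Circuit → PMF Circuit} {P : ℕ → ℕ}

theorem Tools.isSIMMDDPub (T : Tools k l n m PRF PRG PE iO) (hP : PolyTime P)
    (hsz : SizeBound k n m PRF PRG PE P) : (prfIO k l PRF PE iO PRG P).IsSIMMDDPub k n m := by
  intro i A
  -- The challenger's part of the game, as a function of the coin and the message. Separating it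
  -- from the adversary exposes the game as a guessing game between two distributions of views.
  let S : Bool → ℕ → List Bool → PMF View := fun coin lam msg =>
    (PRF.gen lam).bind fun K => (PE.gen lam).bind fun key =>
    (iO lam ((markedCircuit k PRF PRG PE lam K key.2 msg).pad (P lam))).bind fun C =>
    if coin then unifBit.bind fun γ => (unifBits (l lam)).bind fun s =>
      (PE.enc lam key.1 (plaintext k lam s (i lam) γ)).map fun x =>
      (key.1, C, γ, x, (PRG lam).eval s)
    else unifBit.bind fun γ => (unifBits (n lam)).bind fun x =>
      (if γ = msg.getD (i lam) false then unifBits (m lam) else PMF.pure (PRF.F lam K x)).map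
        fun y => (key.1, C, γ, x, y)
  have hexp : ∀ lam, (prfIO k l PRF PE iO PRG P).expSIMMDDPub n m A (i lam) lam =
      (A.first lam ((), ())).bind fun s => unifBit.bind fun coin =>
        ((S coin lam s.1).bind fun b => A.second lam ((), ()) s.1 b s.2).map fun coin' =>
          coin == coin' := by
    intro lam
    simp only [ExtractionLessWM.expSIMMDDPub, prfIO, ExtractionLessWM.dReal, pmf_bind_eq,
      pmf_pure_eq, PMF.pure_bind, PMF.bind_bind, S, PMF.map_bind]
    refine congrArg _ (funext fun s => ?_)
    rw [PMF.bind_comm unifBit]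
    refine congrArg _ (funext fun K => ?_)
    rw [PMF.bind_comm unifBit]
    refine congrArg _ (funext fun key => ?_)
    rw [PMF.bind_comm unifBit]
    refine congrArg _ (funext fun C => congrArg _ (funext fun coin => ?_))
    cases coin
    · simp only [Bool.false_eq_true, if_false, PMF.bind_bind, Function.comp_def,
        PMF.pure_bind, ← PMF.bind_pure_comp]
      refine congrArg _ (funext fun γ => congrArg _ (funext fun x => ?_))
      split_ifs <;> simp only [PMF.bind_bind, PMF.pure_bind]
    · simp only [if_true, PMF.bind_bind, Function.comp_def, PMF.pure_bind, plaintext,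
        ← PMF.bind_pure_comp]
  have hsim : ∀ lam msg, S true lam msg = unifBit.bind fun γ =>
      simView k l PRF PRG PE iO P lam msg γ (i lam) := by
    intro lam msg
    simp only [S, simView, obfView, if_true, ← PMF.bind_pure_comp, Function.comp_def]
    rw [PMF.bind_comm unifBit]
    refine congrArg _ (funext fun K => ?_)
    simp only [PMF.bind_comm (unifBits (l lam)) (PE.gen lam)]
    rw [PMF.bind_comm unifBit]
    refine congrArg _ (funext fun key => ?_)
    rw [PMF.bind_comm (iO _ _)]
    refine congrArg _ (funext fun γ => ?_)
    rw [PMF.bind_comm (iO _ _)]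
    refine congrArg _ (funext fun s => ?_)
    rw [PMF.bind_comm (iO _ _)]
  have hreal : ∀ lam msg, S false lam msg = unifBit.bind fun γ =>
      realView k n m PRF PRG PE iO P lam msg γ (decide (γ = msg.getD (i lam) false)) := by
    intro lam msg
    simp only [S, realView, obfView, Bool.false_eq_true, if_false, ← PMF.bind_pure_comp,
      Function.comp_def, Bool.cond_decide]
    simp only [PMF.bind_comm (unifBits (n lam)) (PRF.gen lam)]
    simp only [PMF.bind_comm (PE.gen lam) (PRF.gen lam)]
    rw [PMF.bind_comm unifBit]
    refine congrArg _ (funext fun K => ?_)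
    rw [PMF.bind_comm unifBit]
    refine congrArg _ (funext fun key => ?_)
    rw [PMF.bind_comm (iO _ _)]
    refine congrArg _ (funext fun γ => ?_)
    rw [PMF.bind_comm (iO _ _)]
    refine congrArg _ (funext fun x => ?_)
    rw [PMF.bind_comm (iO _ _)]
  -- From here on the message is a fixed sequence, and the quantum state left by the first stage is
  -- part of the advice of `D`.
  obtain ⟨msg, D, hmsg, hle⟩ := A.exists_distinguisher T.k_poly.polySizeSeq ((), ())
    fun lam msg g => unifBit.bind fun coin =>
      ((S coin lam msg).bind g).map fun coin' => coin == coin'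
  -- The label is uniform in both experiments, so it can be fixed before the hybrid argument, which
  -- then knows which of the two cases applies.
  have hind := Indist.mix (fun _ => unifBit) (fun γ _ => T.sim_indist_real hP hsz msg hmsg γ i)
    (X := fun lam γ => if i lam < k lam then
        simView k l PRF PRG PE iO P lam (msg lam) γ (i lam)
      else simPuncturedView k l PRF PRG PE iO P lam (msg lam) γ
        (decide (γ = (msg lam).getD (i lam) false)) (i lam))
    (Y := fun lam γ => realView k n m PRF PRG PE iO P lam (msg lam) γ
        (decide (γ = (msg lam).getD (i lam) false)))
  refine (hind D).of_abs_le fun lam => ?_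
  split_ifs with hi
  · have h := hle lam
    rw [← hexp] at h
    simp only [if_pos hi]
    rw [← hsim, ← hreal, abs_abs, ← prTrue_coin fun coin => (S coin lam (msg lam)).bind (D.run lam),
      abs_of_nonneg (by positivity)]
    linarith
  · simp

/-- A marked circuit can differ from the PRF only at inputs that decrypt, so the sparseness
probability itself serves as the error. -/
theorem Tools.evaluation_correctness (T : Tools k l n m PRF PRG PE iO) (msg : ℕ → List Bool) :
    ∃ ν : ℕ → ℝ, Negligible ν ∧
      ∀ lam, 1 - ν lam ≤ prTrue ((prfIO k l PRF PE iO PRG P).expEval n (msg lam) lam) := by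
  refine ⟨_, T.pe.sparseness, fun lam => ?_⟩
  let p : PMF (Val × (Val × Val) × Circuit × List Bool) :=
    (PRF.gen lam).bind fun K => (PE.gen lam).bind fun key =>
    (iO lam ((markedCircuit k PRF PRG PE lam K key.2 (msg lam)).pad (P lam))).bind fun C =>
    (unifBits (n lam)).map fun x => (K, key, C, x)
  have h := abs_prTrue_bind_sub_le_of_eq_off p
    (fun w => PMF.pure (decide (w.2.2.1.eval w.2.2.2 = PRF.F lam w.1 w.2.2.2)))
    (fun _ => PMF.pure true) {w | (PE.dec lam w.2.1.2 w.2.2.2).isSome = true} (by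
      intro w hw hd
      simp only [p, PMF.mem_support_bind_iff, PMF.mem_support_map_iff] at hw
      obtain ⟨K, hK, key, hkey, C, hC, x, hx, rfl⟩ := hw
      have hx' := length_of_mem_unifBits hx
      have hd' : PE.dec lam key.2 x = none := by simpa using hd
      have := (T.io.functionality lam _ C hC).2 x
        (hx'.trans (T.markedCircuit_arity lam K key.2 (msg lam)).1.symm)
      rw [T.markedCircuit_eval lam K key.2 (msg lam) (P lam) hx', hd', markedValue] at this
      simp [this])
  rw [← prTrue_map, PMF.bind_const] at h
  have h1 : prTrue (PMF.pure true) = 1 := by simp [prTrue]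
  have h2 : p.map (fun w => (PE.dec lam w.2.1.2 w.2.2.2).isSome) = (do
      let (_, dk) ← PE.gen lam
      let c ← unifBits (n lam)
      pure (PE.dec lam dk c).isSome) := by
    simp only [p, ← PMF.bind_pure_comp, PMF.bind_bind, PMF.pure_bind, Function.comp_def,
      PMF.bind_const, pmf_bind_eq, pmf_pure_eq]
  have h3 : p.bind (fun w => PMF.pure (decide (w.2.2.1.eval w.2.2.2 = PRF.F lam w.1 w.2.2.2))) =
      (prfIO k l PRF PE iO PRG P).expEval n (msg lam) lam := by
    simp only [p, ExtractionLessWM.expEval, prfIO, PMF.bind_bind, PMF.bind_map, Function.comp_def,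
      pmf_bind_eq, pmf_pure_eq, PMF.pure_bind]
    rfl
  rw [h1, h2, h3, abs_le] at h
  linarith [h.1]

theorem Tools.isExtractionLessWatermarkingPRF (T : Tools k l n m PRF PRG PE iO) (hP : PolyTime P) :
    (prfIO k l PRF PE iO PRG P).IsExtractionLessWatermarkingPRF k n m where
  setup_ppt := PPT.pure (by fun_prop)
  gen_ppt := by
    have : PPT fun a : ℕ × Unit => (PRF.gen a.1).bind fun K => (PE.gen a.1).bind fun key =>
        PMF.pure ((K, key.2), key.1) :=
      PPT.bind (T.prf.gen_ppt.comp (by fun_prop)) (PPT.bind (T.pe.gen_ppt.comp (by fun_prop))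
        (PPT.pure (by fun_prop)))
    exact this
  eval_poly := T.F_poly (by fun_prop) (by fun_prop) (by fun_prop)
  mark_ppt := by
    have h : PolyTime fun a : ℕ × Unit × (Val × Val) × List Bool =>
        (markedCircuit k PRF PRG PE a.1 a.2.2.1.1 a.2.2.1.2 a.2.2.2).pad (P a.1) :=
      PolyTime.pad (T.markedCircuit_poly (by fun_prop) (by fun_prop) (by fun_prop) (by fun_prop))
        (hP.comp (by fun_prop))
    exact T.io.ppt.comp (PolyTime.prodMk (by fun_prop) h)
  sim_ppt := by
    have hk : PolyTime fun a : (ℕ × Unit × Val × ℕ) × Bool => Nat.clog 2 (k a.1.1) :=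
      (T.k_poly.comp (by fun_prop)).clog
    have hG : PolyTime fun a : ((ℕ × Unit × Val × ℕ) × Bool) × List Bool =>
        (PRG a.1.1.1).eval a.2 :=
      (T.prg.poly.comp (by fun_prop)).circuitEval (by fun_prop)
    have hpt : PolyTime fun a : ((ℕ × Unit × Val × ℕ) × Bool) × List Bool =>
        (a.1.1.1, a.1.1.2.2.1, plaintext k a.1.1.1 a.2 a.1.1.2.2.2 a.1.2) := by
      refine PolyTime.prodMk (by fun_prop) (PolyTime.prodMk (by fun_prop) ?_)
      exact ((PolyTime.snd .id).append ((hk.comp (PolyTime.fst .id)).natBits (by fun_prop))).append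
        (by fun_prop)
    have : PPT fun a : ℕ × Unit × Val × ℕ => unifBit.bind fun γ => (unifBits (l a.1)).bind fun s =>
        (PE.enc a.1 a.2.2.1 (plaintext k a.1 s a.2.2.2 γ)).bind fun x =>
        PMF.pure (γ, x, (PRG a.1).eval s) :=
      PPT.bind PPT.unifBit (PPT.bind ((PPT.unifBits T.l_poly).comp (by fun_prop))
        (PPT.bind (T.pe.enc_ppt.comp hpt) (PPT.pure (PolyTime.prodMk (by fun_prop)
          (PolyTime.prodMk (by fun_prop) (hG.comp (by fun_prop)))))))
    exact this
  eval_length lam prfk x _ := T.F_length lam prfk.1 x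
  mark_arity lam _ prfk msg _ C hC := by
    obtain ⟨h1, h2⟩ := T.markedCircuit_arity lam prfk.1 prfk.2 msg
    have := (T.io.functionality lam _ C hC).1
    exact ⟨this.1.trans h1, this.2.trans h2⟩
  sim_length lam _ ek i _ r hr := by
    change r ∈ (unifBit.bind fun γ => (unifBits (l lam)).bind fun s =>
        (PE.enc lam ek (plaintext k lam s i γ)).bind fun x =>
        PMF.pure (γ, x, (PRG lam).eval s)).support at hr
    simp only [PMF.mem_support_bind_iff, PMF.mem_support_pure_iff] at hr
    obtain ⟨γ, _, s, hs, x, hx, rfl⟩ := hr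
    exact ⟨T.pe.enc_length lam _ _ (Tools.plaintext_length lam hs i γ) x hx, T.PRG_length lam s⟩
  evaluation_correctness msg _ := T.evaluation_correctness msg

end construction

end ELWM

theorem mainTheorem8 (k l n m : ℕ → ℕ) (hk : ELWM.PolyTime k)
    (PRF : ELWM.PuncturablePRF) (hPRF : PRF.IsSecure n m)
    (PRG : ℕ → ELWM.Circuit) (hPRG : ELWM.IsSecurePRG PRG l m)
    (PE : ELWM.PuncturableEnc)
    (hPE : PE.IsSecure (fun lam => l lam + Nat.clog 2 (k lam) + 1) n)
    (iO : ℕ → ELWM.Circuit → PMF ELWM.Circuit) (hiO : ELWM.IsSecureIO iO) :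
    ∃ P₀ : Polynomial ℕ, ∀ P : Polynomial ℕ, (∀ lam, P₀.eval lam ≤ P.eval lam) →
      (ELWM.prfIO k l PRF PE iO PRG fun lam => P.eval lam).IsExtractionLessWatermarkingPRF k n m ∧
      (ELWM.prfIO k l PRF PE iO PRG fun lam => P.eval lam).IsSIMMDDPub k n m := by
  have T : ELWM.Tools k l n m PRF PRG PE iO := ⟨hk, hPRF, hPRG, hPE, hiO⟩
  obtain ⟨P₀, h₀⟩ := T.exists_sizeBound
  refine ⟨P₀, fun P hP => ?_⟩
  have hPt : ELWM.PolyTime fun lam : ℕ => P.eval lam := ELWM.PolyTime.polyEval P .id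
  refine ⟨T.isExtractionLessWatermarkingPRF hPt, T.isSIMMDDPub hPt ?_⟩
  intro lam K hK key hkey msg hmsg
  obtain ⟨h1, h2⟩ := h₀ lam K hK key hkey msg hmsg
  exact ⟨h1.trans (hP lam), fun x v hx hv K' hK' dk' hdk' =>
    (h2 x v hx hv K' hK' dk' hdk').trans (hP lam)⟩
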